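/- Let $F=\partial_r\Phi:\mathbb R\times(0,\infty)\to\mathbb R$ be a force function of the form $$F(r,\xi)=\alpha(\xi)\,r+\beta(\xi)\,r^2+\partial_r\psi(r,\xi),$$ where $\alpha,\beta\ge 0$ are piecewise continuous on $(0,\infty)$, and $\partial_r\psi$ is continuously differentiable in $r$, continuous in $\xi$, with $\partial_r\psi(0,\xi)=0$ and $$|\partial_r^2\psi(r,\xi)|\le\gamma(\xi)\,r^2\qquad(\ast)$$ for all $\xi>0$ and $|r|\le 1$. Suppose that the integrals $\int_0^\infty\alpha(\xi)\xi^k\,d\xi$ for $k=2,4,6$ and $\int_0^\infty\beta(\xi)\xi^k\,d\xi$ for $k=\tfrac52,3,5$ are positive and finite, and that $\int_0^\infty\gamma(\xi)\xi^k\,d\xi$ is finite for $k=3,4$. Set $$c_0^2=\int_0^\infty\alpha(\xi)\xi^2\,d\xi,\quad c_\varepsilon=\sqrt{c_0^2+\varepsilon^2},\quad d_1=\frac{12}{\int_0^\infty\alpha(\xi)\xi^4\,d\xi},\quad d_2=\frac{12\int_0^\infty\beta(\xi)\xi^3\,d\xi}{\int_0^\infty\alpha(\xi)\xi^4\,d\xi},$$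 $$W_0(x)=\frac{3d_1}{2d_2}\,\operatorname{sech}^2\!\Big(\tfrac12\sqrt{d_1}\,x\Big).$$ For $W\in L^2(\mathbb R)$ let $U(x)=\int_0^xW(s)\,ds$. We say that $W$ solves the scaled traveling wave equation if $$\varepsilon^3c_\varepsilon^2\,U''(x)=\int_0^\infty\Big[F\big(\varepsilon U(x+\varepsilon\xi)-\varepsilon U(x),\xi\big)-F\big(\varepsilon U(x)-\varepsilon U(x-\varepsilon\xi),\xi\big)\Big]\,d\xi$$ holds in the sense of distributions on $\mathbb R$, that is, after multiplying by any $\varphi\in C_c^\infty(\mathbb R)$ and integrating in $x$ (on the right-hand side inside the $\xi$-integral, which is then required to converge absolutely; on the left-hand side $\int U\varphi''\,dx$ replaces $\int U''\varphi\,dx$). Then there exist constants $\varepsilon_0,\delta,C>0$ such that for every $0<\varepsilon\le\varepsilon_0$ there is an even function $W_\varepsilon\in L^2(\mathbb R)$ which solves the scaled traveling wave equation and satisfies $$\|W_\varepsilon-W_0\|_2\le\delta\qquad\text{and}\qquad\|W_\varepsilon-W_0\|_2\le C\varepsilon^2 .$$ Its bond elongations $\varepsilon U_\varepsilon(x+\varepsilon\xi)-\varepsilon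 U_\varepsilon(x)$ have modulus at most $1$ for all $x\in\mathbb R$, $\xi>0$. Moreover, $W_\varepsilon$ is unique: it is the only even $W\in L^2(\mathbb R)$ with $\|W-W_0\|_2\le\delta$ that solves the scaled traveling wave equation and whose bond elongations stay in the range of validity of $(\ast)$, meaning that $(\ast)$ holds whenever $\xi>0$ and $|r|\le|\varepsilon U(x+\varepsilon\xi)-\varepsilon U(x)|$ for some $x\in\mathbb R$. (The last condition is void if $(\ast)$ holds for all $r\in\mathbb R$, and it is satisfied if all bond elongations of $W$ have modulus at most $1$.) In particular, $\tilde u(t,y)=\varepsilon\,U_\varepsilon(\varepsilon y-\varepsilon c_\varepsilon t)$, with $U_\varepsilon(x)=\int_0^xW_\varepsilon(s)\,ds$, is for every $0<\varepsilon\le\varepsilon_0$ a solitary wave solution of the peridynamical equation $$\partial_t^2\tilde u(t,y)=\int_0^\infty\Big[F\big(\tilde u(t,y+\xi)-\tilde u(t,y),\xi\big)-F\big(\tilde u(t,y)-\tilde u(t,y-\xi),\xi\big)\Big]\,d\xi$$ in the (analogous) sense of distributions on $\mathbb R^2$. -/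

import Mathlib

open MeasureTheory Set Filter Topology
open scoped ContDiff ENNReal

namespace Peridynamics

/-- Piecewise continuity on `(0, ∞)`: only finitely many discontinuities in every compact
subinterval of `(0, ∞)`, and finite one-sided limits at every point of `(0, ∞)`.
(A singularity at the origin is allowed.) -/
def PiecewiseContinuous (f : ℝ → ℝ) : Prop :=
  (∀ a b : ℝ, 0 < a → {ξ | ξ ∈ Icc a b ∧ ¬ ContinuousAt f ξ}.Finite) ∧
  (∀ ξ : ℝ, 0 < ξ →
    (∃ l : ℝ, Tendsto f (𝓝[<] ξ) (𝓝 l)) ∧ (∃ l : ℝ, Tendsto f (𝓝[>] ξ) (𝓝 l)))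

/-- The constitutive assumption on the force function `F r ξ = ∂ᵣΦ(r, ξ)`, with linear coefficient
`α`, quadratic coefficient `β` and higher order part `p r ξ = ∂ᵣψ(r, ξ)`, whose `r`-derivative
`∂ᵣ²ψ` is bounded by means of `γ`. Only bonds `ξ > 0` matter. -/
structure ForceAssumption (F : ℝ → ℝ → ℝ) (α β γ : ℝ → ℝ) (p : ℝ → ℝ → ℝ) : Prop where
  decomposition : ∀ r ξ : ℝ, 0 < ξ → F r ξ = α ξ * r + β ξ * r ^ 2 + p r ξ
  alpha_piecewise : PiecewiseContinuous α
  beta_piecewise : PiecewiseContinuous β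
  alpha_nonneg : ∀ ξ : ℝ, 0 < ξ → 0 ≤ α ξ
  beta_nonneg : ∀ ξ : ℝ, 0 < ξ → 0 ≤ β ξ
  p_contDiff : ∀ ξ : ℝ, 0 < ξ → ContDiff ℝ 1 (fun r => p r ξ)
  p_continuousOn : ∀ r : ℝ, ContinuousOn (fun ξ => p r ξ) (Ioi 0)
  p_zero : ∀ ξ : ℝ, 0 < ξ → p 0 ξ = 0
  p_deriv_bound : ∀ r ξ : ℝ, 0 < ξ → |r| ≤ 1 → |deriv (fun s => p s ξ) r| ≤ γ ξ * r ^ 2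
  alpha_two : IntegrableOn (fun ξ => α ξ * ξ ^ 2) (Ioi 0)
  alpha_four : IntegrableOn (fun ξ => α ξ * ξ ^ 4) (Ioi 0)
  alpha_six : IntegrableOn (fun ξ => α ξ * ξ ^ 6) (Ioi 0)
  alpha_two_pos : 0 < ∫ ξ in Ioi (0 : ℝ), α ξ * ξ ^ 2
  alpha_four_pos : 0 < ∫ ξ in Ioi (0 : ℝ), α ξ * ξ ^ 4
  alpha_six_pos : 0 < ∫ ξ in Ioi (0 : ℝ), α ξ * ξ ^ 6
  beta_three : IntegrableOn (fun ξ => β ξ * ξ ^ 3) (Ioi 0)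
  beta_five_half : IntegrableOn (fun ξ => β ξ * ξ ^ (5 / 2 : ℝ)) (Ioi 0)
  beta_five : IntegrableOn (fun ξ => β ξ * ξ ^ 5) (Ioi 0)
  beta_three_pos : 0 < ∫ ξ in Ioi (0 : ℝ), β ξ * ξ ^ 3
  beta_five_half_pos : 0 < ∫ ξ in Ioi (0 : ℝ), β ξ * ξ ^ (5 / 2 : ℝ)
  beta_five_pos : 0 < ∫ ξ in Ioi (0 : ℝ), β ξ * ξ ^ 5
  gamma_three : IntegrableOn (fun ξ => γ ξ * ξ ^ 3) (Ioi 0)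
  gamma_four : IntegrableOn (fun ξ => γ ξ * ξ ^ 4) (Ioi 0)

/-- The wave speed `c_ε > 0`, where `c_ε² = c₀² + ε²` and `c₀² = ∫₀^∞ α(ξ) ξ² dξ`. -/
noncomputable def waveSpeed (α : ℝ → ℝ) (ε : ℝ) : ℝ :=
  Real.sqrt ((∫ ξ in Ioi (0 : ℝ), α ξ * ξ ^ 2) + ε ^ 2)

noncomputable def kdvCoeff₁ (α : ℝ → ℝ) : ℝ :=
  12 / ∫ ξ in Ioi (0 : ℝ), α ξ * ξ ^ 4

noncomputable def kdvCoeff₂ (α β : ℝ → ℝ) : ℝ :=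
  (12 * ∫ ξ in Ioi (0 : ℝ), β ξ * ξ ^ 3) / ∫ ξ in Ioi (0 : ℝ), α ξ * ξ ^ 4

/-- The KdV soliton `W₀(x) = (3 d₁ / (2 d₂)) sech² (√d₁ x / 2)`. -/
noncomputable def kdvSoliton (α β : ℝ → ℝ) (x : ℝ) : ℝ :=
  3 * kdvCoeff₁ α / (2 * kdvCoeff₂ α β) *
    (1 / Real.cosh (1 / 2 * Real.sqrt (kdvCoeff₁ α) * x)) ^ 2

/-- The scaled displacement profile `U` with `U' = W`, normalized by `U(0) = 0`. -/
noncomputable def profile (W : Lp ℝ 2 (volume : Measure ℝ)) (x : ℝ) : ℝ :=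
  ∫ t in (0 : ℝ)..x, W t

/-- The unscaled displacement field `u(t, y) = ε U(ε y - ε c_ε t)`. -/
noncomputable def displacement (α : ℝ → ℝ) (ε : ℝ) (W : Lp ℝ 2 (volume : Measure ℝ))
    (t y : ℝ) : ℝ :=
  ε * profile W (ε * y - ε * waveSpeed α ε * t)

/-- `W = U'` solves the scaled travelling wave equation
`ε³ c² U''(x) = ∫₀^∞ ∂ᵣΦ(ε U(x+εξ) - ε U(x), ξ) - ∂ᵣΦ(ε U(x) - ε U(x-εξ), ξ) dξ`
in the sense of distributions in `x` (`W` is merely square integrable, so `U''` is a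
distributional derivative); the bond integral is required to converge absolutely when tested. -/
def SolvesScaledEquation (F : ℝ → ℝ → ℝ) (ε c : ℝ) (W : Lp ℝ 2 (volume : Measure ℝ)) : Prop :=
  ∀ φ : ℝ → ℝ, ContDiff ℝ ∞ φ → HasCompactSupport φ →
    IntegrableOn (fun ξ : ℝ => ∫ x : ℝ,
      (F (ε * profile W (x + ε * ξ) - ε * profile W x) ξ
        - F (ε * profile W x - ε * profile W (x - ε * ξ)) ξ) * φ x) (Ioi 0) ∧
    ε ^ 3 * c ^ 2 * ∫ x : ℝ, profile W x * iteratedDeriv 2 φ x =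
      ∫ ξ in Ioi (0 : ℝ), ∫ x : ℝ,
        (F (ε * profile W (x + ε * ξ) - ε * profile W x) ξ
          - F (ε * profile W x - ε * profile W (x - ε * ξ)) ξ) * φ x

/-- `u` solves the peridynamical wave equation
`∂ₜ² u(t,y) = ∫₀^∞ ∂ᵣΦ(u(t,y+ξ) - u(t,y), ξ) - ∂ᵣΦ(u(t,y) - u(t,y-ξ), ξ) dξ`
in the sense of distributions in `(t, y)`. -/
def SolvesPeridynamicEquation (F : ℝ → ℝ → ℝ) (u : ℝ → ℝ → ℝ) : Prop :=
  ∀ φ : ℝ × ℝ → ℝ, ContDiff ℝ ∞ φ → HasCompactSupport φ →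
    IntegrableOn (fun ξ : ℝ => ∫ q : ℝ × ℝ,
      (F (u q.1 (q.2 + ξ) - u q.1 q.2) ξ - F (u q.1 q.2 - u q.1 (q.2 - ξ)) ξ) * φ q) (Ioi 0) ∧
    ∫ q : ℝ × ℝ, u q.1 q.2 * iteratedDeriv 2 (fun s => φ (s, q.2)) q.1 =
      ∫ ξ in Ioi (0 : ℝ), ∫ q : ℝ × ℝ,
        (F (u q.1 (q.2 + ξ) - u q.1 q.2) ξ - F (u q.1 q.2 - u q.1 (q.2 - ξ)) ξ) * φ q

/-- Elements of `L²_even(ℝ)`. -/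
def IsEven (W : Lp ℝ 2 (volume : Measure ℝ)) : Prop :=
  ∀ᵐ x : ℝ, W (-x) = W x

/-- All bond elongations `r = ε U(x+εξ) - ε U(x)` of the wave satisfy `|r| ≤ 1`. -/
def HasSmallStrains (ε : ℝ) (W : Lp ℝ 2 (volume : Measure ℝ)) : Prop :=
  ∀ x ξ : ℝ, 0 < ξ → |ε * profile W (x + ε * ξ) - ε * profile W x| ≤ 1

/-- All bond elongations of the wave stay in the range where `|∂ᵣ²ψ(r, ξ)| ≤ γ(ξ) r²`. -/
def StrainsInRange (γ : ℝ → ℝ) (p : ℝ → ℝ → ℝ) (ε : ℝ)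
    (W : Lp ℝ 2 (volume : Measure ℝ)) : Prop :=
  ∀ x ξ r : ℝ, 0 < ξ → |r| ≤ |ε * profile W (x + ε * ξ) - ε * profile W x| →
    |deriv (fun s => p s ξ) r| ≤ γ ξ * r ^ 2

/-- The `L²(ℝ)`-distance of `W` to the KdV soliton. -/
noncomputable def distSoliton (α β : ℝ → ℝ) (W : Lp ℝ 2 (volume : Measure ℝ)) : ℝ≥0∞ :=
  eLpNorm (fun x => W x - kdvSoliton α β x) 2 volume

end Peridynamics

/-! ### Translations, averages and bond operators on `L²(ℝ)` -/

namespace Peridynamics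

/-! Write W = U' and let A_η V be the increment x ↦ ∫_x^{x+η} V. Integrating the travelling wave
equation once and dividing by ε⁵ yields the weak equation B_ε W = Q_ε(W, W) + P_ε(W), with B_ε = 1 +
ε⁻⁴ ∫ α(ξ) ((εξ)² - A*A) dξ, A = A_{εξ}, a quadratic part Q_ε and a higher order part P_ε. Since
‖A_η V‖ ≤ η ‖V‖, the symmetric operator B_ε is at least 1. Expanding u ↦ ⟨V(· + u), φ⟩ to second
order shows that formally B_ε → 1 - κ⁻²∂² with κ² = d₁ and Q_ε(W, W) → q W² with q = ∫ β ξ³. The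
soliton W₀ solves the limit equation W = q (1 - κ⁻²∂²)⁻¹ W².

The limit is singular: each B_ε is bounded on L² and its inverse does not smooth. The substitute for
smoothing is that η² ‖V‖² - ‖A_η V‖² is an average of squared translation differences of V. Hence
B_ε V = f forces ‖V(· + t) - V‖ ≤ C (|t| + ε) ‖f‖ (`SolvesWave.exists_modulus`), and by duality
B_ε⁻¹ is within O(ε) of (1 - κ⁻²∂²)⁻¹ in operator norm (`SolvesWave.exists_norm_sub_green_le`). The
form Q_ε is only O(ε^{-1/2}) on L², but its composition with the limit resolvent is uniformly
bounded because that resolvent maps L² into L^∞; the O(ε) gap pays for the rest. So near W₀ the map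
W ↦ B_ε⁻¹ (Q_ε(W, W) + P_ε(W)) is Lipschitz close to its limiting linearization V ↦ 2q (1 - κ⁻²∂²)⁻¹
(W₀ V) (`GlobalLaw.exists_linearization`).

This linearization is compact by the exponential decay of W₀. An even fixed vector solves an ODE,
has zero Wronskian with W₀', is therefore a multiple of W₀' on the half-line, and vanishes by
evenness. Fredholm's alternative gives invertibility after composition with the even projection
(`exists_equiv_one_sub_kdvLin`). Since W₀ leaves a residual of order ε²
(`GlobalLaw.exists_residual`), a quantitative inverse function theorem gives existence, the rate and
local uniqueness together.

The bound (∗) is assumed only for |r| ≤ 1, so the law is first frozen outside [-1, 1]. Testing the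
equation with indicators of intervals then bounds all increments of U uniformly in ε and in the bond
length, because the linear part has total weight c₀², which is smaller than c_ε² by ε²
(`SolvesWeak.abs_bond_le`). For small ε the strains are at most 1 and the freezing is invisible. The
distributional equation matches the weak one since a square integrable function with zero
distributional derivative vanishes; the equation in the plane follows by integrating test functions
along characteristics. -/

/-- The real Hilbert space `L²(ℝ)`. -/
abbrev L2R : Type := Lp ℝ 2 (volume : Measure ℝ)

/-- Translation `V ↦ V(· + t)` on `L²(ℝ)`. -/
noncomputable def tr (t : ℝ) : L2R →ₗᵢ[ℝ] L2R :=
  Lp.compMeasurePreservingₗᵢ ℝ (fun x => x + t) (measurePreserving_add_right volume t)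

theorem tr_coe (t : ℝ) (V : L2R) : (tr t V : ℝ → ℝ) =ᵐ[volume] fun x => V (x + t) :=
  Lp.coeFn_compMeasurePreserving V (measurePreserving_add_right volume t)

theorem ae_comp_add {P : ℝ → Prop} (t : ℝ) (h : ∀ᵐ x : ℝ, P x) : ∀ᵐ x : ℝ, P (x + t) :=
  (measurePreserving_add_right volume t).quasiMeasurePreserving.ae h

theorem tr_tr (s t : ℝ) (V : L2R) : tr s (tr t V) = tr (s + t) V := by
  apply Lp.ext
  filter_upwards [tr_coe s (tr t V), tr_coe (s + t) V, ae_comp_add s (tr_coe t V)] with x h1 h2 h3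
  rw [h1, h2, h3, add_assoc]

theorem tr_zero (V : L2R) : tr 0 V = V := by
  apply Lp.ext
  filter_upwards [tr_coe 0 V] with x h1
  rw [h1, add_zero]

/-- Strong continuity of the translation group. Averages and derivatives below are taken of the
`L²`-valued orbit `t ↦ tr t V`, which avoids pointwise arguments and Sobolev spaces. -/
theorem continuous_tr (V : L2R) : Continuous fun t => tr t V := by
  have h2 : Continuous fun t : ℝ => (⟨fun x => x + t, by fun_prop⟩ : C(ℝ, ℝ)) := by
    refine ContinuousMap.continuous_of_continuous_uncurry _ ?_
    simp only [Function.uncurry_def, ContinuousMap.coe_mk]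
    fun_prop
  exact Continuous.compMeasurePreservingLp (f := fun _ : ℝ => V)
    (g := fun t : ℝ => (⟨fun x => x + t, by fun_prop⟩ : C(ℝ, ℝ))) continuous_const h2
    (fun t => measurePreserving_add_right volume t) (by simp)

theorem norm_tr (t : ℝ) (V : L2R) : ‖tr t V‖ = ‖V‖ := (tr t).norm_map V

theorem inner_tr_left (t : ℝ) (V φ : L2R) : inner ℝ (tr t V) φ = inner ℝ V (tr (-t) φ) := by
  rw [← (tr t).inner_map_map V (tr (-t) φ), tr_tr, add_neg_cancel, tr_zero]

theorem inner_tr_tr (s t : ℝ) (V φ : L2R) :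
    inner ℝ (tr s V) (tr t φ) = inner ℝ (tr (s - t) V) φ := by
  rw [inner_tr_left, inner_tr_left, tr_tr]; congr 2; ring_nf

theorem inner_eq_integral (V φ : L2R) : inner ℝ V φ = ∫ x, V x * φ x := by
  rw [L2.inner_def]
  congr 1; ext x; simp [mul_comm]

theorem integrable_smul_tr {w : ℝ → ℝ} {μ : Measure ℝ} (hw : Integrable w μ) (V : L2R) :
    Integrable (fun t => w t • tr t V) μ := by
  refine Integrable.mono' (hw.norm.mul_const ‖V‖)
    (hw.aestronglyMeasurable.smul (continuous_tr V).aestronglyMeasurable) ?_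
  refine Eventually.of_forall fun t => ?_
  rw [norm_smul, norm_tr]

open Classical in
/-- The weighted translation average `V ↦ ∫ w(t) V(· + t) dt` for integrable `w`. -/
noncomputable def trAvg (w : ℝ → ℝ) : L2R →L[ℝ] L2R :=
  if hw : Integrable w then
    LinearMap.mkContinuous
      { toFun := fun V => ∫ t, w t • tr t V
        map_add' := fun V V' => by
          rw [← integral_add (integrable_smul_tr hw V) (integrable_smul_tr hw V')]
          simp
        map_smul' := fun c V => by
          rw [RingHom.id_apply, ← integral_smul]
          congr 1; ext1 t; rw [map_smul, smul_comm] }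
      (∫ t, |w t|) (fun V => by
        refine (norm_integral_le_integral_norm _).trans (le_of_eq ?_)
        rw [← integral_mul_const]
        congr 1; ext1 t; rw [norm_smul, norm_tr, Real.norm_eq_abs])
  else 0

theorem trAvg_apply {w : ℝ → ℝ} (hw : Integrable w) (V : L2R) :
    trAvg w V = ∫ t, w t • tr t V := by
  simp [trAvg, hw]

theorem norm_trAvg_le {w : ℝ → ℝ} (hw : Integrable w) (V : L2R) :
    ‖trAvg w V‖ ≤ (∫ t, |w t|) * ‖V‖ := by
  rw [trAvg_apply hw]
  refine (norm_integral_le_integral_norm _).trans (le_of_eq ?_)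
  rw [← integral_mul_const]
  congr 1; ext1 t; rw [norm_smul, norm_tr, Real.norm_eq_abs]

/-! ### Pointwise representatives of translation averages -/

theorem measurable_coe (V : L2R) : Measurable (V : ℝ → ℝ) := (Lp.stronglyMeasurable V).measurable

theorem integrableOn_coe (V : L2R) {s : Set ℝ} (hs : volume s ≠ ⊤) :
    IntegrableOn (V : ℝ → ℝ) s := by
  have : Fact (volume s < ⊤) := ⟨hs.lt_top⟩
  exact ((Lp.memLp V).restrict s).integrable (by norm_num)

theorem intervalIntegrable_coe (V : L2R) (a b : ℝ) : IntervalIntegrable (V : ℝ → ℝ) volume a b :=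
  ⟨integrableOn_coe V (by simp), integrableOn_coe V (by simp)⟩

theorem setIntegral_eq_inner (V : L2R) {s : Set ℝ} (hs : MeasurableSet s) (hμ : volume s ≠ ⊤) :
    ∫ x in s, V x = inner ℝ (indicatorConstLp 2 hs hμ (1 : ℝ)) V :=
  (L2.inner_indicatorConstLp_one hs hμ V).symm

/-- A Bochner integral in `L²` has no immediate pointwise meaning, so both sides are integrated over
sets of finite measure. Pairing with an indicator commutes with the Bochner integral, and Fubini
treats the pointwise one. -/
theorem trAvg_coe {w : ℝ → ℝ} (hw : Integrable w) (V : L2R) :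
    (trAvg w V : ℝ → ℝ) =ᵐ[volume] fun x => ∫ t, w t * V (x + t) := by
  have key : ∀ s, MeasurableSet s → volume s < ⊤ →
      Integrable (fun q : ℝ × ℝ => w q.2 * V (q.1 + q.2)) ((volume.restrict s).prod volume) := by
    intro s hs hμ
    have hae : AEStronglyMeasurable (fun q : ℝ × ℝ => w q.2 * V (q.1 + q.2))
        ((volume.restrict s).prod volume) :=
      hw.aestronglyMeasurable.comp_snd.mul
        ((measurable_coe V).comp (measurable_fst.add measurable_snd)).aestronglyMeasurable
    have hnorm : ∀ t : ℝ, ∫ x in s, ‖V (x + t)‖ ≤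
        ‖indicatorConstLp 2 hs hμ.ne (1 : ℝ)‖ * ‖V‖ := by
      intro t
      let A : L2R := |tr t V|
      have hA : ∫ x in s, ‖V (x + t)‖ = ∫ x in s, A x := by
        apply setIntegral_congr_ae hs
        filter_upwards [Lp.coeFn_abs (tr t V), tr_coe t V] with x h1 h2 _
        rw [h1, h2, Real.norm_eq_abs]
      rw [hA, setIntegral_eq_inner A hs hμ.ne]
      refine (real_inner_le_norm _ _).trans (le_of_eq ?_)
      rw [norm_abs_eq_norm, norm_tr]
    rw [integrable_prod_iff' hae]
    constructor
    · refine Eventually.of_forall fun t => Integrable.const_mul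
        (f := fun x => V (x + t)) (c := w t) ?_
      exact (integrableOn_coe (tr t V) hμ.ne).congr (ae_restrict_of_ae (tr_coe t V))
    · refine Integrable.mono' (hw.norm.mul_const (‖indicatorConstLp 2 hs hμ.ne (1 : ℝ)‖ * ‖V‖))
        hae.norm.prod_swap.integral_prod_right' (Eventually.of_forall fun t => ?_)
      simp only [norm_mul]
      rw [integral_const_mul, norm_mul, norm_norm]
      gcongr
      rw [Real.norm_of_nonneg (by positivity)]
      exact hnorm t
  refine ae_eq_of_forall_setIntegral_eq_of_sigmaFinite
    (fun s _ hμ => integrableOn_coe _ hμ.ne) (fun s hs hμ => (key s hs hμ).integral_prod_left)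
    fun s hs hμ => ?_
  rw [setIntegral_eq_inner _ hs hμ.ne, trAvg_apply hw, ← integral_inner (integrable_smul_tr hw V)]
  rw [integral_integral_swap (key s hs hμ)]
  congr 1; ext1 t
  rw [inner_smul_right, integral_const_mul, ← setIntegral_eq_inner _ hs hμ.ne]
  congr 1
  exact setIntegral_congr_ae hs ((tr_coe t V).mono fun x h _ => h)

theorem inner_trAvg_left {w : ℝ → ℝ} (hw : Integrable w) (V φ : L2R) :
    inner ℝ (trAvg w V) φ = ∫ t, w t * inner ℝ (tr t V) φ := by
  rw [trAvg_apply hw, real_inner_comm, ← integral_inner (integrable_smul_tr hw V)]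
  congr 1; ext1 t; rw [inner_smul_right, real_inner_comm]

theorem tr_trAvg {w : ℝ → ℝ} (hw : Integrable w) (s : ℝ) (V : L2R) :
    tr s (trAvg w V) = trAvg w (tr s V) := by
  rw [trAvg_apply hw, trAvg_apply hw]
  have := ((tr s).toContinuousLinearMap.integral_comp_comm (integrable_smul_tr hw V)).symm
  simp only [LinearIsometry.coe_toContinuousLinearMap] at this
  rw [this]
  congr 1; ext1 t; rw [map_smul, tr_tr, tr_tr, add_comm]

/-! ### Bond elongations and bond operators -/

/-- The bond elongation `x ↦ U(x + η) - U(x)` of the profile `U` of `V`. -/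
noncomputable def bond (η : ℝ) (V : L2R) (x : ℝ) : ℝ := profile V (x + η) - profile V x

theorem bond_eq (η : ℝ) (V : L2R) (x : ℝ) : bond η V x = ∫ t in x..(x + η), V t :=
  intervalIntegral.integral_interval_sub_left (intervalIntegrable_coe V _ _)
    (intervalIntegrable_coe V _ _)

theorem bond_eq' (η : ℝ) (V : L2R) (x : ℝ) : bond η V x = ∫ t in (0 : ℝ)..η, V (x + t) := by
  rw [bond_eq, intervalIntegral.integral_comp_add_left (fun t => V t)]; simp

theorem continuous_profile (V : L2R) : Continuous (profile V) :=
  intervalIntegral.continuous_primitive (fun a b => intervalIntegrable_coe V a b) 0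

theorem continuous_bond_uncurry (V : L2R) : Continuous fun q : ℝ × ℝ => bond q.1 V q.2 := by
  unfold bond
  have := continuous_profile V
  fun_prop

theorem continuous_bond (η : ℝ) (V : L2R) : Continuous (bond η V) :=
  (continuous_bond_uncurry V).comp (by fun_prop : Continuous fun x : ℝ => (η, x))

/-- The bond elongation as a bounded operator on `L²(ℝ)`. -/
noncomputable def bondOp (η : ℝ) : L2R →L[ℝ] L2R := trAvg ((Ioc 0 η).indicator 1)

theorem integrable_indicator_Ioc (η : ℝ) :
    Integrable ((Ioc (0 : ℝ) η).indicator (1 : ℝ → ℝ)) := by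
  rw [integrable_indicator_iff measurableSet_Ioc]
  exact integrableOn_const (by simp)

theorem bondOp_apply {η : ℝ} (hη : 0 ≤ η) (V : L2R) :
    bondOp η V = ∫ t in (0 : ℝ)..η, tr t V := by
  rw [bondOp, trAvg_apply (integrable_indicator_Ioc η), intervalIntegral.integral_of_le hη,
    ← integral_indicator measurableSet_Ioc]
  congr 1; ext1 t
  by_cases h : t ∈ Ioc 0 η <;> simp [h]

theorem bondOp_coe {η : ℝ} (hη : 0 ≤ η) (V : L2R) :
    (bondOp η V : ℝ → ℝ) =ᵐ[volume] bond η V := by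
  filter_upwards [trAvg_coe (integrable_indicator_Ioc η) V] with x hx
  rw [bondOp, hx, bond_eq', intervalIntegral.integral_of_le hη,
    ← integral_indicator measurableSet_Ioc]
  congr 1; ext1 t
  by_cases h : t ∈ Ioc 0 η <;> simp [h]

theorem intervalIntegrable_tr (V : L2R) (a b : ℝ) :
    IntervalIntegrable (fun t => tr t V) volume a b := (continuous_tr V).intervalIntegrable a b

theorem norm_bondOp_le {η : ℝ} (hη : 0 ≤ η) (V : L2R) : ‖bondOp η V‖ ≤ η * ‖V‖ := by
  rw [bondOp_apply hη]
  refine (intervalIntegral.norm_integral_le_of_norm_le_const (C := ‖V‖) fun t _ => ?_).trans ?_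
  · rw [norm_tr]
  · rw [sub_zero, abs_of_nonneg hη, mul_comm]

/-- Cauchy–Schwarz on an interval of length `η`. The resulting half power is the origin of the
moment 5/2 of `β`; used twice it leads to the moment 3 of `γ`. -/
theorem abs_bond_le {η : ℝ} (hη : 0 ≤ η) (V : L2R) (x : ℝ) :
    |bond η V x| ≤ Real.sqrt η * ‖V‖ := by
  rw [bond_eq, intervalIntegral.integral_of_le (by linarith),
    setIntegral_eq_inner V measurableSet_Ioc (by simp)]
  refine (abs_real_inner_le_norm _ _).trans (le_of_eq ?_)
  rw [norm_indicatorConstLp (by norm_num) (by norm_num)]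
  simp [hη, Real.sqrt_eq_rpow]

theorem norm_bondOp_sub_le {η M : ℝ} (hη : 0 ≤ η) (V : L2R)
    (h : ∀ t, 0 ≤ t → t ≤ η → ‖tr t V - V‖ ≤ M) : ‖bondOp η V - η • V‖ ≤ η * M := by
  have : bondOp η V - η • V = ∫ t in (0 : ℝ)..η, (tr t V - V) := by
    rw [intervalIntegral.integral_sub (intervalIntegrable_tr V _ _) (by simp), bondOp_apply hη]
    simp
  rw [this]
  refine (intervalIntegral.norm_integral_le_of_norm_le_const (C := M) fun t ht => ?_).trans ?_
  · rw [uIoc_of_le hη] at ht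
    exact h t ht.1.le ht.2
  · rw [sub_zero, abs_of_nonneg hη, mul_comm]

end Peridynamics

/-! ### The resolvent of `1 - κ⁻² ∂²` -/

namespace Peridynamics

section ExponentialAverages

variable {E : Type*} [NormedAddCommGroup E] [NormedSpace ℝ E]

/-- The one-sided exponential average `∫₀^∞ e^{-κ s} f(t + s) ds`. -/
noncomputable def expAvg (κ : ℝ) (f : ℝ → E) (t : ℝ) : E :=
  ∫ s in Ioi (0 : ℝ), Real.exp (-κ * s) • f (t + s)

theorem integrableOn_exp_smul {κ M : ℝ} (hκ : 0 < κ) {f : ℝ → E} (hf : Continuous f)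
    (hM : ∀ t, ‖f t‖ ≤ M) (a : ℝ) :
    IntegrableOn (fun s => Real.exp (-κ * s) • f s) (Ioi a) := by
  refine Integrable.mono' ((integrableOn_exp_mul_Ioi (neg_lt_zero.2 hκ) a).mul_const M)
    (by fun_prop) (Eventually.of_forall fun s => ?_)
  rw [norm_smul, Real.norm_of_nonneg (Real.exp_pos _).le]
  gcongr
  exact hM s

theorem norm_expAvg_le {κ M : ℝ} (hκ : 0 < κ) {f : ℝ → E}
    (hM : ∀ t, ‖f t‖ ≤ M) (t : ℝ) : ‖expAvg κ f t‖ ≤ M / κ := by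
  refine (norm_integral_le_of_norm_le
    ((integrableOn_exp_mul_Ioi (neg_lt_zero.2 hκ) 0).mul_const M)
    (Eventually.of_forall fun s => ?_)).trans (le_of_eq ?_)
  · rw [norm_smul, Real.norm_of_nonneg (Real.exp_pos _).le]
    gcongr
    exact hM _
  · rw [integral_mul_const, integral_exp_mul_Ioi (neg_lt_zero.2 hκ)]
    field_simp
    simp

/-- A shift of variables turns the average into `e^{κt} ∫_t^∞ e^{-κs} f(s) ds`, to which the product
rule applies. The values lie in a Banach space because `f` will be an orbit of translations. -/
theorem hasDerivAt_expAvg [CompleteSpace E] {κ M : ℝ} (hκ : 0 < κ) {f : ℝ → E}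
    (hf : Continuous f) (hM : ∀ t, ‖f t‖ ≤ M) (t : ℝ) :
    HasDerivAt (expAvg κ f) (κ • expAvg κ f t - f t) t := by
  set g : ℝ → E := fun s => Real.exp (-κ * s) • f s with hg
  have hgc : Continuous g := by fun_prop
  have hgi : ∀ a, IntegrableOn g (Ioi a) := integrableOn_exp_smul hκ hf hM
  have hform : ∀ t, expAvg κ f t = Real.exp (κ * t) • ((∫ s in Ioi (0 : ℝ), g s) -
      ∫ s in (0 : ℝ)..t, g s) := by
    intro t
    rw [← intervalIntegral.integral_Ioi_sub_Ioi' (hgi 0) (hgi t), sub_sub_cancel]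
    have h := (measurePreserving_add_left volume t).setIntegral_preimage_emb
      (measurableEmbedding_addLeft t) g (Ioi t)
    rw [← h, expAvg, ← integral_smul]
    have : (fun x => t + x) ⁻¹' Ioi t = Ioi 0 := by ext x; simp
    rw [this]
    congr 1; ext1 s
    rw [hg, smul_smul, ← Real.exp_add]
    congr 2; ring
  have h1 : HasDerivAt (fun t => ∫ s in (0 : ℝ)..t, g s) (g t) t :=
    intervalIntegral.integral_hasDerivAt_right (hgc.intervalIntegrable _ _)
      hgc.stronglyMeasurable.stronglyMeasurableAtFilter hgc.continuousAt
  have h2 : HasDerivAt (fun t => Real.exp (κ * t)) (Real.exp (κ * t) * κ) t := by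
    simpa using ((hasDerivAt_id t).const_mul κ).exp
  have h3 := h2.smul (h1.const_sub (∫ s in Ioi (0 : ℝ), g s))
  rw [show expAvg κ f = fun t => _ from funext hform]
  refine h3.congr_deriv ?_
  rw [hg, smul_neg, smul_smul (Real.exp _), ← Real.exp_add]
  simp only [neg_mul, add_neg_cancel, Real.exp_zero, one_smul]
  rw [smul_smul, mul_comm]
  abel

/-- The resolvent `(1 - κ⁻² ∂²)⁻¹ f`, given by the kernel `κ/2 · e^{-κ|t|}`. -/
noncomputable def greenAvg (κ : ℝ) (f : ℝ → E) (t : ℝ) : E :=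
  (κ / 2) • (expAvg κ f t + expAvg κ (fun s => f (-s)) (-t))

/-- The derivative of `greenAvg`. -/
noncomputable def greenAvgDeriv (κ : ℝ) (f : ℝ → E) (t : ℝ) : E :=
  (κ ^ 2 / 2) • (expAvg κ f t - expAvg κ (fun s => f (-s)) (-t))

theorem hasDerivAt_expAvg_neg [CompleteSpace E] {κ M : ℝ} (hκ : 0 < κ) {f : ℝ → E}
    (hf : Continuous f) (hM : ∀ t, ‖f t‖ ≤ M) (t : ℝ) :
    HasDerivAt (fun t => expAvg κ (fun s => f (-s)) (-t))
      (f t - κ • expAvg κ (fun s => f (-s)) (-t)) t := by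
  have h := hasDerivAt_expAvg hκ (f := fun s => f (-s)) (by fun_prop) (fun s => hM _) (-t)
  have := h.scomp t (hasDerivAt_neg t)
  refine this.congr_deriv ?_
  simp

theorem hasDerivAt_greenAvg [CompleteSpace E] {κ M : ℝ} (hκ : 0 < κ) {f : ℝ → E}
    (hf : Continuous f) (hM : ∀ t, ‖f t‖ ≤ M) (t : ℝ) :
    HasDerivAt (greenAvg κ f) (greenAvgDeriv κ f t) t := by
  have := ((hasDerivAt_expAvg hκ hf hM t).add (hasDerivAt_expAvg_neg hκ hf hM t)).const_smul (κ / 2)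
  refine this.congr_deriv ?_
  rw [greenAvgDeriv]
  module

theorem hasDerivAt_greenAvgDeriv [CompleteSpace E] {κ M : ℝ} (hκ : 0 < κ) {f : ℝ → E}
    (hf : Continuous f) (hM : ∀ t, ‖f t‖ ≤ M) (t : ℝ) :
    HasDerivAt (greenAvgDeriv κ f) (κ ^ 2 • (greenAvg κ f t - f t)) t := by
  have := ((hasDerivAt_expAvg hκ hf hM t).sub
    (hasDerivAt_expAvg_neg hκ hf hM t)).const_smul (κ ^ 2 / 2)
  refine this.congr_deriv ?_
  rw [greenAvg]
  module

theorem norm_greenAvgDeriv_le {κ M : ℝ} (hκ : 0 < κ) {f : ℝ → E}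
    (hM : ∀ t, ‖f t‖ ≤ M) (t : ℝ) : ‖greenAvgDeriv κ f t‖ ≤ κ * M := by
  rw [greenAvgDeriv, norm_smul, Real.norm_of_nonneg (by positivity)]
  have h1 := norm_expAvg_le hκ hM t
  have h2 := norm_expAvg_le hκ (f := fun s => f (-s)) (fun s => hM _) (-t)
  calc κ ^ 2 / 2 * ‖expAvg κ f t - expAvg κ (fun s => f (-s)) (-t)‖
      ≤ κ ^ 2 / 2 * (M / κ + M / κ) := by
        gcongr
        exact (norm_sub_le _ _).trans (add_le_add h1 h2)
    _ = κ * M := by field_simp; ring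

/-- The Green's kernel of `1 - κ⁻² ∂²`. -/
noncomputable def greenKernel (κ t : ℝ) : ℝ := κ / 2 * Real.exp (-κ * |t|)

theorem continuous_greenKernel (κ : ℝ) : Continuous (greenKernel κ) := by
  unfold greenKernel; fun_prop

theorem greenKernel_neg (κ t : ℝ) : greenKernel κ (-t) = greenKernel κ t := by
  simp [greenKernel]

theorem greenKernel_nonneg {κ : ℝ} (hκ : 0 < κ) (t : ℝ) : 0 ≤ greenKernel κ t := by
  unfold greenKernel; positivity

theorem integrable_of_even {f : ℝ → ℝ} (hf : ∀ t, f (-t) = f t)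
    (h : IntegrableOn f (Ioi 0)) : Integrable f := by
  have h2 : IntegrableOn f (Iic 0) := by
    have h3 : IntegrableOn f ((fun x => -x) ⁻¹' Ici 0) := by
      refine ((Measure.measurePreserving_neg (volume : Measure ℝ)).integrableOn_comp_preimage
        (MeasurableEquiv.neg ℝ).measurableEmbedding).2 ?_ |>.congr_fun (f := f ∘ Neg.neg)
        (fun x _ => hf x) (by simp)
      rwa [integrableOn_Ici_iff_integrableOn_Ioi]
    simpa using h3
  rw [← integrableOn_univ, ← Iic_union_Ioi (a := (0 : ℝ))]
  exact h2.union h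

theorem integrable_exp_neg_abs {κ : ℝ} (hκ : 0 < κ) :
    Integrable fun t : ℝ => Real.exp (-κ * |t|) := by
  refine integrable_of_even (by simp) ?_
  refine (integrableOn_exp_mul_Ioi (neg_lt_zero.2 hκ) 0).congr_fun (fun t ht => ?_)
    measurableSet_Ioi
  simp only [abs_of_pos (mem_Ioi.1 ht)]

theorem integrable_greenKernel {κ : ℝ} (hκ : 0 < κ) : Integrable (greenKernel κ) :=
  (integrable_exp_neg_abs hκ).const_mul _

theorem integral_greenKernel {κ : ℝ} (hκ : 0 < κ) : ∫ t, greenKernel κ t = 1 := by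
  unfold greenKernel
  rw [integral_const_mul, integral_comp_abs (f := fun t => Real.exp (-κ * t)),
    integral_exp_mul_Ioi (neg_lt_zero.2 hκ)]
  field_simp
  simp

theorem memLp_greenKernel {κ : ℝ} (hκ : 0 < κ) : MemLp (greenKernel κ) 2 := by
  rw [memLp_two_iff_integrable_sq (continuous_greenKernel κ).aestronglyMeasurable]
  refine ((integrable_exp_neg_abs (by positivity : 0 < 2 * κ)).const_mul (κ ^ 2 / 4)).congr ?_
  refine Eventually.of_forall fun t => ?_
  simp only [greenKernel, mul_pow, ← Real.exp_nat_mul]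
  push_cast
  rw [show 2 * (-κ * |t|) = -(2 * κ) * |t| by ring]; ring

theorem integral_greenKernel_smul {κ M : ℝ} (hκ : 0 < κ) {f : ℝ → E} (hf : Continuous f)
    (hM : ∀ t, ‖f t‖ ≤ M) (t : ℝ) :
    ∫ s, greenKernel κ s • f (t + s) = greenAvg κ f t := by
  have hint : Integrable fun s => greenKernel κ s • f (t + s) := by
    refine Integrable.mono' ((integrable_greenKernel hκ).mul_const M)
      (((continuous_greenKernel κ).smul (by fun_prop)).aestronglyMeasurable)
      (Eventually.of_forall fun s => ?_)
    rw [norm_smul, Real.norm_of_nonneg (greenKernel_nonneg hκ s)]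
    exact mul_le_mul_of_nonneg_left (hM _) (greenKernel_nonneg hκ s)
  rw [← intervalIntegral.integral_Iic_add_Ioi hint.integrableOn hint.integrableOn (b := 0),
    ← neg_zero, ← integral_comp_neg_Ioi, neg_zero, greenAvg, smul_add, add_comm]
  congr 1
  · rw [expAvg, ← integral_smul]
    refine setIntegral_congr_fun measurableSet_Ioi fun s hs => ?_
    simp only [greenKernel, abs_of_pos (mem_Ioi.1 hs), smul_smul]
  · rw [expAvg, ← integral_smul]
    refine setIntegral_congr_fun measurableSet_Ioi fun s hs => ?_
    simp only [greenKernel, abs_neg, abs_of_pos (mem_Ioi.1 hs), smul_smul]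
    congr 2; ring

/-- One integration of a power bound. Applied twice in succession it produces second order Taylor
remainders for vector-valued functions. -/
theorem norm_le_of_norm_deriv_le {f f' : ℝ → E} {M h : ℝ} (n : ℕ) (h0 : f 0 = 0)
    (hf : ∀ t, 0 ≤ t → HasDerivAt f (f' t) t)
    (hM : ∀ t, 0 ≤ t → t ≤ h → ‖f' t‖ ≤ M * t ^ n) :
    ∀ t, 0 ≤ t → t ≤ h → ‖f t‖ ≤ M / (n + 1) * t ^ (n + 1) := by
  intro t ht hth
  refine image_norm_le_of_norm_deriv_right_le_deriv_boundary (a := 0) (b := h) (f := f) (f' := f')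
    (B := fun t => M / (n + 1) * t ^ (n + 1)) (B' := fun t => M * t ^ n) ?_ ?_ ?_ ?_ ?_ ⟨ht, hth⟩
  · exact fun x hx => (hf x hx.1).continuousAt.continuousWithinAt
  · exact fun x hx => (hf x hx.1).hasDerivWithinAt
  · simp [h0]
  · intro x
    refine ((hasDerivAt_pow (n + 1) x).const_mul (M / (n + 1))).congr_deriv ?_
    push_cast
    field_simp
  · exact fun x hx => hM x hx.1 hx.2.le

end ExponentialAverages

/-- The resolvent `(1 - κ⁻² ∂²)⁻¹` on `L²(ℝ)`. -/
noncomputable def green (κ : ℝ) : L2R →L[ℝ] L2R := trAvg (greenKernel κ)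

theorem norm_green_le {κ : ℝ} (hκ : 0 < κ) (V : L2R) : ‖green κ V‖ ≤ ‖V‖ := by
  refine (norm_trAvg_le (integrable_greenKernel hκ) V).trans (le_of_eq ?_)
  simp_rw [abs_of_nonneg (greenKernel_nonneg hκ _)]
  rw [integral_greenKernel hκ, one_mul]

theorem tr_green {κ : ℝ} (hκ : 0 < κ) (s : ℝ) (V : L2R) :
    tr s (green κ V) = green κ (tr s V) := tr_trAvg (integrable_greenKernel hκ) s V

/-- Translations commute with the resolvent, so the orbit of `green κ V` is the explicit exponential
average of the orbit of `V`. Hence this orbit is twice differentiable in norm, which is the only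
form in which derivatives of `green κ V` are used. -/
theorem tr_green_eq {κ : ℝ} (hκ : 0 < κ) (t : ℝ) (V : L2R) :
    tr t (green κ V) = greenAvg κ (fun s => tr s V) t := by
  rw [tr_green hκ, green, trAvg_apply (integrable_greenKernel hκ),
    ← integral_greenKernel_smul hκ (continuous_tr V) (fun s => (norm_tr s V).le)]
  congr 1; ext1 s; rw [tr_tr, add_comm]

theorem inner_green_left {κ : ℝ} (hκ : 0 < κ) (V φ : L2R) :
    inner ℝ (green κ V) φ = inner ℝ V (green κ φ) := by
  rw [green, inner_trAvg_left (integrable_greenKernel hκ), real_inner_comm,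
    inner_trAvg_left (integrable_greenKernel hκ), ← integral_neg_eq_self]
  congr 1; ext1 t
  rw [greenKernel_neg, inner_tr_left, real_inner_comm, neg_neg]

/-- The Green's kernel as an element of `L²(ℝ)`. -/
noncomputable def greenKernelLp {κ : ℝ} (hκ : 0 < κ) : L2R := (memLp_greenKernel hκ).toLp _

theorem integral_greenKernel_mul {κ : ℝ} (hκ : 0 < κ) (V : L2R) (x : ℝ) :
    ∫ t, greenKernel κ t * V (x + t) = inner ℝ (greenKernelLp hκ) (tr x V) := by
  rw [inner_eq_integral]
  apply integral_congr_ae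
  filter_upwards [(memLp_greenKernel hκ).coeFn_toLp, tr_coe x V] with t h1 h2
  rw [greenKernelLp, h1, h2, add_comm]

theorem green_coe {κ : ℝ} (hκ : 0 < κ) (V : L2R) :
    (green κ V : ℝ → ℝ) =ᵐ[volume] fun x => inner ℝ (greenKernelLp hκ) (tr x V) := by
  filter_upwards [trAvg_coe (integrable_greenKernel hκ) V] with x hx
  rw [green, hx, integral_greenKernel_mul]

theorem abs_green_le {κ : ℝ} (hκ : 0 < κ) (V : L2R) :
    ∀ᵐ x, |green κ V x| ≤ ‖greenKernelLp hκ‖ * ‖V‖ := by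
  filter_upwards [green_coe hκ V] with x hx
  rw [hx, ← norm_tr x V]
  exact abs_real_inner_le_norm _ _

theorem norm_tr_green_sub_le {κ : ℝ} (hκ : 0 < κ) (t : ℝ) (V : L2R) :
    ‖tr t (green κ V) - green κ V‖ ≤ κ * |t| * ‖V‖ := by
  wlog ht : 0 ≤ t generalizing t
  · have := this (-t) (by linarith)
    rw [abs_neg] at this
    rw [← norm_tr (-t), map_sub, tr_tr, neg_add_cancel, tr_zero, norm_sub_rev]
    exact this
  have := norm_le_of_norm_deriv_le (f := fun t => tr t (green κ V) - green κ V)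
    (f' := greenAvgDeriv κ (fun s => tr s V)) (M := κ * ‖V‖) (h := t) 0 (by simp [tr_zero])
    (fun s _ => ?_) (fun s _ _ => ?_) t ht le_rfl
  · rw [abs_of_nonneg ht]
    simp only [CharP.cast_eq_zero, zero_add, div_one, pow_one] at this
    linarith
  · refine HasDerivAt.sub_const _ ?_
    rw [show (fun t => tr t (green κ V)) = greenAvg κ (fun s => tr s V) from
      funext fun t => tr_green_eq hκ t V]
    exact hasDerivAt_greenAvg hκ (continuous_tr V) (fun s => (norm_tr s V).le) s
  · simpa using norm_greenAvgDeriv_le hκ (fun s => (norm_tr s V).le) s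

/-- The symmetric translation average `(V(· + t) + V(· - t)) / 2`. -/
noncomputable def symTr (t : ℝ) (V : L2R) : L2R := (1 / 2 : ℝ) • (tr t V + tr (-t) V)

theorem symTr_neg (t : ℝ) (V : L2R) : symTr (-t) V = symTr t V := by
  rw [symTr, symTr, neg_neg, add_comm]

/-- Taylor expansion of the symmetric average, whose first order term cancels; `κ² • (green κ V -
V)` is the second derivative of `green κ V`. Whatever modulus `M tⁿ` this second derivative has is
integrated twice: `n = 0` serves the resolvent estimate, `n = 2` the residual of the soliton. -/
theorem norm_symTr_green_sub_le {κ M h : ℝ} (hκ : 0 < κ) (n : ℕ) (V : L2R)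
    (hM : ∀ t, 0 ≤ t → t ≤ h →
      ‖symTr t (κ ^ 2 • (green κ V - V)) - κ ^ 2 • (green κ V - V)‖ ≤ M * t ^ n) :
    ∀ t, 0 ≤ t → t ≤ h →
      ‖symTr t (green κ V) - green κ V - (t ^ 2 / 2) • κ ^ 2 • (green κ V - V)‖ ≤
        M / (n + 1) / (n + 2) * t ^ (n + 2) := by
  set f : ℝ → L2R := fun s => tr s V with hf
  set G := κ ^ 2 • (green κ V - V) with hG
  have hfc : Continuous f := continuous_tr V
  have hfM : ∀ s, ‖f s‖ ≤ ‖V‖ := fun s => (norm_tr s V).le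
  have e : ∀ t, tr t (green κ V) = greenAvg κ f t := fun t => tr_green_eq hκ t V
  have h1 : ∀ t, HasDerivAt (fun t => tr t (green κ V)) (greenAvgDeriv κ f t) t := by
    intro t; simp_rw [e]; exact hasDerivAt_greenAvg hκ hfc hfM t
  have h2 : ∀ t, HasDerivAt (greenAvgDeriv κ f) (tr t G) t := by
    intro t
    refine (hasDerivAt_greenAvgDeriv hκ hfc hfM t).congr_deriv ?_
    rw [hG, map_smul, map_sub, e]
  have h1' : ∀ t, HasDerivAt (fun t => tr (-t) (green κ V)) (-greenAvgDeriv κ f (-t)) t := by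
    intro t
    have := (h1 (-t)).scomp t (hasDerivAt_neg t)
    exact this.congr_deriv (by simp)
  have h2' : ∀ t, HasDerivAt (fun t => greenAvgDeriv κ f (-t)) (-tr (-t) G) t := by
    intro t
    have := (h2 (-t)).scomp t (hasDerivAt_neg t)
    exact this.congr_deriv (by simp)
  have key := norm_le_of_norm_deriv_le (h := h) (M := M) n
    (f := fun t => (1 / 2 : ℝ) • (greenAvgDeriv κ f t - greenAvgDeriv κ f (-t)) - t • G)
    (f' := fun t => symTr t G - G) (by simp) (fun t _ => ?_) hM
  · intro t ht hth
    have key2 := norm_le_of_norm_deriv_le (h := h) (M := M / (n + 1)) (n + 1)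
      (f := fun t => symTr t (green κ V) - green κ V - (t ^ 2 / 2) • G)
      (f' := fun t => (1 / 2 : ℝ) • (greenAvgDeriv κ f t - greenAvgDeriv κ f (-t)) - t • G)
      ?_ (fun t _ => ?_) key t ht hth
    · convert key2 using 3
      push_cast; ring
    · simp [symTr, tr_zero]; module
    · have h3 := (((h1 t).add (h1' t)).const_smul (1 / 2 : ℝ)).sub_const (green κ V)
      have h4 : HasDerivAt (fun t : ℝ => (t ^ 2 / 2) • G) (t • G) t := by
        have := ((hasDerivAt_pow 2 t).div_const 2).smul_const G
        exact this.congr_deriv (by simp)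
      exact (h3.sub h4).congr_deriv (by module)
  · have h3 := ((h2 t).sub (h2' t)).const_smul (1 / 2 : ℝ)
    have h4 : HasDerivAt (fun t : ℝ => t • G) G t := by
      have := (hasDerivAt_id t).smul_const G
      exact this.congr_deriv (by simp)
    exact (h3.sub h4).congr_deriv (by rw [symTr]; module)

end Peridynamics

/-! ### Expansions of the bond operators -/

namespace Peridynamics

/-- The integral of `c(s - t)` over the square `[0, η]²`. -/
noncomputable def diffInt (η : ℝ) (c : ℝ → ℝ) : ℝ :=
  ∫ s in (0 : ℝ)..η, ∫ t in (0 : ℝ)..η, c (s - t)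

theorem continuous_diffInt_inner (a b : ℝ) {c : ℝ → ℝ} (hc : Continuous c) :
    Continuous fun s => ∫ t in a..b, c (s - t) :=
  intervalIntegral.continuous_parametric_intervalIntegral_of_continuous'
    (f := fun s t => c (s - t)) (by fun_prop) a b

theorem diffInt_comp_neg (η : ℝ) (c : ℝ → ℝ) : diffInt η (fun u => c (-u)) = diffInt η c := by
  unfold diffInt
  have h := intervalIntegral.integral_comp_sub_left (a := 0) (b := η)
    (fun s => ∫ t in (0 : ℝ)..η, c (s - t)) η
  rw [sub_self, sub_zero] at h
  rw [← h]
  congr 1; ext1 s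
  have h2 := intervalIntegral.integral_comp_sub_left (a := 0) (b := η) (fun t => c (η - s - t)) η
  rw [sub_self, sub_zero] at h2
  rw [← h2]
  congr 1; ext1 t; ring_nf

theorem diffInt_add (η : ℝ) {c d : ℝ → ℝ} (hc : Continuous c) (hd : Continuous d) :
    diffInt η (fun u => c u + d u) = diffInt η c + diffInt η d := by
  unfold diffInt
  rw [← intervalIntegral.integral_add ((continuous_diffInt_inner 0 η hc).intervalIntegrable _ _)
    ((continuous_diffInt_inner 0 η hd).intervalIntegrable _ _)]
  congr 1; ext1 s
  exact intervalIntegral.integral_add (Continuous.intervalIntegrable (by fun_prop) _ _)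
    (Continuous.intervalIntegrable (by fun_prop) _ _)

theorem diffInt_const_mul (η a : ℝ) (c : ℝ → ℝ) :
    diffInt η (fun u => a * c u) = a * diffInt η c := by
  unfold diffInt
  simp_rw [intervalIntegral.integral_const_mul]

theorem diffInt_one (η : ℝ) : diffInt η (fun _ => 1) = η ^ 2 := by
  simp [diffInt, sq]

theorem diffInt_sq (η : ℝ) : diffInt η (fun u => u ^ 2) = η ^ 4 / 6 := by
  unfold diffInt
  have : ∀ s : ℝ, ∫ t in (0 : ℝ)..η, (s - t) ^ 2 = η * s ^ 2 - η ^ 2 * s + η ^ 3 / 3 := by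
    intro s
    rw [intervalIntegral.integral_comp_sub_left (fun x => x ^ 2) s, integral_pow]
    push_cast; ring
  simp_rw [this]
  rw [intervalIntegral.integral_add (Continuous.intervalIntegrable (by fun_prop) _ _)
      (Continuous.intervalIntegrable (by fun_prop) _ _),
    intervalIntegral.integral_sub (Continuous.intervalIntegrable (by fun_prop) _ _)
      (Continuous.intervalIntegrable (by fun_prop) _ _),
    intervalIntegral.integral_const_mul, intervalIntegral.integral_const_mul, integral_pow,
    integral_id]
  simp
  ring

theorem abs_diffInt_le {η B : ℝ} (hη : 0 ≤ η) {c : ℝ → ℝ} (hB : ∀ u, |u| ≤ η → |c u| ≤ B) :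
    |diffInt η c| ≤ η ^ 2 * B := by
  unfold diffInt
  have h1 : ∀ s ∈ uIoc 0 η, ‖∫ t in (0 : ℝ)..η, c (s - t)‖ ≤ B * η := by
    intro s hs
    have := intervalIntegral.norm_integral_le_of_norm_le_const (a := 0) (b := η) (C := B)
      (f := fun t => c (s - t)) (fun t ht => ?_)
    · simpa [abs_of_nonneg hη] using this
    · rw [uIoc_of_le hη] at hs ht
      exact hB _ (abs_le.2 ⟨by linarith [hs.1, ht.2], by linarith [hs.2, ht.1]⟩)
  have := intervalIntegral.norm_integral_le_of_norm_le_const h1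
  rw [sub_zero, abs_of_nonneg hη, Real.norm_eq_abs] at this
  linarith

theorem continuous_inner_tr (V φ : L2R) : Continuous fun u => inner ℝ (tr u V) φ :=
  (continuous_tr V).inner continuous_const

theorem inner_bondOp_left {η : ℝ} (hη : 0 ≤ η) (V φ : L2R) :
    inner ℝ (bondOp η V) φ = ∫ s in (0 : ℝ)..η, inner ℝ (tr s V) φ := by
  rw [bondOp_apply hη, real_inner_comm]
  have := (innerSL ℝ φ).intervalIntegral_comp_comm (intervalIntegrable_tr V 0 η)
  simp only [innerSL_apply_apply] at this
  rw [← this]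
  congr 1; ext1 s; rw [real_inner_comm]

/-- Shifting both factors back to one leaves only the difference of the two translation parameters.
Expansions of the bond operators thereby reduce to the correlation function `u ↦ ⟨tr u V, φ⟩`. -/
theorem inner_bondOp_bondOp {η : ℝ} (hη : 0 ≤ η) (V φ : L2R) :
    inner ℝ (bondOp η V) (bondOp η φ) = diffInt η (fun u => inner ℝ (tr u V) φ) := by
  rw [inner_bondOp_left hη, diffInt]
  congr 1; ext1 s
  rw [real_inner_comm, inner_bondOp_left hη]
  congr 1; ext1 t
  rw [inner_tr_tr, inner_tr_left, neg_sub, real_inner_comm]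

/-- The square is symmetric under `u ↦ -u`, so `tr` may be replaced by `symTr`. Integrating `1` and
`u² / 2` over the square gives `η²` and `η⁴ / 12`; only the Taylor remainder is left. -/
theorem abs_inner_bondOp_expansion_le {η B : ℝ} (hη : 0 ≤ η) (g G φ : L2R)
    (hB : ∀ u, 0 ≤ u → u ≤ η → ‖symTr u g - g - (u ^ 2 / 2) • G‖ ≤ B) :
    |η ^ 2 * inner ℝ g φ - inner ℝ (bondOp η g) (bondOp η φ) + η ^ 4 / 12 * inner ℝ G φ| ≤
      η ^ 2 * (B * ‖φ‖) := by
  have e : η ^ 2 * inner ℝ g φ - inner ℝ (bondOp η g) (bondOp η φ) + η ^ 4 / 12 * inner ℝ G φ =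
      -diffInt η (fun u => inner ℝ (symTr u g - g - (u ^ 2 / 2) • G) φ) := by
    set c := fun u => inner ℝ (tr u g) φ with hc
    have hcc : Continuous c := continuous_inner_tr g φ
    have h1 : (fun u => inner ℝ (symTr u g - g - (u ^ 2 / 2) • G) φ) = fun u =>
        (1 / 2 * c u + 1 / 2 * c (-u)) + (-inner ℝ g φ * 1 + (-inner ℝ G φ / 2) * u ^ 2) := by
      ext1 u
      rw [symTr, inner_sub_left, inner_sub_left, inner_smul_left, inner_add_left, inner_smul_left]
      simp only [hc, RCLike.conj_to_real]
      ring
    rw [h1, diffInt_add _ (by fun_prop) (by fun_prop), diffInt_add _ (by fun_prop) (by fun_prop),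
      diffInt_add _ (by fun_prop) (by fun_prop), diffInt_const_mul, diffInt_const_mul,
      diffInt_const_mul, diffInt_const_mul, diffInt_comp_neg, diffInt_one, diffInt_sq,
      inner_bondOp_bondOp hη]
    ring
  rw [e, abs_neg]
  refine abs_diffInt_le hη fun u hu => (abs_real_inner_le_norm _ _).trans ?_
  gcongr
  rcases le_total 0 u with h | h
  · exact hB u h (by rwa [abs_of_nonneg h] at hu)
  · rw [abs_of_nonpos h] at hu
    simpa [symTr_neg] using hB (-u) (by linarith) hu

/-! ### Translation differences controlled by the energy defect -/

theorem half_norm_tr_sub_sq (u : ℝ) (V : L2R) :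
    1 / 2 * ‖tr u V - V‖ ^ 2 = ‖V‖ ^ 2 - inner ℝ (tr u V) V := by
  rw [@norm_sub_sq_real, norm_tr]; ring

/-- The loss of norm under the bond operator is a nonlocal Dirichlet energy. It is nonnegative, and
its smallness forces `V` to vary little under short translations. -/
theorem diffInt_norm_tr_sub_sq {η : ℝ} (hη : 0 ≤ η) (V : L2R) :
    diffInt η (fun u => 1 / 2 * ‖tr u V - V‖ ^ 2) = η ^ 2 * ‖V‖ ^ 2 - ‖bondOp η V‖ ^ 2 := by
  rw [← real_inner_self_eq_norm_sq (bondOp η V), inner_bondOp_bondOp hη]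
  have : (fun u => 1 / 2 * ‖tr u V - V‖ ^ 2) =
      fun u => ‖V‖ ^ 2 * 1 + (-1) * inner ℝ (tr u V) V := by
    ext1 u; rw [half_norm_tr_sub_sq]; ring
  have hc := continuous_inner_tr V V
  rw [this, diffInt_add _ (by fun_prop) (by fun_prop), diffInt_const_mul, diffInt_const_mul,
    diffInt_one]
  ring

theorem norm_tr_sub_neg (u : ℝ) (V : L2R) : ‖tr (-u) V - V‖ = ‖tr u V - V‖ := by
  rw [← norm_tr u, map_sub, tr_tr, add_neg_cancel, tr_zero, norm_sub_rev]

theorem norm_tr_add_sub_le (s t : ℝ) (V : L2R) :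
    ‖tr (s + t) V - V‖ ≤ ‖tr s V - V‖ + ‖tr t V - V‖ := by
  have : tr (s + t) V - V = tr s (tr t V - V) + (tr s V - V) := by
    rw [map_sub, tr_tr]; abel
  rw [this, add_comm ‖tr s V - V‖, ← norm_tr s (tr t V - V)]
  exact norm_add_le _ _

theorem norm_tr_nat_mul_sub_le (n : ℕ) (t : ℝ) (V : L2R) :
    ‖tr (n * t) V - V‖ ≤ n * ‖tr t V - V‖ := by
  induction n with
  | zero => simp [tr_zero]
  | succ n ih =>
    push_cast
    rw [add_mul, one_mul]
    refine (norm_tr_add_sub_le _ _ V).trans ?_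
    linarith

/-- For arbitrary `s`, `r`, the shift by `t` is the shift by `s + t - r` followed by the one by `-(s
- r)`. The resulting pointwise inequality is integrated over `s ∈ [0, η/2]`, `r ∈ [0, η]`; since `t
≤ η/2`, both right-hand integrals stay inside the square defining the energy. -/
theorem norm_tr_sub_sq_le_of_half {η t : ℝ} (hη : 0 < η) (ht : 0 ≤ t) (htη : t ≤ η / 2) (V : L2R) :
    η ^ 2 * ‖tr t V - V‖ ^ 2 ≤ 16 * (η ^ 2 * ‖V‖ ^ 2 - ‖bondOp η V‖ ^ 2) := by
  rw [← diffInt_norm_tr_sub_sq hη.le]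
  set c : ℝ → ℝ := fun u => 1 / 2 * ‖tr u V - V‖ ^ 2 with hc
  have hcc : Continuous c := by
    have := continuous_tr V
    fun_prop
  have hc0 : ∀ u, 0 ≤ c u := fun u => by positivity
  have hin : ∀ a b : ℝ, 0 ≤ a → a ≤ b → b ≤ η →
      ∫ s in a..b, ∫ r in (0 : ℝ)..η, c (s - r) ≤ diffInt η c := by
    intro a b ha hab hb
    refine intervalIntegral.integral_mono_interval ha hab hb ?_
      ((continuous_diffInt_inner 0 η hcc).intervalIntegrable _ _)
    exact Eventually.of_forall fun s => intervalIntegral.integral_nonneg hη.le fun _ _ => hc0 _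
  have hpt : ∀ s r : ℝ, c t ≤ 2 * c (s + t - r) + 2 * c (s - r) := by
    intro s r
    have h1 := norm_tr_add_sub_le (s + t - r) (-(s - r)) V
    rw [norm_tr_sub_neg, show s + t - r + -(s - r) = t by ring] at h1
    simp only [hc]
    have h2 : ‖tr t V - V‖ ^ 2 ≤ (‖tr (s + t - r) V - V‖ + ‖tr (s - r) V - V‖) ^ 2 := by gcongr
    nlinarith [sq_nonneg (‖tr (s + t - r) V - V‖ - ‖tr (s - r) V - V‖)]
  have hfin : ∫ s in (0 : ℝ)..(η / 2), ∫ r in (0 : ℝ)..η, c t ≤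
      2 * diffInt η c + 2 * diffInt η c := by
    have hs2 : ∫ s in (0 : ℝ)..(η / 2), ∫ r in (0 : ℝ)..η, c (s + t - r) ≤ diffInt η c := by
      have := intervalIntegral.integral_comp_add_right (a := 0) (b := η / 2)
        (fun s => ∫ r in (0 : ℝ)..η, c (s - r)) t
      rw [this]
      exact hin _ _ (by linarith) (by linarith) (by linarith)
    have hs1 := hin 0 (η / 2) le_rfl (by linarith) (by linarith)
    have hi1 := continuous_diffInt_inner 0 η hcc
    have hi2 : Continuous fun s => ∫ r in (0 : ℝ)..η, c (s + t - r) :=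
      hi1.comp (by fun_prop : Continuous fun s : ℝ => s + t)
    calc ∫ s in (0 : ℝ)..(η / 2), ∫ r in (0 : ℝ)..η, c t
        ≤ ∫ s in (0 : ℝ)..(η / 2), (2 * (∫ r in (0 : ℝ)..η, c (s + t - r)) +
            2 * ∫ r in (0 : ℝ)..η, c (s - r)) := by
          refine intervalIntegral.integral_mono_on (by linarith) (by simp)
            (Continuous.intervalIntegrable (by fun_prop) _ _) fun s _ => ?_
          rw [← intervalIntegral.integral_const_mul, ← intervalIntegral.integral_const_mul,
            ← intervalIntegral.integral_add (Continuous.intervalIntegrable (by fun_prop) _ _)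
              (Continuous.intervalIntegrable (by fun_prop) _ _)]
          exact intervalIntegral.integral_mono_on hη.le (by simp)
            (Continuous.intervalIntegrable (by fun_prop) _ _) fun r _ => hpt s r
      _ ≤ _ := by
          rw [intervalIntegral.integral_add (Continuous.intervalIntegrable (by fun_prop) _ _)
              (Continuous.intervalIntegrable (by fun_prop) _ _),
            intervalIntegral.integral_const_mul, intervalIntegral.integral_const_mul]
          linarith
  simp only [intervalIntegral.integral_const, sub_zero, smul_eq_mul] at hfin
  simp only [hc] at hfin ⊢
  nlinarith

/-- A long translation is cut into at most `2|t|/η + 1` steps of length at most `η/2`, each costing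
`4δ`. -/
theorem norm_tr_sub_le_of_energy {η δ : ℝ} (hη : 0 < η) (hδ : 0 ≤ δ) (V : L2R)
    (hE : η ^ 2 * ‖V‖ ^ 2 - ‖bondOp η V‖ ^ 2 ≤ η ^ 2 * δ ^ 2) (t : ℝ) :
    ‖tr t V - V‖ ≤ (2 * |t| / η + 1) * (4 * δ) := by
  wlog ht : 0 ≤ t generalizing t
  · have := this (-t) (by linarith)
    rwa [abs_neg, norm_tr_sub_neg] at this
  rw [abs_of_nonneg ht]
  have hhalf : ∀ r, 0 ≤ r → r ≤ η / 2 → ‖tr r V - V‖ ≤ 4 * δ := by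
    intro r hr hrη
    have h1 := norm_tr_sub_sq_le_of_half hη hr hrη V
    have h2 : η ^ 2 * ‖tr r V - V‖ ^ 2 ≤ η ^ 2 * (4 * δ) ^ 2 := by nlinarith
    have h3 := le_of_mul_le_mul_left h2 (by positivity)
    exact le_of_sq_le_sq h3 (by positivity)
  set n := ⌊2 * t / η⌋₊ + 1 with hn
  have hn1 : 2 * t / η ≤ n := by
    rw [hn]; push_cast; exact (Nat.lt_floor_add_one _).le
  have hn2 : (n : ℝ) ≤ 2 * t / η + 1 := by
    rw [hn]; push_cast; gcongr; exact Nat.floor_le (by positivity)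
  have hn0 : (0 : ℝ) < n := by rw [hn]; positivity
  have h := norm_tr_nat_mul_sub_le n (t / n) V
  rw [mul_div_cancel₀ _ hn0.ne'] at h
  refine h.trans (mul_le_mul hn2 (hhalf _ (by positivity) ?_) (norm_nonneg _) (by positivity))
  rw [div_le_iff₀ hn0]
  rw [div_le_iff₀ hη] at hn1
  linarith

/-! ### Midpoint rule for bond averages -/

theorem norm_integral_tr_centered_sub_le {η M : ℝ} (hη : 0 ≤ η) (hM : 0 ≤ M) (g : L2R)
    (h : ∀ t, 0 ≤ t → ‖symTr t g - g‖ ≤ M * t ^ 2) :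
    ‖∫ s in (0 : ℝ)..η, (tr (s - η / 2) g - g)‖ ≤ M * η ^ 3 := by
  have hc := continuous_tr g
  have h1 : ∫ s in (0 : ℝ)..η, (tr (s - η / 2) g - g) =
      ∫ s in (0 : ℝ)..η, (tr (-(s - η / 2)) g - g) := by
    have := intervalIntegral.integral_comp_sub_left (a := 0) (b := η)
      (fun s => tr (s - η / 2) g - g) η
    rw [sub_self, sub_zero] at this
    rw [← this]
    congr 1; ext1 s; congr 3; ring
  have h2 : ∫ s in (0 : ℝ)..η, (tr (s - η / 2) g - g) =
      ∫ s in (0 : ℝ)..η, (symTr (s - η / 2) g - g) := by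
    have h3 : ∀ s, symTr (s - η / 2) g - g =
        (1 / 2 : ℝ) • (tr (s - η / 2) g - g) + (1 / 2 : ℝ) • (tr (-(s - η / 2)) g - g) := by
      intro s; rw [symTr]; module
    simp_rw [h3]
    rw [intervalIntegral.integral_add (Continuous.intervalIntegrable (by fun_prop) _ _)
      (Continuous.intervalIntegrable (by fun_prop) _ _), intervalIntegral.integral_smul,
      intervalIntegral.integral_smul, ← h1]
    module
  rw [h2]
  refine (intervalIntegral.norm_integral_le_of_norm_le_const (C := M * η ^ 2)
    fun s hs => ?_).trans ?_
  · rw [uIoc_of_le hη] at hs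
    have : ‖symTr |s - η / 2| g - g‖ ≤ M * |s - η / 2| ^ 2 := h _ (abs_nonneg _)
    have e : symTr |s - η / 2| g = symTr (s - η / 2) g := by
      rcases abs_choice (s - η / 2) with e | e <;> rw [e]
      rw [symTr_neg]
    rw [e] at this
    refine this.trans ?_
    gcongr
    exact abs_le.2 ⟨by linarith [hs.1], by linarith [hs.2]⟩
  · rw [sub_zero, abs_of_nonneg hη]
    exact le_of_eq (by ring)

/-- Recentring the interval at its midpoint cancels the odd part of the translation differences. The
error is of order `η³` instead of `η²`, the extra order behind the `ε²` residual. -/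
theorem norm_bondOp_sub_midpoint_le {η M : ℝ} (hη : 0 ≤ η) (hM : 0 ≤ M) (g : L2R)
    (h : ∀ t, 0 ≤ t → ‖symTr t g - g‖ ≤ M * t ^ 2) :
    ‖bondOp η g - η • tr (η / 2) g‖ ≤ M * η ^ 3 := by
  have hc := continuous_tr g
  have e : bondOp η g - η • tr (η / 2) g =
      tr (η / 2) (∫ s in (0 : ℝ)..η, (tr (s - η / 2) g - g)) := by
    have := ((tr (η / 2)).toContinuousLinearMap.intervalIntegral_comp_comm
      (Continuous.intervalIntegrable (μ := volume)
        (by fun_prop : Continuous fun s : ℝ => tr (s - η / 2) g - g) 0 η)).symm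
    simp only [LinearIsometry.coe_toContinuousLinearMap] at this
    rw [this, bondOp_apply hη]
    simp_rw [map_sub, tr_tr, add_sub_cancel]
    rw [intervalIntegral.integral_sub (intervalIntegrable_tr g _ _) (by simp)]
    simp
  rw [e, norm_tr]
  exact norm_integral_tr_centered_sub_le hη hM g h

theorem abs_inner_midpoint_bondOp_sub_le {η M : ℝ} (hη : 0 ≤ η) (hM : 0 ≤ M) (g φ : L2R)
    (h : ∀ t, 0 ≤ t → ‖symTr t g - g‖ ≤ M * t ^ 2) :
    |inner ℝ (tr (η / 2) g) (bondOp η φ) - η * inner ℝ g φ| ≤ M * η ^ 3 * ‖φ‖ := by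
  have hc := continuous_tr g
  have hi : IntervalIntegrable (fun s : ℝ => tr (s - η / 2) g - g) volume 0 η :=
    Continuous.intervalIntegrable (by fun_prop) _ _
  have e : inner ℝ (tr (η / 2) g) (bondOp η φ) - η * inner ℝ g φ =
      inner ℝ φ (∫ s in (0 : ℝ)..η, (tr (s - η / 2) g - g)) := by
    have h1 := (innerSL ℝ φ).intervalIntegral_comp_comm hi
    simp only [innerSL_apply_apply] at h1
    have h2 := intervalIntegral.integral_comp_sub_left (a := 0) (b := η)
      (fun s => inner ℝ φ (tr (s - η / 2) g)) η
    rw [sub_self, sub_zero] at h2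
    have h3 : Continuous fun s => inner ℝ φ (tr (s - η / 2) g) := by fun_prop
    rw [← h1]
    simp_rw [inner_sub_right]
    rw [intervalIntegral.integral_sub (h3.intervalIntegrable _ _) (by simp), ← h2,
      real_inner_comm, inner_bondOp_left hη, real_inner_comm g φ]
    simp only [intervalIntegral.integral_const, sub_zero, smul_eq_mul]
    congr 2; ext1 s
    rw [inner_tr_left, tr_tr]
    ring_nf
  rw [e, mul_comm _ ‖φ‖]
  refine (abs_real_inner_le_norm _ _).trans ?_
  gcongr
  exact norm_integral_tr_centered_sub_le hη hM g h

end Peridynamics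

/-! ### Bilinear forms of bond integrals -/

namespace Peridynamics

theorem norm_le_of_abs_inner_le {v : L2R} {C : ℝ} (hC : 0 ≤ C)
    (h : ∀ φ, |inner ℝ v φ| ≤ C * ‖φ‖) : ‖v‖ ≤ C := by
  have := h v
  rw [real_inner_self_eq_norm_sq, abs_of_nonneg (by positivity), sq] at this
  rcases eq_or_ne ‖v‖ 0 with h0 | h0
  · rwa [h0]
  · exact le_of_mul_le_mul_right this (lt_of_le_of_ne (norm_nonneg v) h0.symm)

/-! ### Calculus of `L²` bounds -/

/-- `f` is a measurable function on `ℝ` whose `L²`-norm is at most `A`. -/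
def L2Bound (f : ℝ → ℝ) (A : ℝ) : Prop :=
  AEStronglyMeasurable f volume ∧ eLpNorm f 2 volume ≤ ENNReal.ofReal A

theorem L2Bound.memLp {f : ℝ → ℝ} {A : ℝ} (h : L2Bound f A) : MemLp f 2 :=
  ⟨h.1, h.2.trans_lt ENNReal.ofReal_lt_top⟩

theorem L2Bound.norm_toLp_le {f : ℝ → ℝ} {A : ℝ} (h : L2Bound f A) (hA : 0 ≤ A) :
    ‖h.memLp.toLp f‖ ≤ A := by
  rw [Lp.norm_toLp]
  exact ENNReal.toReal_le_of_le_ofReal hA h.2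

theorem L2Bound.coe (V : L2R) : L2Bound V ‖V‖ := by
  refine ⟨Lp.aestronglyMeasurable V, ?_⟩
  rw [Lp.norm_def, ENNReal.ofReal_toReal (Lp.eLpNorm_ne_top V)]

theorem L2Bound.coe_of_le {V : L2R} {A : ℝ} (h : ‖V‖ ≤ A) : L2Bound V A :=
  ⟨(L2Bound.coe V).1, (L2Bound.coe V).2.trans (ENNReal.ofReal_le_ofReal h)⟩

theorem L2Bound.congr {f g : ℝ → ℝ} {A : ℝ} (h : L2Bound f A) (hfg : f =ᵐ[volume] g) :
    L2Bound g A :=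
  ⟨h.1.congr hfg, (eLpNorm_congr_ae hfg).symm.le.trans h.2⟩

theorem L2Bound.mono {f : ℝ → ℝ} {A B : ℝ} (h : L2Bound f A) (hAB : A ≤ B) : L2Bound f B :=
  ⟨h.1, h.2.trans (ENNReal.ofReal_le_ofReal hAB)⟩

theorem L2Bound.bond {η : ℝ} (hη : 0 ≤ η) (V : L2R) :
    L2Bound (bond η V) (η * ‖V‖) :=
  ((L2Bound.coe _).congr (bondOp_coe hη V)).mono (norm_bondOp_le hη V)

theorem L2Bound.of_le {f g : ℝ → ℝ} {A b : ℝ} (hg : L2Bound g A)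
    (hf : AEStronglyMeasurable f volume) (hb : 0 ≤ b) (h : ∀ᵐ x, |f x| ≤ b * |g x|) :
    L2Bound f (b * A) := by
  refine ⟨hf, (eLpNorm_le_mul_eLpNorm_of_ae_le_mul (g := g) (c := b) (by simpa using h) 2).trans ?_⟩
  rw [ENNReal.ofReal_mul hb]
  gcongr
  exact hg.2

theorem L2Bound.mul {f g : ℝ → ℝ} {A b : ℝ} (hg : L2Bound g A)
    (hf : AEStronglyMeasurable f volume) (hb : 0 ≤ b) (h : ∀ᵐ x, |f x| ≤ b) :
    L2Bound (fun x => f x * g x) (b * A) := by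
  refine hg.of_le (hf.mul hg.1) hb (h.mono fun x hx => ?_)
  rw [abs_mul]; gcongr

theorem L2Bound.add {f g : ℝ → ℝ} {A B : ℝ} (hf : L2Bound f A) (hg : L2Bound g B)
    (hA : 0 ≤ A) (hB : 0 ≤ B) : L2Bound (fun x => f x + g x) (A + B) := by
  refine ⟨hf.1.add hg.1, (eLpNorm_add_le hf.1 hg.1 (by norm_num)).trans ?_⟩
  rw [ENNReal.ofReal_add hA hB]
  exact add_le_add hf.2 hg.2

theorem L2Bound.comp_add {f : ℝ → ℝ} {A : ℝ} (hf : L2Bound f A) (t : ℝ) :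
    L2Bound (fun x => f (x + t)) A :=
  ⟨hf.1.comp_measurePreserving (measurePreserving_add_right volume t),
    (eLpNorm_comp_measurePreserving hf.1 (measurePreserving_add_right volume t)).le.trans hf.2⟩

theorem L2Bound.integrable_mul {f g : ℝ → ℝ} {A B : ℝ} (hf : L2Bound f A) (hg : L2Bound g B) :
    Integrable fun x => f x * g x :=
  hf.memLp.integrable_mul hg.memLp

theorem L2Bound.abs_integral_mul_le {f g : ℝ → ℝ} {A B : ℝ} (hf : L2Bound f A) (hg : L2Bound g B)
    (hA : 0 ≤ A) (hB : 0 ≤ B) : |∫ x, f x * g x| ≤ A * B := by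
  have : ∫ x, f x * g x = inner ℝ (hf.memLp.toLp f) (hg.memLp.toLp g) := by
    rw [inner_eq_integral]
    apply integral_congr_ae
    filter_upwards [hf.memLp.coeFn_toLp, hg.memLp.coeFn_toLp] with x h1 h2
    rw [h1, h2]
  rw [this]
  refine (abs_real_inner_le_norm _ _).trans ?_
  gcongr
  · exact hf.norm_toLp_le hA
  · exact hg.norm_toLp_le hB

theorem bond_congr {V W : ℝ → ℝ} (h : V =ᵐ[volume] W) (a b : ℝ) :
    ∫ t in a..b, V t = ∫ t in a..b, W t :=
  intervalIntegral.integral_congr_ae (h.mono fun _ hx _ => hx)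

theorem bond_add (η : ℝ) (V W : L2R) (x : ℝ) : bond η (V + W) x = bond η V x + bond η W x := by
  simp_rw [bond_eq]
  rw [bond_congr (Lp.coeFn_add V W)]
  exact intervalIntegral.integral_add (intervalIntegrable_coe V _ _) (intervalIntegrable_coe W _ _)

theorem bond_smul (η c : ℝ) (V : L2R) (x : ℝ) : bond η (c • V) x = c * bond η V x := by
  simp_rw [bond_eq]
  rw [bond_congr (Lp.coeFn_smul c V)]
  simp

theorem bond_sub (η : ℝ) (V W : L2R) (x : ℝ) : bond η (V - W) x = bond η V x - bond η W x := by
  simp_rw [bond_eq]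
  rw [bond_congr (Lp.coeFn_sub V W)]
  exact intervalIntegral.integral_sub (intervalIntegrable_coe V _ _) (intervalIntegrable_coe W _ _)

theorem abs_bond_le_of_ae_le {η b : ℝ} (hη : 0 ≤ η) {V : L2R}
    (h : ∀ᵐ x, |V x| ≤ b) (x : ℝ) : |bond η V x| ≤ η * b := by
  rw [bond_eq]
  have := intervalIntegral.norm_integral_le_of_norm_le_const_ae (a := x) (b := x + η) (f := V)
    (C := b) (h.mono fun x hx _ => hx)
  rw [add_sub_cancel_left, abs_of_nonneg hη, mul_comm] at this
  exact this

theorem inner_bondOp_eq_integral {η : ℝ} (hη : 0 ≤ η) (V φ : L2R) :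
    inner ℝ V (bondOp η φ) = ∫ x, V x * bond η φ x := by
  rw [inner_eq_integral]
  apply integral_congr_ae
  filter_upwards [bondOp_coe hη φ] with x hx
  rw [hx]

theorem inner_bondOp_bondOp_eq_integral {η : ℝ} (hη : 0 ≤ η) (V φ : L2R) :
    inner ℝ (bondOp η V) (bondOp η φ) = ∫ x, bond η V x * bond η φ x := by
  rw [inner_bondOp_eq_integral hη]
  apply integral_congr_ae
  filter_upwards [bondOp_coe hη V] with x hx
  rw [hx]

/-- A measurable family of bond stresses `x ↦ g ξ x`, square integrable in `x` with a first
moment in `ξ`. -/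
def BondAdmissible (g : ℝ → ℝ → ℝ) : Prop :=
  AEStronglyMeasurable (Function.uncurry g) ((volume.restrict (Ioi 0)).prod volume) ∧
  ∃ G : ℝ → ℝ, IntegrableOn (fun ξ => ξ * G ξ) (Ioi 0) ∧
    ∀ ξ, 0 < ξ → 0 ≤ G ξ ∧ L2Bound (g ξ) (G ξ)

/-- The virtual work `∫₀^∞ ⟨g_ξ, φ(· + εξ)-increment⟩ dξ` of the bond stresses `g`. -/
noncomputable def bondForm (ε : ℝ) (g : ℝ → ℝ → ℝ) (φ : L2R) : ℝ :=
  ∫ ξ in Ioi (0 : ℝ), ∫ x, g ξ x * bond (ε * ξ) φ x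

theorem aestronglyMeasurable_bond_uncurry (ε : ℝ) (V : L2R) (μ : Measure (ℝ × ℝ)) :
    AEStronglyMeasurable (fun q : ℝ × ℝ => bond (ε * q.1) V q.2) μ :=
  ((continuous_bond_uncurry V).comp
    (by fun_prop : Continuous fun q : ℝ × ℝ => (ε * q.1, q.2))).aestronglyMeasurable

theorem abs_integral_mul_bond_le {ε ξ A : ℝ} (hε : 0 ≤ ε) (hξ : 0 ≤ ξ) {f : ℝ → ℝ}
    (hA : 0 ≤ A) (hf : L2Bound f A) (φ : L2R) :
    |∫ x, f x * bond (ε * ξ) φ x| ≤ ε * ‖φ‖ * (ξ * A) := by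
  have h0 : 0 ≤ ε * ξ := by positivity
  refine (hf.abs_integral_mul_le (L2Bound.bond h0 φ) hA (by positivity)).trans (le_of_eq (by ring))

theorem BondAdmissible.integrableOn {ε : ℝ} (hε : 0 ≤ ε) {g : ℝ → ℝ → ℝ} (hg : BondAdmissible g)
    (φ : L2R) : IntegrableOn (fun ξ => ∫ x, g ξ x * bond (ε * ξ) φ x) (Ioi 0) := by
  obtain ⟨hm, G, hG, hb⟩ := hg
  refine Integrable.mono' (hG.const_mul (ε * ‖φ‖)) ?_ ?_
  · exact (hm.mul (aestronglyMeasurable_bond_uncurry ε φ _)).integral_prod_right'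
  · filter_upwards [ae_restrict_mem measurableSet_Ioi] with ξ hξ
    exact abs_integral_mul_bond_le hε (le_of_lt hξ) (hb ξ hξ).1 (hb ξ hξ).2 φ

theorem abs_bondForm_le {ε : ℝ} {g : ℝ → ℝ → ℝ} {φ : L2R} {h : ℝ → ℝ}
    (hh : IntegrableOn h (Ioi 0))
    (hb : ∀ ξ, 0 < ξ → |∫ x, g ξ x * bond (ε * ξ) φ x| ≤ h ξ) :
    |bondForm ε g φ| ≤ ∫ ξ in Ioi (0 : ℝ), h ξ := by
  rw [bondForm, ← Real.norm_eq_abs]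
  exact norm_integral_le_of_norm_le hh
    ((ae_restrict_mem measurableSet_Ioi).mono fun ξ hξ => hb ξ hξ)

theorem BondAdmissible.exists_bound {g : ℝ → ℝ → ℝ} (hg : BondAdmissible g) {ε : ℝ}
    (hε : 0 ≤ ε) : ∃ C, ∀ φ, ‖bondForm ε g φ‖ ≤ C * ‖φ‖ := by
  have hm := hg.1
  obtain ⟨_, G, hG, hb⟩ := hg
  refine ⟨ε * ∫ ξ in Ioi (0 : ℝ), ξ * G ξ, fun φ => ?_⟩
  refine (abs_bondForm_le (hG.const_mul (ε * ‖φ‖)) fun ξ hξ =>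
    abs_integral_mul_bond_le hε (le_of_lt hξ) (hb ξ hξ).1 (hb ξ hξ).2 φ).trans (le_of_eq ?_)
  rw [integral_const_mul]; ring

theorem BondAdmissible.bondForm_add {g : ℝ → ℝ → ℝ} (hg : BondAdmissible g) {ε : ℝ}
    (hε : 0 ≤ ε) (φ ψ : L2R) :
    bondForm ε g (φ + ψ) = bondForm ε g φ + bondForm ε g ψ := by
  rw [bondForm, bondForm, bondForm, ← integral_add (hg.integrableOn hε φ) (hg.integrableOn hε ψ)]
  refine setIntegral_congr_fun measurableSet_Ioi fun ξ hξ => ?_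
  obtain ⟨_, G, hG, hb⟩ := hg
  have h0 : 0 ≤ ε * ξ := mul_nonneg hε (le_of_lt hξ)
  rw [← integral_add ((hb ξ hξ).2.integrable_mul (L2Bound.bond h0 φ))
    ((hb ξ hξ).2.integrable_mul (L2Bound.bond h0 ψ))]
  simp_rw [bond_add, mul_add]

theorem bondForm_smul (ε : ℝ) (g : ℝ → ℝ → ℝ) (c : ℝ) (φ : L2R) :
    bondForm ε g (c • φ) = c * bondForm ε g φ := by
  rw [bondForm, bondForm, ← integral_const_mul]
  congr 1; ext1 ξ
  rw [← integral_const_mul]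
  congr 1; ext1 x
  rw [bond_smul]; ring

/-- Riesz representation. Nonlinear stresses become vectors in `L²`, while every estimate on them is
made on the form `bondForm`, by duality. -/
theorem BondAdmissible.exists_vec {g : ℝ → ℝ → ℝ} (hg : BondAdmissible g) {ε : ℝ}
    (hε : 0 ≤ ε) : ∃ v : L2R, ∀ φ, inner ℝ v φ = bondForm ε g φ := by
  obtain ⟨C, hC⟩ := hg.exists_bound hε
  let ℓ : L2R →L[ℝ] ℝ := LinearMap.mkContinuous
    { toFun := bondForm ε g
      map_add' := hg.bondForm_add hε
      map_smul' := bondForm_smul ε g } C hC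
  refine ⟨(InnerProductSpace.toDual ℝ L2R).symm ℓ, fun φ => ?_⟩
  rw [InnerProductSpace.toDual_symm_apply]
  rfl

open Classical in
/-- The vector in `L²(ℝ)` that represents the virtual work of the bond stresses `g`. -/
noncomputable def bondVec (ε : ℝ) (g : ℝ → ℝ → ℝ) : L2R :=
  if h : ∃ v : L2R, ∀ φ, inner ℝ v φ = bondForm ε g φ then h.choose else 0

theorem BondAdmissible.inner_bondVec {g : ℝ → ℝ → ℝ} (hg : BondAdmissible g) {ε : ℝ}
    (hε : 0 ≤ ε) (φ : L2R) : inner ℝ (bondVec ε g) φ = bondForm ε g φ := by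
  have h := hg.exists_vec hε
  rw [bondVec, dif_pos h]
  exact h.choose_spec φ

theorem BondAdmissible.add {g h : ℝ → ℝ → ℝ} (hg : BondAdmissible g) (hh : BondAdmissible h) :
    BondAdmissible fun ξ x => g ξ x + h ξ x := by
  obtain ⟨hm, G, hG, hb⟩ := hg
  obtain ⟨hm', H, hH, hb'⟩ := hh
  refine ⟨hm.add hm', fun ξ => G ξ + H ξ, ?_, fun ξ hξ => ⟨?_, ?_⟩⟩
  · simp_rw [mul_add]; exact hG.add hH
  · exact add_nonneg (hb ξ hξ).1 (hb' ξ hξ).1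
  · exact (hb ξ hξ).2.add (hb' ξ hξ).2 (hb ξ hξ).1 (hb' ξ hξ).1

theorem BondAdmissible.bondForm_add_left {g h : ℝ → ℝ → ℝ} (hg : BondAdmissible g)
    (hh : BondAdmissible h) {ε : ℝ} (hε : 0 ≤ ε) (φ : L2R) :
    bondForm ε (fun ξ x => g ξ x + h ξ x) φ = bondForm ε g φ + bondForm ε h φ := by
  rw [bondForm, bondForm, bondForm, ← integral_add (hg.integrableOn hε φ) (hh.integrableOn hε φ)]
  refine setIntegral_congr_fun measurableSet_Ioi fun ξ hξ => ?_
  obtain ⟨_, G, hG, hb⟩ := hg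
  obtain ⟨_, H, hH, hb'⟩ := hh
  have h0 : 0 ≤ ε * ξ := mul_nonneg hε (le_of_lt hξ)
  rw [← integral_add ((hb ξ hξ).2.integrable_mul (L2Bound.bond h0 φ))
    ((hb' ξ hξ).2.integrable_mul (L2Bound.bond h0 φ))]
  simp_rw [add_mul]

theorem bondForm_const_mul (ε c : ℝ) (g : ℝ → ℝ → ℝ) (φ : L2R) :
    bondForm ε (fun ξ x => c * g ξ x) φ = c * bondForm ε g φ := by
  rw [bondForm, bondForm, ← integral_const_mul]
  congr 1; ext1 ξ
  rw [← integral_const_mul]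
  congr 1; ext1 x
  ring

/-! ### Reflection symmetry -/

/-- The reflection `V ↦ V(-·)` on `L²(ℝ)`. -/
noncomputable def refl : L2R →ₗᵢ[ℝ] L2R :=
  Lp.compMeasurePreservingₗᵢ ℝ (fun x => -x) (Measure.measurePreserving_neg volume)

theorem refl_coe (V : L2R) : (refl V : ℝ → ℝ) =ᵐ[volume] fun x => V (-x) :=
  Lp.coeFn_compMeasurePreserving V (Measure.measurePreserving_neg volume)

theorem ae_comp_neg {P : ℝ → Prop} (h : ∀ᵐ x : ℝ, P x) : ∀ᵐ x : ℝ, P (-x) :=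
  (Measure.measurePreserving_neg (volume : Measure ℝ)).quasiMeasurePreserving.ae h

theorem refl_refl (V : L2R) : refl (refl V) = V := by
  apply Lp.ext
  filter_upwards [refl_coe (refl V), ae_comp_neg (refl_coe V)] with x h1 h2
  rw [h1, h2, neg_neg]

theorem isEven_iff (V : L2R) : IsEven V ↔ refl V = V := by
  constructor
  · intro h
    apply Lp.ext
    filter_upwards [refl_coe V, h] with x h1 h2
    rw [h1, h2]
  · intro h
    filter_upwards [refl_coe V] with x h1
    rw [← h1, h]

theorem inner_refl_left (V φ : L2R) : inner ℝ (refl V) φ = inner ℝ V (refl φ) := by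
  rw [← refl.inner_map_map V (refl φ), refl_refl]

theorem bond_refl (η : ℝ) (V : L2R) (x : ℝ) : bond η (refl V) x = bond η V (-x - η) := by
  rw [bond_eq, bond_eq, bond_congr (refl_coe V),
    intervalIntegral.integral_comp_neg (fun t => V t)]
  congr 1 <;> ring

/-- Reflection exchanges the two end points of a bond, so it acts on increments as the substitution
`x ↦ -x - εξ`, which preserves Lebesgue measure. -/
theorem bondForm_refl {ε : ℝ} {g g' : ℝ → ℝ → ℝ}
    (h : ∀ ξ x, 0 < ξ → g' ξ x = g ξ (-x - ε * ξ)) (φ : L2R) :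
    bondForm ε g' φ = bondForm ε g (refl φ) := by
  rw [bondForm, bondForm]
  refine setIntegral_congr_fun measurableSet_Ioi fun ξ hξ => ?_
  have e := integral_sub_left_eq_self (fun x => g ξ x * bond (ε * ξ) (refl φ) x) volume (-(ε * ξ))
  rw [← e]
  congr 1; ext1 x
  rw [h ξ x hξ, bond_refl]
  congr 2 <;> ring

end Peridynamics

/-! ### The linear wave operator and its resolvent -/

namespace Peridynamics

/-- The moment `∫₀^∞ w(ξ) ξᵏ dξ`. -/
noncomputable def moment (w : ℝ → ℝ) (k : ℕ) : ℝ := ∫ ξ in Ioi (0 : ℝ), w ξ * ξ ^ k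

/-- Division by `ξᵏ`, which is nonzero on the half-line, recovers the weight from its integrable
moment. -/
theorem aestronglyMeasurable_of_moment {w : ℝ → ℝ} {k : ℕ}
    (h : IntegrableOn (fun ξ => w ξ * ξ ^ k) (Ioi 0)) :
    AEStronglyMeasurable w (volume.restrict (Ioi 0)) := by
  have h1 : AEStronglyMeasurable (fun ξ : ℝ => w ξ * ξ ^ k * (ξ ^ k)⁻¹) (volume.restrict (Ioi 0)) :=
    h.aestronglyMeasurable.mul (by fun_prop : Measurable fun ξ : ℝ => (ξ ^ k)⁻¹).aestronglyMeasurable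
  refine h1.congr ?_
  filter_upwards [ae_restrict_mem measurableSet_Ioi] with ξ hξ
  have : ξ ≠ 0 := ne_of_gt hξ
  field_simp

theorem integrableOn_moment_between {w : ℝ → ℝ} (hw : ∀ ξ, 0 < ξ → 0 ≤ w ξ) {k l m : ℕ}
    (hkl : k ≤ l) (hlm : l ≤ m) (hk : IntegrableOn (fun ξ => w ξ * ξ ^ k) (Ioi 0))
    (hm : IntegrableOn (fun ξ => w ξ * ξ ^ m) (Ioi 0)) :
    IntegrableOn (fun ξ => w ξ * ξ ^ l) (Ioi 0) := by
  refine Integrable.mono' (hk.add hm)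
    ((aestronglyMeasurable_of_moment hk).mul (by fun_prop)) ?_
  filter_upwards [ae_restrict_mem measurableSet_Ioi] with ξ hξ
  have h0 : 0 < ξ := hξ
  have hwξ := hw ξ h0
  rw [Real.norm_of_nonneg (by positivity), Pi.add_apply, ← mul_add]
  refine mul_le_mul_of_nonneg_left ?_ hwξ
  rcases le_total ξ 1 with h | h
  · have := pow_le_pow_of_le_one h0.le h hkl
    have : 0 ≤ ξ ^ m := by positivity
    linarith
  · have := pow_le_pow_right₀ h hlm
    have : 0 ≤ ξ ^ k := by positivity
    linarith

/-- The linear bond stress. -/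
noncomputable def stiffStress (α : ℝ → ℝ) (ε : ℝ) (V : L2R) (ξ x : ℝ) : ℝ := α ξ * bond (ε * ξ) V x

/-- The quadratic form of the rescaled linear wave operator
`1 + ε⁻² ∫ α ξ² (1 - A²_{εξ}) dξ`. -/
noncomputable def waveForm (α : ℝ → ℝ) (ε : ℝ) (V φ : L2R) : ℝ :=
  inner ℝ V φ + (ε ^ 4)⁻¹ * ∫ ξ in Ioi (0 : ℝ), α ξ * ((ε * ξ) ^ 2 * inner ℝ V φ -
    inner ℝ (bondOp (ε * ξ) V) (bondOp (ε * ξ) φ))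

variable {α : ℝ → ℝ}

theorem stiffStress_admissible (hα : ∀ ξ, 0 < ξ → 0 ≤ α ξ)
    (h2 : IntegrableOn (fun ξ => α ξ * ξ ^ 2) (Ioi 0)) {ε : ℝ} (hε : 0 < ε) (V : L2R) :
    BondAdmissible (stiffStress α ε V) := by
  refine ⟨(aestronglyMeasurable_of_moment h2).comp_fst.mul
    (aestronglyMeasurable_bond_uncurry ε V _), fun ξ => α ξ * (ε * ξ * ‖V‖), ?_, fun ξ hξ => ?_⟩
  · refine (h2.const_mul (ε * ‖V‖)).congr (Eventually.of_forall fun ξ => ?_)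
    ring
  · have := hα ξ hξ
    have h0 : 0 ≤ ε * ξ := by positivity
    refine ⟨by positivity, ?_⟩
    exact (L2Bound.bond h0 V).mul (f := fun _ => α ξ) (by fun_prop) this
      (Eventually.of_forall fun x => (abs_of_nonneg this).le)

theorem stiffStress_integral {ε ξ : ℝ} (hε : 0 < ε) (hξ : 0 < ξ) (V φ : L2R) :
    ∫ x, stiffStress α ε V ξ x * bond (ε * ξ) φ x =
      α ξ * inner ℝ (bondOp (ε * ξ) V) (bondOp (ε * ξ) φ) := by
  rw [inner_bondOp_bondOp_eq_integral (by positivity), ← integral_const_mul]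
  congr 1; ext1 x; rw [stiffStress]; ring

theorem integrableOn_inner_bondOp (hα : ∀ ξ, 0 < ξ → 0 ≤ α ξ)
    (h2 : IntegrableOn (fun ξ => α ξ * ξ ^ 2) (Ioi 0)) {ε : ℝ} (hε : 0 < ε) (V φ : L2R) :
    IntegrableOn (fun ξ => α ξ * inner ℝ (bondOp (ε * ξ) V) (bondOp (ε * ξ) φ)) (Ioi 0) := by
  refine ((stiffStress_admissible hα h2 hε V).integrableOn hε.le φ).congr_fun (fun ξ hξ => ?_)
    measurableSet_Ioi
  exact stiffStress_integral hε hξ V φ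

theorem integrableOn_waveForm (hα : ∀ ξ, 0 < ξ → 0 ≤ α ξ)
    (h2 : IntegrableOn (fun ξ => α ξ * ξ ^ 2) (Ioi 0)) {ε : ℝ} (hε : 0 < ε) (V φ : L2R) :
    IntegrableOn (fun ξ => α ξ * ((ε * ξ) ^ 2 * inner ℝ V φ -
      inner ℝ (bondOp (ε * ξ) V) (bondOp (ε * ξ) φ))) (Ioi 0) := by
  simp_rw [mul_sub]
  refine Integrable.sub ?_ (integrableOn_inner_bondOp hα h2 hε V φ)
  refine (h2.const_mul (ε ^ 2 * inner ℝ V φ)).congr (Eventually.of_forall fun ξ => ?_)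
  ring

/-- The link with the original equation: the wave speed contributes `c₀² + ε²` with `c₀²` equal to
the second moment of `α`. This is what lets the two singular terms combine into the nonnegative
energy defect plus the identity. -/
theorem waveForm_eq (hα : ∀ ξ, 0 < ξ → 0 ≤ α ξ)
    (h2 : IntegrableOn (fun ξ => α ξ * ξ ^ 2) (Ioi 0)) {ε : ℝ} (hε : 0 < ε) (V φ : L2R) :
    waveForm α ε V φ = (ε ^ 2)⁻¹ * ((moment α 2 + ε ^ 2) * inner ℝ V φ) -
      (ε ^ 4)⁻¹ * bondForm ε (stiffStress α ε V) φ := by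
  have e1 : bondForm ε (stiffStress α ε V) φ =
      ∫ ξ in Ioi (0 : ℝ), α ξ * inner ℝ (bondOp (ε * ξ) V) (bondOp (ε * ξ) φ) :=
    setIntegral_congr_fun measurableSet_Ioi fun ξ hξ => stiffStress_integral hε hξ V φ
  have e2 : ∫ ξ in Ioi (0 : ℝ), α ξ * ((ε * ξ) ^ 2 * inner ℝ V φ -
      inner ℝ (bondOp (ε * ξ) V) (bondOp (ε * ξ) φ)) =
      ε ^ 2 * inner ℝ V φ * moment α 2 - bondForm ε (stiffStress α ε V) φ := by
    rw [e1, moment, ← integral_const_mul, ← integral_sub (h2.const_mul _)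
      (integrableOn_inner_bondOp hα h2 hε V φ)]
    congr 1; ext1 ξ; ring
  rw [waveForm, e2]
  field_simp
  ring

theorem norm_bondOp_sq_le {η : ℝ} (hη : 0 ≤ η) (V : L2R) :
    ‖bondOp η V‖ ^ 2 ≤ η ^ 2 * ‖V‖ ^ 2 := by
  rw [← mul_pow]
  exact pow_le_pow_left₀ (norm_nonneg _) (norm_bondOp_le hη V) 2

theorem waveForm_self (ε : ℝ) (V : L2R) :
    waveForm α ε V V = ‖V‖ ^ 2 + (ε ^ 4)⁻¹ * ∫ ξ in Ioi (0 : ℝ), α ξ * ((ε * ξ) ^ 2 * ‖V‖ ^ 2 -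
      ‖bondOp (ε * ξ) V‖ ^ 2) := by
  simp_rw [waveForm, real_inner_self_eq_norm_sq]

theorem energy_nonneg (hα : ∀ ξ, 0 < ξ → 0 ≤ α ξ) {ε : ℝ} (hε : 0 < ε) (V : L2R) :
    ∀ ξ, 0 < ξ → 0 ≤ α ξ * ((ε * ξ) ^ 2 * ‖V‖ ^ 2 - ‖bondOp (ε * ξ) V‖ ^ 2) := fun ξ hξ =>
  mul_nonneg (hα ξ hξ) (sub_nonneg.2 (norm_bondOp_sq_le (by positivity) V))

theorem norm_sq_le_waveForm (hα : ∀ ξ, 0 < ξ → 0 ≤ α ξ) {ε : ℝ} (hε : 0 < ε) (V : L2R) :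
    ‖V‖ ^ 2 ≤ waveForm α ε V V := by
  rw [waveForm_self]
  have : 0 ≤ ∫ ξ in Ioi (0 : ℝ), α ξ * ((ε * ξ) ^ 2 * ‖V‖ ^ 2 - ‖bondOp (ε * ξ) V‖ ^ 2) :=
    setIntegral_nonneg measurableSet_Ioi fun ξ hξ => energy_nonneg hα hε V ξ hξ
  have : 0 ≤ (ε ^ 4)⁻¹ * ∫ ξ in Ioi (0 : ℝ), α ξ * ((ε * ξ) ^ 2 * ‖V‖ ^ 2 -
    ‖bondOp (ε * ξ) V‖ ^ 2) := by positivity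
  linarith

/-- `V` solves the linear wave equation with right-hand side `f`. -/
def SolvesWave (α : ℝ → ℝ) (ε : ℝ) (V f : L2R) : Prop :=
  ∀ φ, waveForm α ε V φ = inner ℝ f φ

theorem SolvesWave.norm_le (hα : ∀ ξ, 0 < ξ → 0 ≤ α ξ) {ε : ℝ} (hε : 0 < ε) {V f : L2R}
    (h : SolvesWave α ε V f) : ‖V‖ ≤ ‖f‖ := by
  have h1 := norm_sq_le_waveForm hα hε V
  rw [h V] at h1
  have h2 := h1.trans (real_inner_le_norm f V)
  rcases eq_or_ne ‖V‖ 0 with h0 | h0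
  · rw [h0]; positivity
  · rw [sq] at h2
    exact le_of_mul_le_mul_right h2 (lt_of_le_of_ne (norm_nonneg V) h0.symm)

/-- Up to a positive factor the operator is `1 - c⁻¹ K`, where `K` represents the stiffness form. As
`‖K‖ ≤ ε² ∫ α ξ²` is strictly below `c = ε² (∫ α ξ² + ε²)`, a Neumann series inverts it. The bound
on the inverse that is uniform in `ε` comes from coercivity, in `SolvesWave.norm_le`. -/
theorem exists_waveInverse (hα : ∀ ξ, 0 < ξ → 0 ≤ α ξ)
    (h2 : IntegrableOn (fun ξ => α ξ * ξ ^ 2) (Ioi 0)) {ε : ℝ} (hε : 0 < ε) :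
    ∃ S : L2R →L[ℝ] L2R, ∀ V f, SolvesWave α ε V f ↔ V = S f := by
  have hm : 0 ≤ moment α 2 := setIntegral_nonneg measurableSet_Ioi fun ξ hξ =>
    mul_nonneg (hα ξ hξ) (by positivity)
  have hadm := fun V => stiffStress_admissible hα h2 hε V
  have hinner : ∀ V φ, inner ℝ (bondVec ε (stiffStress α ε V)) φ =
      ∫ ξ in Ioi (0 : ℝ), α ξ * inner ℝ (bondOp (ε * ξ) V) (bondOp (ε * ξ) φ) := fun V φ =>
    ((hadm V).inner_bondVec hε.le φ).trans
      (setIntegral_congr_fun measurableSet_Ioi fun ξ hξ => stiffStress_integral hε hξ V φ)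
  have hint := fun V φ => integrableOn_inner_bondOp hα h2 hε V φ
  let K : L2R →L[ℝ] L2R := LinearMap.mkContinuous
    { toFun := fun V => bondVec ε (stiffStress α ε V)
      map_add' := fun V V' => by
        refine ext_inner_right ℝ fun φ => ?_
        rw [inner_add_left, hinner, hinner, hinner, ← integral_add (hint V φ) (hint V' φ)]
        simp_rw [map_add, inner_add_left, mul_add]
      map_smul' := fun c V => by
        refine ext_inner_right ℝ fun φ => ?_
        rw [RingHom.id_apply, inner_smul_left, hinner, hinner, ← integral_const_mul]
        simp_rw [map_smul, inner_smul_left, RCLike.conj_to_real]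
        congr 1; ext1 ξ; ring } (ε ^ 2 * moment α 2) (fun V => by
      refine norm_le_of_abs_inner_le (by positivity) fun φ => ?_
      simp only [LinearMap.coe_mk, AddHom.coe_mk]
      rw [hinner, moment, mul_assoc, mul_assoc, ← integral_mul_const, ← integral_const_mul]
      rw [← Real.norm_eq_abs]
      refine norm_integral_le_of_norm_le
        ((h2.mul_const (‖V‖ * ‖φ‖)).const_mul (ε ^ 2)) ?_ |>.trans (le_of_eq ?_)
      · filter_upwards [ae_restrict_mem measurableSet_Ioi] with ξ hξ
        have h0 : 0 < ξ := hξ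
        have hαξ := hα ξ h0
        rw [norm_mul, Real.norm_of_nonneg hαξ]
        calc α ξ * ‖inner ℝ (bondOp (ε * ξ) V) (bondOp (ε * ξ) φ)‖
            ≤ α ξ * ((ε * ξ * ‖V‖) * (ε * ξ * ‖φ‖)) := by
              gcongr
              refine (abs_real_inner_le_norm _ _).trans ?_
              gcongr <;> exact norm_bondOp_le (by positivity) _
          _ = _ := by ring
      · rfl)
  have hK : ∀ V, K V = bondVec ε (stiffStress α ε V) := fun V => rfl
  have hKn : ‖K‖ ≤ ε ^ 2 * moment α 2 := LinearMap.mkContinuous_norm_le _ (by positivity) _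
  set c := ε ^ 2 * (moment α 2 + ε ^ 2) with hc
  have hc0 : 0 < c := by positivity
  have hlt : ‖c⁻¹ • K‖ < 1 := by
    rw [norm_smul, norm_inv, Real.norm_of_nonneg hc0.le, inv_mul_lt_iff₀ hc0, mul_one]
    refine hKn.trans_lt ?_
    rw [hc]; gcongr; linarith [pow_pos hε 2]
  let u := Units.oneSub (c⁻¹ • K) hlt
  have hu : ∀ V, (u : L2R →L[ℝ] L2R) V = V - c⁻¹ • K V := fun V => by
    simp [u]
  have hform : ∀ V φ, waveForm α ε V φ = (ε ^ 4)⁻¹ * c * inner ℝ ((u : L2R →L[ℝ] L2R) V) φ := by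
    intro V φ
    rw [waveForm_eq hα h2 hε, hu, inner_sub_left, inner_smul_left, hK,
      (hadm V).inner_bondVec hε.le, RCLike.conj_to_real, mul_sub, ← mul_assoc _ c⁻¹,
      mul_assoc _ c c⁻¹, mul_inv_cancel₀ hc0.ne', hc]
    field_simp
  refine ⟨(ε ^ 4 * c⁻¹) • (↑u⁻¹ : L2R →L[ℝ] L2R), fun V f => ?_⟩
  have hε4 : (ε ^ 4) ≠ 0 := by positivity
  have huinv : ∀ V, (↑u⁻¹ : L2R →L[ℝ] L2R) ((u : L2R →L[ℝ] L2R) V) = V := fun V => by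
    rw [← mul_apply_eq_comp, Units.inv_mul, one_apply_eq_self]
  have huinv' : ∀ V, (u : L2R →L[ℝ] L2R) ((↑u⁻¹ : L2R →L[ℝ] L2R) V) = V := fun V => by
    rw [← mul_apply_eq_comp, Units.mul_inv, one_apply_eq_self]
  constructor
  · intro h
    have h3 : f = ((ε ^ 4)⁻¹ * c) • (u : L2R →L[ℝ] L2R) V := by
      refine ext_inner_right ℝ fun φ => ?_
      rw [← h φ, hform, inner_smul_left, RCLike.conj_to_real]
    rw [h3, map_smul, smul_apply, huinv, smul_smul]
    rw [show (ε ^ 4)⁻¹ * c * (ε ^ 4 * c⁻¹) = 1 by field_simp, one_smul]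
  · rintro rfl φ
    rw [hform, smul_apply, map_smul, huinv', inner_smul_left,
      RCLike.conj_to_real, ← mul_assoc]
    rw [show (ε ^ 4)⁻¹ * c * (ε ^ 4 * c⁻¹) = 1 by field_simp, one_mul]

/-- Exhaust the half-line by `(a, ∞)` as `a → 0`. Bonds of length bounded below are needed because
the number of steps in `norm_tr_sub_le_of_energy` grows as the bond shrinks. -/
theorem exists_pos_setIntegral_Ioi_pos {f : ℝ → ℝ} (hf : IntegrableOn f (Ioi 0))
    (hpos : 0 < ∫ ξ in Ioi (0 : ℝ), f ξ) : ∃ a > 0, 0 < ∫ ξ in Ioi a, f ξ := by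
  have hc : AECover (volume.restrict (Ioi (0 : ℝ))) (𝓝[>] (0 : ℝ)) fun a => Ioi a :=
    aecover_Ioi_of_Ioi (tendsto_nhdsWithin_of_tendsto_nhds tendsto_id)
  have ht := hc.integral_tendsto_of_countably_generated hf
  have h1 := ht.eventually (lt_mem_nhds hpos)
  obtain ⟨a, ha, ha0⟩ := (h1.and self_mem_nhdsWithin).exists
  have ha0' : 0 < a := ha0
  refine ⟨a, ha0', ?_⟩
  rwa [Measure.restrict_restrict measurableSet_Ioi,
    inter_eq_left.2 (Ioi_subset_Ioi ha0'.le)] at ha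

/-- Testing the equation with `V` itself bounds the `α`-weighted energy by `ε⁴ ‖f‖²`. Some single
bond `ξ > a` must then have a small energy defect, and that one bond, of scaled length `εξ`, already
controls all translations of `V`. -/
theorem SolvesWave.exists_modulus (hα : ∀ ξ, 0 < ξ → 0 ≤ α ξ)
    (h2 : IntegrableOn (fun ξ => α ξ * ξ ^ 2) (Ioi 0))
    (hpos : 0 < ∫ ξ in Ioi (0 : ℝ), α ξ * ξ ^ 2) :
    ∃ C > 0, ∀ ε > 0, ∀ V f, SolvesWave α ε V f → ∀ t,
      ‖tr t V - V‖ ≤ C * (|t| + ε) * ‖f‖ := by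
  obtain ⟨a, ha, hm⟩ := exists_pos_setIntegral_Ioi_pos h2 hpos
  set m := ∫ ξ in Ioi a, α ξ * ξ ^ 2 with hmdef
  refine ⟨(2 / a + 1) * (4 * Real.sqrt (2 / m)), by positivity, fun ε hε V f h t => ?_⟩
  rcases eq_or_ne f 0 with rfl | hf
  · have := h.norm_le hα hε
    have hV : V = 0 := by simpa using this
    simp [hV]
  have hf0 : 0 < ‖f‖ := norm_pos_iff.2 hf
  set e : ℝ → ℝ := fun ξ => (ε * ξ) ^ 2 * ‖V‖ ^ 2 - ‖bondOp (ε * ξ) V‖ ^ 2 with he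
  have hint : IntegrableOn (fun ξ => α ξ * e ξ) (Ioi 0) := by
    have := integrableOn_waveForm hα h2 hε V V
    simp_rw [real_inner_self_eq_norm_sq] at this
    exact this
  have hE : ∫ ξ in Ioi (0 : ℝ), α ξ * e ξ ≤ ε ^ 4 * ‖f‖ ^ 2 := by
    have h1 := waveForm_self (α := α) ε V
    rw [h V] at h1
    have h3 := real_inner_le_norm f V
    have h4 := h.norm_le hα hε
    have h5 : (ε ^ 4)⁻¹ * ∫ ξ in Ioi (0 : ℝ), α ξ * e ξ ≤ ‖f‖ ^ 2 := by
      have : ‖f‖ * ‖V‖ ≤ ‖f‖ * ‖f‖ := by gcongr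
      nlinarith [sq_nonneg ‖V‖]
    rwa [inv_mul_le_iff₀ (by positivity)] at h5
  -- Pigeonhole: if every bond longer than `a` violated this, the total energy would be at least `2
  -- ε⁴ ‖f‖²`. The factor 2 in `2 / m` makes the contradiction strict.
  have hex : ∃ ξ, a < ξ ∧ e ξ ≤ (ε * ξ) ^ 2 * (ε * ‖f‖ * Real.sqrt (2 / m)) ^ 2 := by
    by_contra! hcon
    have h6 : ∫ ξ in Ioi a, ε ^ 4 * ‖f‖ ^ 2 * (2 / m) * (α ξ * ξ ^ 2) ≤
        ∫ ξ in Ioi a, α ξ * e ξ := by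
      refine setIntegral_mono_on ((h2.mono_set (Ioi_subset_Ioi ha.le)).const_mul _)
        (hint.mono_set (Ioi_subset_Ioi ha.le)) measurableSet_Ioi fun ξ hξ => ?_
      have h7 := mul_le_mul_of_nonneg_left (hcon ξ hξ).le (hα ξ (ha.trans hξ))
      refine le_trans (le_of_eq ?_) h7
      rw [mul_pow _ (Real.sqrt _), Real.sq_sqrt (by positivity)]
      ring
    have h7 : ∫ ξ in Ioi a, α ξ * e ξ ≤ ∫ ξ in Ioi (0 : ℝ), α ξ * e ξ :=
      setIntegral_mono_set hint
        ((ae_restrict_mem measurableSet_Ioi).mono fun ξ hξ => energy_nonneg hα hε V ξ hξ)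
        (Ioi_subset_Ioi ha.le).eventuallyLE
    rw [integral_const_mul, ← hmdef, mul_assoc, div_mul_cancel₀ _ hm.ne'] at h6
    have : 0 < ε ^ 4 * ‖f‖ ^ 2 := by positivity
    linarith
  obtain ⟨ξ, hξ, hle⟩ := hex
  have hξ0 : 0 < ξ := ha.trans hξ
  refine (norm_tr_sub_le_of_energy (by positivity) (by positivity) V hle t).trans ?_
  have h8 : 2 * |t| / (ε * ξ) + 1 ≤ (2 / a + 1) * (|t| + ε) / ε := by
    rw [le_div_iff₀ hε]
    have h9 : 2 * |t| / (ε * ξ) * ε ≤ 2 / a * |t| := by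
      rw [show 2 * |t| / (ε * ξ) * ε = 2 / ξ * |t| by field_simp]
      gcongr
    have h10 : 0 ≤ 2 / a * ε := by positivity
    nlinarith [abs_nonneg t]
  calc _ ≤ (2 / a + 1) * (|t| + ε) / ε * (4 * (ε * ‖f‖ * Real.sqrt (2 / m))) := by gcongr
    _ = _ := by field_simp

/-- The normalization `κ² ∫ α ξ⁴ = 12` makes the second order Taylor term of the bond operators
equal to `ε⁴ (green κ V - V)`, which turns the form at `green κ V` into `⟨V, φ⟩`. Only the Taylor
remainder `B` contributes to the error. -/
theorem abs_waveForm_green_sub_le (hα : ∀ ξ, 0 < ξ → 0 ≤ α ξ)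
    (h2 : IntegrableOn (fun ξ => α ξ * ξ ^ 2) (Ioi 0))
    (h4 : IntegrableOn (fun ξ => α ξ * ξ ^ 4) (Ioi 0)) {κ : ℝ}
    (hκα : κ ^ 2 * moment α 4 = 12) {ε : ℝ} (hε : 0 < ε) (V φ : L2R) {B : ℝ → ℝ}
    (hBi : IntegrableOn (fun ξ => α ξ * (ξ ^ 2 * B ξ)) (Ioi 0))
    (hB : ∀ ξ, 0 < ξ → ∀ u, 0 ≤ u → u ≤ ε * ξ →
      ‖symTr u (green κ V) - green κ V - (u ^ 2 / 2) • κ ^ 2 • (green κ V - V)‖ ≤ B ξ) :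
    |waveForm α ε (green κ V) φ - inner ℝ V φ| ≤
      (ε ^ 2)⁻¹ * (∫ ξ in Ioi (0 : ℝ), α ξ * (ξ ^ 2 * B ξ)) * ‖φ‖ := by
  set g := green κ V with hg
  set G := κ ^ 2 • (g - V) with hG
  have e : waveForm α ε g φ - inner ℝ V φ = (ε ^ 4)⁻¹ * ∫ ξ in Ioi (0 : ℝ),
      α ξ * ((ε * ξ) ^ 2 * inner ℝ g φ - inner ℝ (bondOp (ε * ξ) g) (bondOp (ε * ξ) φ) +
        (ε * ξ) ^ 4 / 12 * inner ℝ G φ) := by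
    have h5 : (fun ξ => α ξ * ((ε * ξ) ^ 2 * inner ℝ g φ -
        inner ℝ (bondOp (ε * ξ) g) (bondOp (ε * ξ) φ) + (ε * ξ) ^ 4 / 12 * inner ℝ G φ)) =
        fun ξ => α ξ * ((ε * ξ) ^ 2 * inner ℝ g φ -
          inner ℝ (bondOp (ε * ξ) g) (bondOp (ε * ξ) φ)) +
          ε ^ 4 / 12 * inner ℝ G φ * (α ξ * ξ ^ 4) := by
      ext1 ξ; ring
    rw [h5, integral_add (integrableOn_waveForm hα h2 hε g φ) (h4.const_mul _),
      integral_const_mul, waveForm]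
    change _ = (ε ^ 4)⁻¹ * (_ + ε ^ 4 / 12 * inner ℝ G φ * moment α 4)
    rw [hG, inner_smul_left, inner_sub_left, RCLike.conj_to_real]
    have h6 : ε ^ 4 / 12 * (κ ^ 2 * (inner ℝ g φ - inner ℝ V φ)) * moment α 4 =
        ε ^ 4 * (inner ℝ g φ - inner ℝ V φ) := by
      linear_combination ε ^ 4 / 12 * (inner ℝ g φ - inner ℝ V φ) * hκα
    rw [h6, mul_add, ← mul_assoc _ (ε ^ 4), inv_mul_cancel₀ (by positivity)]
    ring
  rw [e, abs_mul, abs_of_nonneg (by positivity)]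
  have h7 : |∫ ξ in Ioi (0 : ℝ), α ξ * ((ε * ξ) ^ 2 * inner ℝ g φ -
      inner ℝ (bondOp (ε * ξ) g) (bondOp (ε * ξ) φ) + (ε * ξ) ^ 4 / 12 * inner ℝ G φ)| ≤
      ∫ ξ in Ioi (0 : ℝ), ε ^ 2 * ‖φ‖ * (α ξ * (ξ ^ 2 * B ξ)) := by
    rw [← Real.norm_eq_abs]
    refine norm_integral_le_of_norm_le (hBi.const_mul (ε ^ 2 * ‖φ‖)) ?_
    filter_upwards [ae_restrict_mem measurableSet_Ioi] with ξ hξ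
    have h0 : 0 < ξ := hξ
    rw [norm_mul, Real.norm_of_nonneg (hα ξ h0)]
    have := abs_inner_bondOp_expansion_le (by positivity : 0 ≤ ε * ξ) g G φ (hB ξ h0)
    refine (mul_le_mul_of_nonneg_left this (hα ξ h0)).trans (le_of_eq ?_)
    ring
  refine (mul_le_mul_of_nonneg_left h7 (by positivity)).trans (le_of_eq ?_)
  rw [integral_const_mul]
  field_simp

theorem norm_symTr_sub_le (t : ℝ) (V : L2R) : ‖symTr t V - V‖ ≤ ‖tr t V - V‖ := by
  have e : symTr t V - V = (1 / 2 : ℝ) • (tr t V - V) + (1 / 2 : ℝ) • (tr (-t) V - V) := by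
    rw [symTr]; module
  rw [e]
  refine (norm_add_le _ _).trans ?_
  rw [norm_smul, norm_smul, norm_tr_sub_neg]
  norm_num
  linarith

theorem symTr_green {κ : ℝ} (hκ : 0 < κ) (t : ℝ) (V : L2R) :
    symTr t (green κ V) = green κ (symTr t V) := by
  rw [symTr, symTr, map_smul, map_add, tr_green hκ, tr_green hκ]

theorem symTr_sub (t : ℝ) (V W : L2R) : symTr t (V - W) = symTr t V - symTr t W := by
  rw [symTr, symTr, symTr, map_sub, map_sub]; module

theorem symTr_smul (t c : ℝ) (V : L2R) : symTr t (c • V) = c • symTr t V := by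
  rw [symTr, symTr, map_smul, map_smul]; module

theorem norm_symTr_greenDefect_sub_le {κ : ℝ} (hκ : 0 < κ) (t : ℝ) (V : L2R) :
    ‖symTr t (κ ^ 2 • (green κ V - V)) - κ ^ 2 • (green κ V - V)‖ ≤
      2 * κ ^ 2 * ‖symTr t V - V‖ := by
  have e : symTr t (κ ^ 2 • (green κ V - V)) - κ ^ 2 • (green κ V - V) =
      κ ^ 2 • (green κ (symTr t V - V) - (symTr t V - V)) := by
    rw [symTr_smul, symTr_sub, symTr_green hκ, map_sub]; module
  rw [e, norm_smul, Real.norm_of_nonneg (by positivity)]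
  have := (norm_sub_le (green κ (symTr t V - V)) (symTr t V - V)).trans
    (add_le_add_left (norm_green_le hκ _) _)
  nlinarith [sq_nonneg κ]

theorem inner_bondOp_green {κ η : ℝ} (hκ : 0 < κ) (hη : 0 ≤ η) (V φ : L2R) :
    inner ℝ (bondOp η V) (bondOp η (green κ φ)) =
      inner ℝ (bondOp η (green κ V)) (bondOp η φ) := by
  rw [inner_bondOp_bondOp hη, inner_bondOp_bondOp hη]
  congr 1; ext1 u
  rw [← inner_green_left hκ, tr_green hκ]

/-- Both operators are built from translations, hence commute, and `green κ` is symmetric. -/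
theorem waveForm_green {κ : ℝ} (hκ : 0 < κ) {ε : ℝ} (hε : 0 < ε) (V φ : L2R) :
    waveForm α ε V (green κ φ) = waveForm α ε (green κ V) φ := by
  rw [waveForm, waveForm, ← inner_green_left hκ]
  congr 2
  refine setIntegral_congr_fun measurableSet_Ioi fun ξ hξ => ?_
  have h0 : 0 < ξ := hξ
  simp only [inner_bondOp_green hκ (by positivity : 0 ≤ ε * ξ)]

/-- Convergence of the rescaled linear wave operators to the KdV operator `1 - κ⁻² ∂²` in the
norm resolvent sense. -/
theorem SolvesWave.exists_norm_sub_green_le (hα : ∀ ξ, 0 < ξ → 0 ≤ α ξ)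
    (h2 : IntegrableOn (fun ξ => α ξ * ξ ^ 2) (Ioi 0))
    (h4 : IntegrableOn (fun ξ => α ξ * ξ ^ 4) (Ioi 0))
    (h6 : IntegrableOn (fun ξ => α ξ * ξ ^ 6) (Ioi 0))
    (hpos : 0 < ∫ ξ in Ioi (0 : ℝ), α ξ * ξ ^ 2) {κ : ℝ} (hκ : 0 < κ)
    (hκα : κ ^ 2 * moment α 4 = 12) :
    ∃ C > 0, ∀ ε > 0, ∀ V f, SolvesWave α ε V f → ‖V - green κ f‖ ≤ C * ε * ‖f‖ := by
  obtain ⟨C, hC, hmod⟩ := SolvesWave.exists_modulus hα h2 hpos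
  have h5 := integrableOn_moment_between hα (by norm_num : 4 ≤ 5) (by norm_num : 5 ≤ 6) h4 h6
  have hm5 : 0 ≤ moment α 5 := setIntegral_nonneg measurableSet_Ioi fun ξ hξ =>
    mul_nonneg (hα ξ hξ) (pow_nonneg (le_of_lt hξ) _)
  have hm4 : 0 ≤ moment α 4 := setIntegral_nonneg measurableSet_Ioi fun ξ hξ =>
    mul_nonneg (hα ξ hξ) (pow_nonneg (le_of_lt hξ) _)
  refine ⟨κ ^ 2 * C * (moment α 5 + moment α 4) + 1, by positivity, fun ε hε V f h => ?_⟩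
  suffices hs : ‖V - green κ f‖ ≤ κ ^ 2 * C * (moment α 5 + moment α 4) * ε * ‖f‖ by
    refine hs.trans ?_
    gcongr
    linarith
  refine norm_le_of_abs_inner_le (by positivity) fun φ => ?_
  -- Duality moves the resolvent from the data onto the solution: the difference becomes that of
  -- `⟨V, φ⟩` and the form at `green κ V`. Thus only the modulus of continuity of `V` is required,
  -- and no derivatives.
  rw [inner_sub_left, inner_green_left hκ, ← h, waveForm_green hκ hε, abs_sub_comm]
  -- On shifts up to `εξ` the modulus of `V` is at most a multiple of `(εξ + ε) ‖f‖`; two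
  -- integrations add the factor `(εξ)²`. This accounts for the moments 5 and 4 of `α`.
  set B : ℝ → ℝ := fun ξ => κ ^ 2 * C * (ε * ξ + ε) * ‖f‖ * (ε * ξ) ^ 2 with hBdef
  have e : (fun ξ => α ξ * (ξ ^ 2 * B ξ)) = fun ξ =>
      κ ^ 2 * C * ε ^ 3 * ‖f‖ * (α ξ * ξ ^ 5 + α ξ * ξ ^ 4) := by
    ext1 ξ; rw [hBdef]; ring
  have := abs_waveForm_green_sub_le hα h2 h4 hκα hε V φ (B := B) ?_ ?_
  · refine this.trans (le_of_eq ?_)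
    rw [e, integral_const_mul, integral_add h5 h4]
    change (ε ^ 2)⁻¹ * (_ * (moment α 5 + moment α 4)) * _ = _
    field_simp
  · rw [e]; exact (h5.add h4).const_mul _
  · intro ξ hξ u hu huξ
    have hM : ∀ t, 0 ≤ t → t ≤ ε * ξ →
        ‖symTr t (κ ^ 2 • (green κ V - V)) - κ ^ 2 • (green κ V - V)‖ ≤
          2 * κ ^ 2 * (C * (ε * ξ + ε) * ‖f‖) * t ^ 0 := by
      intro t ht htξ
      refine (norm_symTr_greenDefect_sub_le hκ t V).trans ?_
      rw [pow_zero, mul_one]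
      gcongr
      refine (norm_symTr_sub_le t V).trans ((hmod ε hε V f h t).trans ?_)
      rw [abs_of_nonneg ht]
      gcongr
    refine (norm_symTr_green_sub_le hκ 0 V hM u hu huξ).trans ?_
    have : u ^ 2 ≤ (ε * ξ) ^ 2 := by gcongr
    simp only [hBdef]
    norm_num
    calc _ ≤ 2 * κ ^ 2 * (C * (ε * ξ + ε) * ‖f‖) / 2 * (ε * ξ) ^ 2 := by gcongr
      _ = _ := by ring

end Peridynamics

/-! ### Estimates for the nonlinear stresses -/

namespace Peridynamics

/-- The bilinear bond stress. -/
noncomputable def quadStress (β : ℝ → ℝ) (ε : ℝ) (V W : L2R) (ξ x : ℝ) : ℝ :=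
  β ξ * (bond (ε * ξ) V x * bond (ε * ξ) W x)

/-- The bond stress of the force law `P`. -/
noncomputable def lawStress (P : ℝ → ℝ → ℝ) (ε : ℝ) (W : L2R) (ξ x : ℝ) : ℝ :=
  P (ε * bond (ε * ξ) W x) ξ

section Quadratic

variable {β : ℝ → ℝ}

theorem sq_mul_sqrt_eq_rpow {ξ : ℝ} (hξ : 0 < ξ) : ξ ^ 2 * Real.sqrt ξ = ξ ^ (5 / 2 : ℝ) := by
  rw [Real.sqrt_eq_rpow, ← Real.rpow_natCast, ← Real.rpow_add hξ]
  norm_num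

theorem quadStress_bound (hβ : ∀ ξ, 0 < ξ → 0 ≤ β ξ) {ε ξ : ℝ} (hε : 0 < ε) (hξ : 0 < ξ)
    (V W : L2R) : L2Bound (quadStress β ε V W ξ)
      (β ξ * (Real.sqrt (ε * ξ) * ‖V‖ * (ε * ξ * ‖W‖))) := by
  have h0 : 0 ≤ ε * ξ := by positivity
  have h1 := (L2Bound.bond h0 W).mul (f := bond (ε * ξ) V)
    (continuous_bond _ V).aestronglyMeasurable (by positivity)
    (Eventually.of_forall fun x => abs_bond_le h0 V x)
  exact h1.mul (f := fun _ => β ξ) (by fun_prop) (hβ ξ hξ)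
    (Eventually.of_forall fun x => (abs_of_nonneg (hβ ξ hξ)).le)

theorem quadStress_weight {ε ξ : ℝ} (hε : 0 < ε) (hξ : 0 < ξ) (b v w : ℝ) :
    ξ * (b * (Real.sqrt (ε * ξ) * v * (ε * ξ * w))) =
      ε * Real.sqrt ε * v * w * (b * ξ ^ (5 / 2 : ℝ)) := by
  rw [Real.sqrt_mul hε.le, ← sq_mul_sqrt_eq_rpow hξ]; ring

theorem quadStress_admissible (hβ : ∀ ξ, 0 < ξ → 0 ≤ β ξ)
    (h52 : IntegrableOn (fun ξ => β ξ * ξ ^ (5 / 2 : ℝ)) (Ioi 0))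
    (h3 : IntegrableOn (fun ξ => β ξ * ξ ^ 3) (Ioi 0)) {ε : ℝ} (hε : 0 < ε) (V W : L2R) :
    BondAdmissible (quadStress β ε V W) := by
  refine ⟨(aestronglyMeasurable_of_moment h3).comp_fst.mul
    ((aestronglyMeasurable_bond_uncurry ε V _).mul (aestronglyMeasurable_bond_uncurry ε W _)),
    fun ξ => β ξ * (Real.sqrt (ε * ξ) * ‖V‖ * (ε * ξ * ‖W‖)), ?_, fun ξ hξ => ⟨?_, ?_⟩⟩
  · refine IntegrableOn.congr_fun (h52.const_mul (ε * Real.sqrt ε * ‖V‖ * ‖W‖)) (fun ξ hξ => ?_)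
      measurableSet_Ioi
    exact (quadStress_weight hε hξ _ _ _).symm
  · have := hβ ξ hξ
    positivity
  · exact quadStress_bound hβ hε hξ V W

theorem abs_bondForm_quadStress_le (hβ : ∀ ξ, 0 < ξ → 0 ≤ β ξ)
    (h52 : IntegrableOn (fun ξ => β ξ * ξ ^ (5 / 2 : ℝ)) (Ioi 0)) {ε : ℝ} (hε : 0 < ε)
    (V W φ : L2R) :
    |bondForm ε (quadStress β ε V W) φ| ≤
      ε ^ 2 * Real.sqrt ε * (∫ ξ in Ioi (0 : ℝ), β ξ * ξ ^ (5 / 2 : ℝ)) * ‖V‖ * ‖W‖ * ‖φ‖ := by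
  refine (abs_bondForm_le (h52.const_mul (ε ^ 2 * Real.sqrt ε * ‖V‖ * ‖W‖ * ‖φ‖))
    fun ξ hξ => ?_).trans (le_of_eq ?_)
  · have := hβ ξ hξ
    refine (abs_integral_mul_bond_le hε.le hξ.le (by positivity)
      (quadStress_bound hβ hε hξ V W) φ).trans (le_of_eq ?_)
    rw [quadStress_weight hε hξ]; ring
  · rw [integral_const_mul]; ring

theorem integral_quadStress (ε ξ : ℝ) (V W φ : L2R) :
    ∫ x, quadStress β ε V W ξ x * bond (ε * ξ) φ x =
      β ξ * ∫ x, bond (ε * ξ) V x * bond (ε * ξ) W x * bond (ε * ξ) φ x := by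
  rw [← integral_const_mul]
  congr 1; ext1 x; rw [quadStress]; ring

/-- Increments of an essentially bounded test function are linear in `εξ` rather than of order
`√(εξ)`. The gained half power of `ε` exactly balances the prefactor `ε⁻³` of the quadratic
nonlinearity. -/
theorem abs_bondForm_quadStress_le_of_bounded_test (hβ : ∀ ξ, 0 < ξ → 0 ≤ β ξ)
    (h3 : IntegrableOn (fun ξ => β ξ * ξ ^ 3) (Ioi 0)) {ε b : ℝ} (hε : 0 < ε) (hb : 0 ≤ b)
    (V W : L2R) {ψ : L2R} (hψ : ∀ᵐ x, |ψ x| ≤ b) :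
    |bondForm ε (quadStress β ε V W) ψ| ≤ ε ^ 3 * moment β 3 * b * ‖V‖ * ‖W‖ := by
  refine (abs_bondForm_le (h3.const_mul (ε ^ 3 * b * ‖V‖ * ‖W‖))
    fun ξ hξ => ?_).trans (le_of_eq ?_)
  · have h0 : 0 ≤ ε * ξ := by positivity
    have hβξ := hβ ξ hξ
    rw [integral_quadStress, abs_mul, abs_of_nonneg hβξ]
    have h1 := (L2Bound.bond h0 W).mul (f := bond (ε * ξ) ψ)
      (continuous_bond _ ψ).aestronglyMeasurable (by positivity)
      (Eventually.of_forall fun x => abs_bond_le_of_ae_le h0 hψ x)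
    have h2 := (L2Bound.bond h0 V).abs_integral_mul_le h1 (by positivity) (by positivity)
    have e : ∫ x, bond (ε * ξ) V x * bond (ε * ξ) W x * bond (ε * ξ) ψ x =
        ∫ x, bond (ε * ξ) V x * (bond (ε * ξ) ψ x * bond (ε * ξ) W x) := by
      congr 1; ext1 x; ring
    rw [e]
    refine (mul_le_mul_of_nonneg_left h2 hβξ).trans (le_of_eq ?_)
    ring
  · rw [integral_const_mul, moment]; ring

theorem abs_bondForm_quadStress_le_of_bounded (hβ : ∀ ξ, 0 < ξ → 0 ≤ β ξ)
    (h3 : IntegrableOn (fun ξ => β ξ * ξ ^ 3) (Ioi 0)) {ε b : ℝ} (hε : 0 < ε) (hb : 0 ≤ b)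
    {V : L2R} (hV : ∀ᵐ x, |V x| ≤ b) (W φ : L2R) :
    |bondForm ε (quadStress β ε V W) φ| ≤ ε ^ 3 * moment β 3 * b * ‖W‖ * ‖φ‖ := by
  refine (abs_bondForm_le (h3.const_mul (ε ^ 3 * b * ‖W‖ * ‖φ‖))
    fun ξ hξ => ?_).trans (le_of_eq ?_)
  · have h0 : 0 ≤ ε * ξ := by positivity
    have hβξ := hβ ξ hξ
    rw [integral_quadStress, abs_mul, abs_of_nonneg hβξ]
    have h1 := (L2Bound.bond h0 W).mul (f := bond (ε * ξ) V)
      (continuous_bond _ V).aestronglyMeasurable (by positivity)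
      (Eventually.of_forall fun x => abs_bond_le_of_ae_le h0 hV x)
    have h2 := h1.abs_integral_mul_le (L2Bound.bond h0 φ) (by positivity) (by positivity)
    refine (mul_le_mul_of_nonneg_left h2 hβξ).trans (le_of_eq ?_)
    ring
  · rw [integral_const_mul, moment]; ring

theorem abs_inner_bondOp_sub_le {η M : ℝ} (hη : 0 ≤ η) (V m : L2R)
    (hM : ∀ s, 0 ≤ s → s ≤ η → ‖tr s m - m‖ ≤ M) :
    |inner ℝ m (bondOp η V) - η * inner ℝ m V| ≤ η * M * ‖V‖ := by
  have hc : Continuous fun s => inner ℝ (tr s V) m := continuous_inner_tr V m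
  have e : inner ℝ m (bondOp η V) - η * inner ℝ m V =
      ∫ s in (0 : ℝ)..η, (inner ℝ (tr s V) m - inner ℝ V m) := by
    rw [intervalIntegral.integral_sub (hc.intervalIntegrable _ _) (by simp), real_inner_comm,
      inner_bondOp_left hη, real_inner_comm V m]
    simp
  rw [e, ← Real.norm_eq_abs]
  refine (intervalIntegral.norm_integral_le_of_norm_le_const (C := M * ‖V‖)
    fun s hs => ?_).trans ?_
  · rw [uIoc_of_le hη] at hs
    rw [inner_tr_left, ← inner_sub_right, mul_comm]
    refine (norm_inner_le_norm _ _).trans ?_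
    gcongr
    rw [norm_tr_sub_neg]
    exact hM s hs.1.le hs.2
  · rw [sub_zero, abs_of_nonneg hη]
    exact le_of_eq (by ring)

/-- Increments are replaced by `η` times values one factor at a time: for `green κ φ` by the
Lipschitz continuity of its orbit, for `W₀` by that of `w`. The remaining factor `V` is merely
square integrable, so its average is transferred to the product of `w` with `green κ φ`, which does
have a translation modulus. -/
theorem abs_integral_bond_triple_sub_le {W₀ : L2R} {w : ℝ → ℝ} {b₀ b₁ κ : ℝ}
    (hw : W₀ =ᵐ[volume] w) (hwc : Continuous w) (hb0 : 0 ≤ b₀) (hb1 : 0 ≤ b₁)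
    (hb : ∀ x, |w x| ≤ b₀) (hL : ∀ x y, |w x - w y| ≤ b₁ * |x - y|) (hκ : 0 < κ) {η : ℝ}
    (hη : 0 ≤ η) (V φ : L2R) :
    |(∫ x, bond η W₀ x * bond η V x * bond η (green κ φ) x) -
      η ^ 3 * ∫ x, w x * V x * green κ φ x| ≤ 2 * (b₀ * κ + b₁) * η ^ 4 * ‖V‖ * ‖φ‖ := by
  set ψ := green κ φ with hψ
  have hψn : ‖ψ‖ ≤ ‖φ‖ := norm_green_le hκ φ
  have hψt : ∀ s, 0 ≤ s → s ≤ η → ‖tr s ψ - ψ‖ ≤ κ * η * ‖φ‖ := by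
    intro s hs hsη
    refine (norm_tr_green_sub_le hκ s φ).trans ?_
    rw [abs_of_nonneg hs]; gcongr
  have hD0 : ∀ x, |bond η W₀ x| ≤ η * b₀ :=
    abs_bond_le_of_ae_le hη (hw.mono fun x hx => by rw [hx]; exact hb x)
  have hD1 : ∀ x, |bond η W₀ x - η * w x| ≤ b₁ * η * η := by
    intro x
    have e : bond η W₀ x - η * w x = ∫ t in x..(x + η), (w t - w x) := by
      rw [intervalIntegral.integral_sub (hwc.intervalIntegrable _ _) (by simp), bond_eq,
        bond_congr hw]
      simp
    rw [e, ← Real.norm_eq_abs]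
    refine (intervalIntegral.norm_integral_le_of_norm_le_const (C := b₁ * η)
      fun t ht => ?_).trans ?_
    · rw [uIoc_of_le (by linarith)] at ht
      refine (hL t x).trans ?_
      rw [abs_of_nonneg (by linarith [ht.1])]
      gcongr
      linarith [ht.2]
    · rw [add_sub_cancel_left, abs_of_nonneg hη]
  have hV := L2Bound.coe V
  have hψb : L2Bound ψ ‖φ‖ := L2Bound.coe_of_le hψn
  have hDV := L2Bound.bond hη V
  have hDψ := L2Bound.bond hη ψ
  have hDψ1 : L2Bound (fun x => bond η ψ x - η * ψ x) (η * (κ * η * ‖φ‖)) := by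
    refine (L2Bound.coe_of_le (norm_bondOp_sub_le hη ψ hψt)).congr ?_
    filter_upwards [bondOp_coe hη ψ, Lp.coeFn_sub (bondOp η ψ) (η • ψ), Lp.coeFn_smul η ψ]
      with x h1 h2 h3
    rw [h2, Pi.sub_apply, h1, h3, Pi.smul_apply, smul_eq_mul]
  have hwa : AEStronglyMeasurable w volume := hwc.aestronglyMeasurable
  have hDa : AEStronglyMeasurable (bond η W₀) volume := (continuous_bond η W₀).aestronglyMeasurable
  have hm : L2Bound (fun x => w x * ψ x) (b₀ * ‖φ‖) :=
    hψb.mul hwa hb0 (Eventually.of_forall hb)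
  set m : L2R := hm.memLp.toLp _ with hmdef
  have hmc : (m : ℝ → ℝ) =ᵐ[volume] fun x => w x * ψ x := hm.memLp.coeFn_toLp
  have hmt : ∀ s, 0 ≤ s → s ≤ η → ‖tr s m - m‖ ≤ (b₀ * κ + b₁) * η * ‖φ‖ := by
    intro s hs hsη
    have h1 : L2Bound (fun x => w (x + s) * (tr s ψ - ψ : L2R) x) (b₀ * (κ * η * ‖φ‖)) :=
      (L2Bound.coe_of_le (hψt s hs hsη)).mul
        (hwc.comp (continuous_add_const s)).aestronglyMeasurable hb0
        (Eventually.of_forall fun x => hb _)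
    have h2 : L2Bound (fun x => (w (x + s) - w x) * ψ x) (b₁ * η * ‖φ‖) := by
      refine hψb.mul (by fun_prop) (by positivity) (Eventually.of_forall fun x => ?_)
      refine (hL _ _).trans ?_
      rw [add_sub_cancel_left, abs_of_nonneg hs]; gcongr
    have h3 := h1.add h2 (by positivity) (by positivity)
    have h4 : L2Bound (tr s m - m : L2R) ((b₀ * κ + b₁) * η * ‖φ‖) := by
      refine (h3.mono (le_of_eq (by ring))).congr ?_
      filter_upwards [Lp.coeFn_sub (tr s m) m, Lp.coeFn_sub (tr s ψ) ψ, tr_coe s m, tr_coe s ψ,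
        hmc, ae_comp_add s hmc] with x h5 h6 h7 h8 h9 h10
      rw [h5, Pi.sub_apply, h6, Pi.sub_apply, h7, h8, h9, h10]
      ring
    have h5 := h4.norm_toLp_le (by positivity)
    rwa [Lp.toLp_coeFn] at h5
  have t1 : |∫ x, (bond η W₀ x * bond η V x) * (bond η ψ x - η * ψ x)| ≤
      η * b₀ * (η * ‖V‖) * (η * (κ * η * ‖φ‖)) :=
    (hDV.mul hDa (by positivity) (Eventually.of_forall hD0)).abs_integral_mul_le hDψ1
      (by positivity) (by positivity)
  have t2 : |∫ x, ((bond η W₀ x - η * w x) * bond η V x) * ψ x| ≤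
      b₁ * η * η * (η * ‖V‖) * ‖φ‖ :=
    (hDV.mul (f := fun x => bond η W₀ x - η * w x) (hDa.sub (hwa.const_mul _)) (by positivity)
      (Eventually.of_forall hD1)).abs_integral_mul_le hψb (by positivity) (by positivity)
  have t3 : |(∫ x, (w x * ψ x) * bond η V x) - η * ∫ x, (w x * ψ x) * V x| ≤
      η * ((b₀ * κ + b₁) * η * ‖φ‖) * ‖V‖ := by
    have := abs_inner_bondOp_sub_le hη V m hmt
    rw [inner_bondOp_eq_integral hη, inner_eq_integral] at this
    rwa [integral_congr_ae (hmc.mono fun x hx => by beta_reduce; rw [hx] :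
        (fun x => m x * bond η V x) =ᵐ[volume] fun x => (w x * ψ x) * bond η V x),
      integral_congr_ae (hmc.mono fun x hx => by beta_reduce; rw [hx] :
        (fun x => m x * V x) =ᵐ[volume] fun x => (w x * ψ x) * V x)] at this
  have e : (∫ x, bond η W₀ x * bond η V x * bond η ψ x) - η ^ 3 * ∫ x, w x * V x * ψ x =
      (∫ x, (bond η W₀ x * bond η V x) * (bond η ψ x - η * ψ x)) +
      η * (∫ x, ((bond η W₀ x - η * w x) * bond η V x) * ψ x) +
      η ^ 2 * ((∫ x, (w x * ψ x) * bond η V x) - η * ∫ x, (w x * ψ x) * V x) := by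
    have i1 : Integrable fun x => (bond η W₀ x * bond η V x) * bond η ψ x :=
      (hDV.mul hDa (by positivity) (Eventually.of_forall hD0)).integrable_mul hDψ
    have i2 : Integrable fun x => (bond η W₀ x * bond η V x) * ψ x :=
      (hDV.mul hDa (by positivity) (Eventually.of_forall hD0)).integrable_mul hψb
    have i3 : Integrable fun x => (w x * ψ x) * bond η V x := hm.integrable_mul hDV
    have e1 : ∫ x, (bond η W₀ x * bond η V x) * (bond η ψ x - η * ψ x) =
        (∫ x, bond η W₀ x * bond η V x * bond η ψ x) -
          η * ∫ x, (bond η W₀ x * bond η V x) * ψ x := by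
      rw [← integral_const_mul, ← integral_sub i1 (i2.const_mul _)]
      congr 1; ext1 x; ring
    have e2 : ∫ x, ((bond η W₀ x - η * w x) * bond η V x) * ψ x =
        (∫ x, (bond η W₀ x * bond η V x) * ψ x) - η * ∫ x, (w x * ψ x) * bond η V x := by
      rw [← integral_const_mul, ← integral_sub i2 (i3.const_mul _)]
      congr 1; ext1 x; ring
    have e3 : ∫ x, w x * V x * ψ x = ∫ x, (w x * ψ x) * V x := by
      congr 1; ext1 x; ring
    rw [e1, e2, e3]; ring
  rw [e]
  refine (abs_add_three _ _ _).trans ?_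
  rw [abs_mul, abs_mul, abs_of_nonneg hη, abs_of_nonneg (by positivity : 0 ≤ η ^ 2)]
  have s2 := mul_le_mul_of_nonneg_left t2 hη
  have s3 := mul_le_mul_of_nonneg_left t3 (by positivity : 0 ≤ η ^ 2)
  refine (add_le_add (add_le_add t1 s2) s3).trans (le_of_eq ?_)
  ring

/-- Compare with the midpoint value `T = W₀(· + η/2)`: the difference of squares factors, and one
factor is of order `η³` by the midpoint rule. The remaining product `T²` is the shifted `w²`, and
the centred average of the test function again loses only `η³`. The relative error is thus of second
order in `η`. -/
theorem abs_integral_bond_sq_sub_le {W₀ w₂ : L2R} {w : ℝ → ℝ} {b₀ M M₂ : ℝ}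
    (hw : W₀ =ᵐ[volume] w) (hw2 : w₂ =ᵐ[volume] fun x => w x ^ 2) (hb0 : 0 ≤ b₀)
    (hb : ∀ x, |w x| ≤ b₀) (hM : 0 ≤ M) (hM2 : 0 ≤ M₂)
    (hs : ∀ t, 0 ≤ t → ‖symTr t W₀ - W₀‖ ≤ M * t ^ 2)
    (hs2 : ∀ t, 0 ≤ t → ‖symTr t w₂ - w₂‖ ≤ M₂ * t ^ 2) {η : ℝ} (hη : 0 ≤ η) (φ : L2R) :
    |(∫ x, bond η W₀ x * bond η W₀ x * bond η φ x) - η ^ 3 * inner ℝ w₂ φ| ≤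
      (2 * b₀ * M + M₂) * η ^ 5 * ‖φ‖ := by
  set T := tr (η / 2) W₀ with hT
  have hT' : (T : ℝ → ℝ) =ᵐ[volume] fun x => w (x + η / 2) := by
    filter_upwards [tr_coe (η / 2) W₀, ae_comp_add (η / 2) hw] with x h1 h2
    rw [hT, h1, h2]
  have hD0 : ∀ x, |bond η W₀ x| ≤ η * b₀ :=
    abs_bond_le_of_ae_le hη (hw.mono fun x hx => by rw [hx]; exact hb x)
  have hDφ := L2Bound.bond hη φ
  have hTb := L2Bound.coe T
  have hDa : AEStronglyMeasurable (bond η W₀) volume := (continuous_bond η W₀).aestronglyMeasurable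
  have hDW := L2Bound.bond hη W₀
  have hd : L2Bound (fun x => bond η W₀ x - η * T x) (M * η ^ 3) := by
    refine (L2Bound.coe_of_le (norm_bondOp_sub_midpoint_le hη hM W₀ hs)).congr ?_
    filter_upwards [bondOp_coe hη W₀, Lp.coeFn_sub (bondOp η W₀) (η • T), Lp.coeFn_smul η T]
      with x h1 h2 h3
    rw [h2, Pi.sub_apply, h1, h3, Pi.smul_apply, smul_eq_mul]
  have hTle : ∀ᵐ x, |T x| ≤ b₀ := hT'.mono fun x hx => by rw [hx]; exact hb _
  have hsum : ∀ᵐ x, |bond η W₀ x + η * T x| ≤ 2 * η * b₀ := by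
    filter_upwards [hTle] with x hx
    refine (abs_add_le _ _).trans ?_
    rw [abs_mul, abs_of_nonneg hη]
    have := hD0 x
    nlinarith
  have hprod := hd.mul (f := fun x => bond η W₀ x + η * T x) (hDa.add (hTb.1.const_mul _))
    (by positivity) hsum
  have t1 := hprod.abs_integral_mul_le hDφ (by positivity) (by positivity)
  have t2 := abs_inner_midpoint_bondOp_sub_le hη hM2 w₂ φ hs2
  have hw2T : (tr (η / 2) w₂ : ℝ → ℝ) =ᵐ[volume] fun x => T x * T x := by
    filter_upwards [tr_coe (η / 2) w₂, ae_comp_add (η / 2) hw2, hT'] with x h1 h2 h3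
    rw [h1, h2, h3]; ring
  rw [inner_bondOp_eq_integral hη, integral_congr_ae (hw2T.mono fun x hx => by beta_reduce; rw [hx] :
    (fun x => tr (η / 2) w₂ x * bond η φ x) =ᵐ[volume]
      fun x => T x * T x * bond η φ x)] at t2
  have e : (∫ x, bond η W₀ x * bond η W₀ x * bond η φ x) - η ^ 3 * inner ℝ w₂ φ =
      (∫ x, (bond η W₀ x + η * T x) * (bond η W₀ x - η * T x) * bond η φ x) +
        η ^ 2 * ((∫ x, T x * T x * bond η φ x) - η * inner ℝ w₂ φ) := by
    have i1 : Integrable fun x => bond η W₀ x * bond η W₀ x * bond η φ x :=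
      (hDW.mul hDa (by positivity) (Eventually.of_forall hD0)).integrable_mul hDφ
    have i2 : Integrable fun x => T x * T x * bond η φ x :=
      (hTb.mul hTb.1 hb0 hTle).integrable_mul hDφ
    have e1 : ∫ x, (bond η W₀ x + η * T x) * (bond η W₀ x - η * T x) * bond η φ x =
        (∫ x, bond η W₀ x * bond η W₀ x * bond η φ x) -
          η ^ 2 * ∫ x, T x * T x * bond η φ x := by
      rw [← integral_const_mul, ← integral_sub i1 (i2.const_mul _)]
      congr 1; ext1 x; ring
    rw [e1]; ring
  rw [e]
  refine (abs_add_le _ _).trans ?_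
  rw [abs_mul (η ^ 2), abs_of_nonneg (by positivity : 0 ≤ η ^ 2)]
  have s2 := mul_le_mul_of_nonneg_left t2 (by positivity : 0 ≤ η ^ 2)
  refine (add_le_add t1 s2).trans (le_of_eq ?_)
  ring

end Quadratic

section Law

variable {P : ℝ → ℝ → ℝ} {γ : ℝ → ℝ}

theorem lawStress_aestronglyMeasurable (hr : ∀ ξ, 0 < ξ → Continuous fun r => P r ξ)
    (hξ : ∀ r, ContinuousOn (fun ξ => P r ξ) (Ioi 0)) (ε : ℝ) (W : L2R) :
    AEStronglyMeasurable (Function.uncurry (lawStress P ε W))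
      ((volume.restrict (Ioi 0)).prod volume) := by
  classical
  -- Extension by zero to `ξ ≤ 0` gives a function continuous in `r` and measurable in `ξ` on the
  -- whole line, hence jointly measurable.
  let u : ℝ → ℝ → ℝ := fun r => (Ioi (0 : ℝ)).piecewise (fun ξ => P r ξ) 0
  have hu : Measurable (Function.uncurry u) := by
    refine measurable_uncurry_of_continuous_of_measurable (fun ξ => ?_) (fun r => ?_)
    · by_cases h : 0 < ξ
      · simpa [u, piecewise, h] using hr ξ h
      · simpa [u, piecewise, h] using continuous_const
    · exact (hξ r).measurable_piecewise continuousOn_const measurableSet_Ioi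
  have hc : Measurable fun q : ℝ × ℝ => (ε * bond (ε * q.1) W q.2, q.1) := by
    have : Continuous fun q : ℝ × ℝ => bond (ε * q.1) W q.2 :=
      (continuous_bond_uncurry W).comp (by fun_prop : Continuous fun q : ℝ × ℝ => (ε * q.1, q.2))
    exact (by fun_prop : Continuous fun q : ℝ × ℝ => (ε * bond (ε * q.1) W q.2, q.1)).measurable
  refine (hu.comp hc).aestronglyMeasurable.congr ?_
  have : ∀ᵐ q : ℝ × ℝ ∂(volume.restrict (Ioi 0)).prod volume, q.1 ∈ Ioi (0 : ℝ) :=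
    Measure.quasiMeasurePreserving_fst.ae (ae_restrict_mem measurableSet_Ioi)
  filter_upwards [this] with q hq
  simp only [Function.comp_apply, Function.uncurry, u, lawStress]
  rw [piecewise_eq_of_mem _ _ _ hq]

theorem lawStress_bound (hr : ∀ ξ, 0 < ξ → Continuous fun r => P r ξ) {ε ξ : ℝ} (hε : 0 < ε)
    (hξ : 0 < ξ) {W : L2R} (hγ : 0 ≤ γ ξ)
    (hb : ∀ x, |lawStress P ε W ξ x| ≤ γ ξ * |ε * bond (ε * ξ) W x| ^ 3) :
    L2Bound (lawStress P ε W ξ) (γ ξ * (ε ^ 5 * ξ ^ 2 * ‖W‖ ^ 3)) := by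
  have h0 : 0 ≤ ε * ξ := by positivity
  have hm : AEStronglyMeasurable (lawStress P ε W ξ) volume := by
    refine Continuous.aestronglyMeasurable ?_
    exact (hr ξ hξ).comp ((continuous_bond (ε * ξ) W).const_mul ε)
  refine ((L2Bound.bond h0 W).of_le (b := γ ξ * ε ^ 3 * (ε * ξ * ‖W‖ ^ 2)) hm (by positivity)
    (Eventually.of_forall fun x => (hb x).trans ?_)).mono (le_of_eq (by ring))
  have h1 : |bond (ε * ξ) W x| ^ 2 ≤ ε * ξ * ‖W‖ ^ 2 := by
    have := pow_le_pow_left₀ (abs_nonneg _) (abs_bond_le h0 W x) 2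
    rwa [mul_pow, Real.sq_sqrt h0] at this
  rw [abs_mul, abs_of_pos hε, mul_pow, pow_succ |bond (ε * ξ) W x|]
  calc γ ξ * (ε ^ 3 * (|bond (ε * ξ) W x| ^ 2 * |bond (ε * ξ) W x|))
      ≤ γ ξ * (ε ^ 3 * ((ε * ξ * ‖W‖ ^ 2) * |bond (ε * ξ) W x|)) := by gcongr
    _ = _ := by ring

theorem lawStress_admissible (hr : ∀ ξ, 0 < ξ → Continuous fun r => P r ξ)
    (hξ : ∀ r, ContinuousOn (fun ξ => P r ξ) (Ioi 0)) (hγ : ∀ ξ, 0 < ξ → 0 ≤ γ ξ)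
    (h3 : IntegrableOn (fun ξ => γ ξ * ξ ^ 3) (Ioi 0)) {ε : ℝ} (hε : 0 < ε) {W : L2R}
    (hb : ∀ ξ x, 0 < ξ → |lawStress P ε W ξ x| ≤ γ ξ * |ε * bond (ε * ξ) W x| ^ 3) :
    BondAdmissible (lawStress P ε W) := by
  refine ⟨lawStress_aestronglyMeasurable hr hξ ε W,
    fun ξ => γ ξ * (ε ^ 5 * ξ ^ 2 * ‖W‖ ^ 3), ?_, fun ξ hξ0 => ⟨?_, ?_⟩⟩
  · refine (h3.const_mul (ε ^ 5 * ‖W‖ ^ 3)).congr (Eventually.of_forall fun ξ => ?_)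
    ring
  · have := hγ ξ hξ0
    positivity
  · exact lawStress_bound hr hε hξ0 (hγ ξ hξ0) fun x => hb ξ x hξ0

/-- The bound `ρ` controls both strains in each bond. -/
theorem abs_integral_lawStress_sub_le (hr : ∀ ξ, 0 < ξ → Continuous fun r => P r ξ)
    (hγ : ∀ ξ, 0 < ξ → 0 ≤ γ ξ)
    (hlip : ∀ ξ ρ r s, 0 < ξ → |r| ≤ ρ → |s| ≤ ρ → |P r ξ - P s ξ| ≤ γ ξ * ρ ^ 2 * |r - s|)
    {ε ξ ρ : ℝ} (hε : 0 < ε) (hξ : 0 < ξ) {X Y : L2R}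
    (hX : ∀ x, |ε * bond (ε * ξ) X x| ≤ ρ) (hY : ∀ x, |ε * bond (ε * ξ) Y x| ≤ ρ) (φ : L2R) :
    |∫ x, (lawStress P ε X ξ x - lawStress P ε Y ξ x) * bond (ε * ξ) φ x| ≤
      γ ξ * ρ ^ 2 * ε * (ε * ξ) ^ 2 * ‖X - Y‖ * ‖φ‖ := by
  have h0 : 0 ≤ ε * ξ := by positivity
  have hγξ := hγ ξ hξ
  have hc : ∀ V : L2R, Continuous (lawStress P ε V ξ) := fun V =>
    (hr ξ hξ).comp ((continuous_bond (ε * ξ) V).const_mul ε)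
  have h1 : L2Bound (fun x => lawStress P ε X ξ x - lawStress P ε Y ξ x)
      (γ ξ * ρ ^ 2 * ε * (ε * ξ * ‖X - Y‖)) := by
    refine (L2Bound.bond h0 (X - Y)).of_le ((hc X).sub (hc Y)).aestronglyMeasurable
      (by positivity) (Eventually.of_forall fun x => ?_)
    refine (hlip ξ ρ _ _ hξ (hX x) (hY x)).trans (le_of_eq ?_)
    rw [← mul_sub, abs_mul, abs_of_pos hε, bond_sub]; ring
  refine (h1.abs_integral_mul_le (L2Bound.bond h0 φ) (by positivity) (by positivity)).trans
    (le_of_eq (by ring))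

/-- The force law, frozen outside `[-1, 1]`. -/
def clampLaw (p : ℝ → ℝ → ℝ) (r ξ : ℝ) : ℝ := p (max (-1) (min 1 r)) ξ

theorem clampLaw_eq (p : ℝ → ℝ → ℝ) {r : ℝ} (hr : |r| ≤ 1) (ξ : ℝ) : clampLaw p r ξ = p r ξ := by
  rw [clampLaw, min_eq_right (abs_le.1 hr).2, max_eq_right (abs_le.1 hr).1]

theorem abs_clamp_sub_le (r s : ℝ) :
    |max (-1) (min 1 r) - max (-1) (min 1 s)| ≤ |r - s| := by
  rw [max_comm, max_comm (-1)]
  refine (abs_max_sub_max_le_abs (min 1 r) (min 1 s) (-1)).trans ?_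
  refine (abs_min_sub_min_le_max _ _ _ _).trans ?_
  simp

theorem abs_clamp_le (r : ℝ) : |max (-1) (min 1 r)| ≤ min 1 |r| := by
  refine le_min (abs_le.2 ⟨le_max_left _ _, max_le (by norm_num) (min_le_left _ _)⟩) ?_
  simpa using abs_clamp_sub_le r 0

theorem abs_sub_le_of_deriv_bound {f : ℝ → ℝ} {c ρ : ℝ} (hf : Differentiable ℝ f) (hc : 0 ≤ c)
    (hb : ∀ r, |r| ≤ ρ → |deriv f r| ≤ c * r ^ 2) {r s : ℝ} (hr : |r| ≤ ρ) (hs : |s| ≤ ρ) :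
    |f r - f s| ≤ c * ρ ^ 2 * |r - s| := by
  refine (convex_Icc (-ρ) ρ).norm_image_sub_le_of_norm_deriv_le (𝕜 := ℝ) (f := f)
    (fun x _ => hf x) (fun x hx => ?_) (abs_le.1 hs) (abs_le.1 hr)
  have hx' : |x| ≤ ρ := abs_le.2 hx
  refine (hb x hx').trans ?_
  rw [← sq_abs x]
  gcongr

/-- The clamp is a contraction fixing zero, so it increases neither the size nor the distance of the
arguments, and it brings them into the range where the derivative bound is assumed. -/
theorem clampLaw_lipschitz {p : ℝ → ℝ → ℝ} (hd : ∀ ξ, 0 < ξ → ContDiff ℝ 1 fun r => p r ξ)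
    (hb : ∀ r ξ : ℝ, 0 < ξ → |r| ≤ 1 → |deriv (fun s => p s ξ) r| ≤ γ ξ * r ^ 2)
    (hγ : ∀ ξ, 0 < ξ → 0 ≤ γ ξ) (ξ ρ r s : ℝ) (hξ : 0 < ξ) (hr : |r| ≤ ρ) (hs : |s| ≤ ρ) :
    |clampLaw p r ξ - clampLaw p s ξ| ≤ γ ξ * ρ ^ 2 * |r - s| := by
  have hγξ := hγ ξ hξ
  have h1 : ∀ t, |t| ≤ ρ → |max (-1) (min 1 t)| ≤ min 1 ρ := fun t ht =>
    (abs_clamp_le t).trans (min_le_min le_rfl ht)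
  have hρ : 0 ≤ ρ := (abs_nonneg r).trans hr
  refine (abs_sub_le_of_deriv_bound (ρ := min 1 ρ) ((hd ξ hξ).differentiable (by norm_num)) hγξ
    (fun t ht => hb t ξ hξ (ht.trans (min_le_left _ _))) (h1 r hr) (h1 s hs)).trans ?_
  refine mul_le_mul ?_ (abs_clamp_sub_le r s) (abs_nonneg _) (by positivity)
  have : min 1 ρ ≤ ρ := min_le_right _ _
  have : 0 ≤ min 1 ρ := le_min zero_le_one hρ
  gcongr

theorem clampLaw_continuous {p : ℝ → ℝ → ℝ} (hd : ∀ ξ, 0 < ξ → ContDiff ℝ 1 fun r => p r ξ)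
    (ξ : ℝ) (hξ : 0 < ξ) : Continuous fun r => clampLaw p r ξ :=
  (hd ξ hξ).continuous.comp (by fun_prop : Continuous fun r : ℝ => max (-1) (min 1 r))

end Law

end Peridynamics

/-! ### Compactness of the resolvent composed with a decaying potential -/

namespace Peridynamics

/-- Multiplication by a bounded measurable function on `L²(ℝ)`. -/
noncomputable def mulOp {w : ℝ → ℝ} {b : ℝ} (hw : AEStronglyMeasurable w volume) (hb0 : 0 ≤ b)
    (hb : ∀ x, |w x| ≤ b) : L2R →L[ℝ] L2R :=
  have h : ∀ V : L2R, L2Bound (fun x => w x * V x) (b * ‖V‖) := fun V =>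
    (L2Bound.coe V).mul hw hb0 (Eventually.of_forall hb)
  LinearMap.mkContinuous
    { toFun := fun V => (h V).memLp.toLp _
      map_add' := fun V V' => by
        apply Lp.ext
        filter_upwards [(h (V + V')).memLp.coeFn_toLp, (h V).memLp.coeFn_toLp,
          (h V').memLp.coeFn_toLp, Lp.coeFn_add V V',
          Lp.coeFn_add ((h V).memLp.toLp _) ((h V').memLp.toLp _)] with x h1 h2 h3 h4 h5
        rw [h1, h5, Pi.add_apply, h2, h3, h4, Pi.add_apply, mul_add]
      map_smul' := fun c V => by
        apply Lp.ext
        filter_upwards [(h (c • V)).memLp.coeFn_toLp, (h V).memLp.coeFn_toLp, Lp.coeFn_smul c V,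
          Lp.coeFn_smul c ((h V).memLp.toLp _)] with x h1 h2 h3 h4
        rw [h1, RingHom.id_apply, h4, Pi.smul_apply, h2, h3, Pi.smul_apply, smul_eq_mul,
          smul_eq_mul]
        ring } b fun V =>
        (h V).norm_toLp_le (mul_nonneg hb0 (norm_nonneg V))

theorem mulOp_coe {w : ℝ → ℝ} {b : ℝ} (hw : AEStronglyMeasurable w volume) (hb0 : 0 ≤ b)
    (hb : ∀ x, |w x| ≤ b) (V : L2R) :
    (mulOp hw hb0 hb V : ℝ → ℝ) =ᵐ[volume] fun x => w x * V x :=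
  (((L2Bound.coe V).mul hw hb0 (Eventually.of_forall hb)).memLp).coeFn_toLp

theorem inner_mulOp {w : ℝ → ℝ} {b : ℝ} (hw : AEStronglyMeasurable w volume) (hb0 : 0 ≤ b)
    (hb : ∀ x, |w x| ≤ b) (V φ : L2R) :
    inner ℝ (mulOp hw hb0 hb V) φ = ∫ x, w x * V x * φ x := by
  rw [inner_eq_integral]
  apply integral_congr_ae
  filter_upwards [mulOp_coe hw hb0 hb V] with x hx
  rw [hx]

theorem inner_mulOp_comm {w : ℝ → ℝ} {b : ℝ} (hw : AEStronglyMeasurable w volume) (hb0 : 0 ≤ b)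
    (hb : ∀ x, |w x| ≤ b) (V φ : L2R) :
    inner ℝ (mulOp hw hb0 hb V) φ = inner ℝ V (mulOp hw hb0 hb φ) := by
  rw [inner_mulOp, real_inner_comm, inner_mulOp]
  congr 1; ext1 x; ring

/-! ### Factorization of the resolvent through half-line averages -/

/-- The one-sided exponential `e^{κ x}` on `x < 0`. -/
noncomputable def halfExp (κ x : ℝ) : ℝ := (Iio (0 : ℝ)).indicator (fun x => Real.exp (κ * x)) x

theorem integrable_halfExp {κ : ℝ} (hκ : 0 < κ) : Integrable (halfExp κ) := by
  unfold halfExp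
  rw [integrable_indicator_iff measurableSet_Iio]
  exact (integrableOn_exp_mul_Iic hκ 0).mono_set Iio_subset_Iic_self

theorem halfExp_nonneg (κ x : ℝ) : 0 ≤ halfExp κ x :=
  indicator_nonneg (fun _ _ => (Real.exp_pos _).le) x

theorem memLp_halfExp {κ : ℝ} (hκ : 0 < κ) : MemLp (halfExp κ) 2 := by
  rw [memLp_two_iff_integrable_sq (integrable_halfExp hκ).aestronglyMeasurable]
  refine (integrable_halfExp (by positivity : 0 < 2 * κ)).congr (Eventually.of_forall fun x => ?_)
  by_cases h : x ∈ Iio (0 : ℝ)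
  · simp only [halfExp, indicator_of_mem h, ← Real.exp_nat_mul]
    push_cast
    ring_nf
  · simp [halfExp, indicator_of_notMem h]

theorem trAvg_halfExp {κ : ℝ} (hκ : 0 < κ) (V : L2R) :
    trAvg (halfExp κ) V = expAvg κ (fun s => tr (-s) V) 0 := by
  rw [trAvg_apply (integrable_halfExp hκ), expAvg]
  have : (fun t => halfExp κ t • tr t V) =
      (Iio (0 : ℝ)).indicator fun t => Real.exp (κ * t) • tr t V := by
    ext1 t
    by_cases h : t ∈ Iio (0 : ℝ)
    · simp only [halfExp, indicator_of_mem h]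
    · simp only [halfExp, indicator_of_notMem h, zero_smul]
  rw [this, integral_indicator measurableSet_Iio, ← integral_Iic_eq_integral_Iio,
    ← neg_zero, ← integral_comp_neg_Ioi, neg_zero]
  congr 1; ext1 s
  rw [zero_add]; congr 2; ring

theorem tr_trAvg_halfExp {κ : ℝ} (hκ : 0 < κ) (V : L2R) (t : ℝ) :
    tr t (trAvg (halfExp κ) V) = expAvg κ (fun s => tr (-s) V) (-t) := by
  rw [tr_trAvg (integrable_halfExp hκ), trAvg_halfExp hκ, expAvg, expAvg]
  congr 1; ext1 s
  rw [tr_tr]; congr 3; ring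

theorem hasDerivAt_tr_trAvg_halfExp {κ : ℝ} (hκ : 0 < κ) (V : L2R) :
    HasDerivAt (fun t => tr t (trAvg (halfExp κ) V)) (V - κ • trAvg (halfExp κ) V) 0 := by
  simp_rw [tr_trAvg_halfExp hκ]
  have := hasDerivAt_expAvg_neg hκ (continuous_tr V) (fun s => (norm_tr s V).le) 0
  refine this.congr_deriv ?_
  rw [tr_zero, neg_zero, trAvg_halfExp hκ]

/-- With `A = trAvg (halfExp κ)`, the orbit of `A V` has derivative `V - κ A V` at zero.
Translations preserve inner products, so differentiating `⟨tr t (A V), tr t (A φ)⟩` gives zero; in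
operator form, `2κ A*A = A + A*`. -/
theorem inner_trAvg_halfExp {κ : ℝ} (hκ : 0 < κ) (V φ : L2R) :
    2 * κ * inner ℝ (trAvg (halfExp κ) V) (trAvg (halfExp κ) φ) =
      inner ℝ V (trAvg (halfExp κ) φ) + inner ℝ (trAvg (halfExp κ) V) φ := by
  have h := (hasDerivAt_tr_trAvg_halfExp hκ V).inner ℝ (hasDerivAt_tr_trAvg_halfExp hκ φ)
  have h2 : (fun t => inner ℝ (tr t (trAvg (halfExp κ) V)) (tr t (trAvg (halfExp κ) φ))) =
      fun _ => inner ℝ (trAvg (halfExp κ) V) (trAvg (halfExp κ) φ) := by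
    ext1 t; exact (tr t).inner_map_map _ _
  rw [h2] at h
  have h3 := h.unique (hasDerivAt_const (0 : ℝ) _)
  rw [tr_zero, tr_zero, inner_sub_left, inner_sub_right, inner_smul_left, inner_smul_right,
    RCLike.conj_to_real] at h3
  linarith

theorem inner_expAvg_tr {κ : ℝ} (hκ : 0 < κ) (V φ : L2R) :
    inner ℝ (expAvg κ (fun s => tr s V) 0) φ = inner ℝ V (trAvg (halfExp κ) φ) := by
  rw [trAvg_halfExp hκ, expAvg, expAvg]
  simp_rw [zero_add]
  rw [real_inner_comm, ← integral_inner
    (integrableOn_exp_smul hκ (continuous_tr V) (fun s => (norm_tr s V).le) 0), ← integral_inner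
    (integrableOn_exp_smul hκ (f := fun s => tr (-s) φ) ((continuous_tr φ).comp continuous_neg)
      (fun s => (norm_tr (-s) φ).le) 0)]
  congr 1; ext1 s
  rw [inner_smul_right, inner_smul_right, real_inner_comm, inner_tr_left]

/-- Splitting the Green's kernel into its two halves gives `green κ = (κ/2)(A + A*)`, which the
identity above turns into `κ² A*A`. This resolves `green κ` into rank-one operators built from
translated half exponentials. -/
theorem inner_green_eq {κ : ℝ} (hκ : 0 < κ) (V φ : L2R) :
    inner ℝ (green κ V) φ =
      κ ^ 2 * inner ℝ (trAvg (halfExp κ) V) (trAvg (halfExp κ) φ) := by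
  have h1 := inner_trAvg_halfExp hκ V φ
  rw [← tr_zero (green κ V), tr_green_eq hκ, greenAvg, inner_smul_left, inner_add_left,
    inner_expAvg_tr hκ, neg_zero, ← trAvg_halfExp hκ, RCLike.conj_to_real, ← h1]
  ring

/-- The translated one-sided exponential in `L²(ℝ)`. -/
noncomputable def halfExpLp {κ : ℝ} (hκ : 0 < κ) (s : ℝ) : L2R :=
  tr (-s) ((memLp_halfExp hκ).toLp _)

theorem halfExpLp_coe {κ : ℝ} (hκ : 0 < κ) (s : ℝ) :
    (halfExpLp hκ s : ℝ → ℝ) =ᵐ[volume] fun x => halfExp κ (x - s) := by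
  filter_upwards [tr_coe (-s) ((memLp_halfExp hκ).toLp _),
    ae_comp_add (-s) (memLp_halfExp hκ).coeFn_toLp] with x h1 h2
  rw [halfExpLp, h1, h2, sub_eq_add_neg]

theorem continuous_halfExpLp {κ : ℝ} (hκ : 0 < κ) : Continuous (halfExpLp hκ) :=
  (continuous_tr _).comp continuous_neg

theorem trAvg_halfExp_coe {κ : ℝ} (hκ : 0 < κ) (V : L2R) :
    (trAvg (halfExp κ) V : ℝ → ℝ) =ᵐ[volume] fun s => inner ℝ (halfExpLp hκ s) V := by
  filter_upwards [trAvg_coe (integrable_halfExp hκ) V] with s hs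
  rw [hs, halfExpLp, inner_tr_left, neg_neg, inner_eq_integral]
  apply integral_congr_ae
  filter_upwards [(memLp_halfExp hκ).coeFn_toLp, tr_coe s V] with x h1 h2
  rw [h1, h2, add_comm]

theorem inner_green_eq_integral {κ : ℝ} (hκ : 0 < κ) (V φ : L2R) :
    inner ℝ (green κ V) φ =
      κ ^ 2 * ∫ s, inner ℝ (halfExpLp hκ s) V * inner ℝ (halfExpLp hκ s) φ := by
  rw [inner_green_eq hκ, inner_eq_integral]
  congr 1
  apply integral_congr_ae
  filter_upwards [trAvg_halfExp_coe hκ V, trAvg_halfExp_coe hκ φ] with s h1 h2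
  rw [h1, h2]

/-! ### Compactness by integrating rank-one operators -/

theorem isCompactOperator_rankOne (x y : L2R) :
    IsCompactOperator (InnerProductSpace.rankOne ℝ x y : L2R →L[ℝ] L2R) := by
  rw [InnerProductSpace.rankOne_def']
  exact (isCompactOperator_id (E := ℝ)).comp_clm (innerSL ℝ y) |>.clm_comp
    (ContinuousLinearMap.toSpanSingleton ℝ x)

/-- A functional separating the integral from the subspace is bounded above on the subspace, hence
vanishes there, hence vanishes at the integral. -/
theorem integral_mem_of_isClosed_submodule {E : Type*} [NormedAddCommGroup E] [NormedSpace ℝ E]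
    [CompleteSpace E] {K : Submodule ℝ E} (hK : IsClosed (K : Set E)) {f : ℝ → E}
    (hf : Integrable f) (hc : ∀ s, f s ∈ K) : ∫ s, f s ∈ K := by
  by_contra hx
  obtain ⟨l, u, hu, hl⟩ := geometric_hahn_banach_closed_point K.convex hK hx
  have h0 : ∀ a ∈ K, l a = 0 := by
    intro a ha
    by_contra hne
    have := hu ((u / l a) • a) (K.smul_mem _ ha)
    rw [map_smul, smul_eq_mul, div_mul_cancel₀ _ hne] at this
    exact this.false
  have hu0 := hu 0 K.zero_mem
  rw [map_zero] at hu0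
  rw [← l.integral_comp_comm hf] at hl
  simp_rw [h0 _ (hc _), integral_zero] at hl
  linarith

theorem IsCompactOperator.integral {f : ℝ → L2R →L[ℝ] L2R} (hf : Integrable f)
    (hc : ∀ s, IsCompactOperator (f s)) : IsCompactOperator (∫ s, f s : L2R →L[ℝ] L2R) := by
  let K : Submodule ℝ (L2R →L[ℝ] L2R) :=
    { carrier := {A | IsCompactOperator A}
      add_mem' := fun ha hb => ha.add hb
      zero_mem' := isCompactOperator_zero
      smul_mem' := fun c _ ha => ha.smul c }
  exact integral_mem_of_isClosed_submodule (K := K) isClosed_setOfPred_isCompactOperator hf hc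

/-- Where the half exponential lives, `x < s`, the triangle inequality bounds `|s|` by `|x| + (s -
x)`. Spending half of the exponential rate thus converts decay in `x` into decay in the position
`s`. -/
theorem halfExp_mul_le {κ a : ℝ} (hκ : 0 < κ) {w : ℝ → ℝ} (ha : 0 ≤ a)
    (hdecay : ∀ x, |w x| ≤ a * Real.exp (-κ * |x|)) (s x : ℝ) :
    |w x * halfExp κ (x - s)| ≤ a * Real.exp (-(κ / 2) * |s|) * |halfExp (κ / 2) (x - s)| := by
  rw [abs_mul, abs_of_nonneg (halfExp_nonneg _ _), abs_of_nonneg (halfExp_nonneg _ _)]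
  by_cases h : x - s ∈ Iio (0 : ℝ)
  · simp only [halfExp, indicator_of_mem h]
    have h' : x - s < 0 := h
    have h1 : |s| ≤ |x| + (s - x) := by
      have := abs_add_le x (s - x)
      rwa [add_sub_cancel, abs_of_pos (by linarith : 0 < s - x)] at this
    calc |w x| * Real.exp (κ * (x - s))
        ≤ a * Real.exp (-κ * |x|) * Real.exp (κ * (x - s)) := by gcongr; exact hdecay x
      _ = a * Real.exp (-κ * |x| + κ * (x - s)) := by rw [mul_assoc, ← Real.exp_add]
      _ ≤ a * Real.exp (-(κ / 2) * |s| + κ / 2 * (x - s)) := by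
          refine mul_le_mul_of_nonneg_left (Real.exp_le_exp.2 ?_) ha
          have h2 : κ / 2 * |s| ≤ κ / 2 * (2 * |x| + (s - x)) := by
            gcongr
            linarith [abs_nonneg x]
          linarith
      _ = _ := by rw [Real.exp_add]; ring
  · simp [halfExp, indicator_of_notMem h]

theorem norm_mulOp_halfExpLp_le {κ a b : ℝ} (hκ : 0 < κ) {w : ℝ → ℝ}
    (hw : AEStronglyMeasurable w volume) (hb0 : 0 ≤ b) (hb : ∀ x, |w x| ≤ b) (ha : 0 ≤ a)
    (hdecay : ∀ x, |w x| ≤ a * Real.exp (-κ * |x|)) (s : ℝ) :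
    ‖mulOp hw hb0 hb (halfExpLp hκ s)‖ ≤
      a * Real.exp (-(κ / 2) * |s|) * ‖halfExpLp (half_pos hκ) 0‖ := by
  have h1 : L2Bound (fun x => halfExp (κ / 2) (x - s)) ‖halfExpLp (half_pos hκ) 0‖ := by
    have := (L2Bound.coe (halfExpLp (half_pos hκ) s)).congr (halfExpLp_coe (half_pos hκ) s)
    rwa [halfExpLp, norm_tr, ← norm_tr (-0)] at this
  have h2 : L2Bound (mulOp hw hb0 hb (halfExpLp hκ s))
      (a * Real.exp (-(κ / 2) * |s|) * ‖halfExpLp (half_pos hκ) 0‖) := by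
    refine h1.of_le (Lp.aestronglyMeasurable _) (by positivity) ?_
    filter_upwards [mulOp_coe hw hb0 hb (halfExpLp hκ s), halfExpLp_coe hκ s] with x h3 h4
    rw [h3, h4]
    exact halfExp_mul_le hκ ha hdecay s x
  have := h2.norm_toLp_le (by positivity)
  rwa [Lp.toLp_coeFn] at this

/-- The vectors `halfExpLp hκ s` all have the same norm, so the rank-one integral for `green κ`
alone does not converge absolutely. Multiplication by a decaying `w` makes it do so in operator
norm, and compact operators form a closed subspace. -/
theorem isCompactOperator_green_mulOp {κ a b : ℝ} (hκ : 0 < κ) {w : ℝ → ℝ}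
    (hw : AEStronglyMeasurable w volume) (hb0 : 0 ≤ b) (hb : ∀ x, |w x| ≤ b) (ha : 0 ≤ a)
    (hdecay : ∀ x, |w x| ≤ a * Real.exp (-κ * |x|)) :
    IsCompactOperator ((green κ).comp (mulOp hw hb0 hb)) := by
  set f : ℝ → L2R →L[ℝ] L2R := fun s =>
    InnerProductSpace.rankOne ℝ (halfExpLp hκ s) (mulOp hw hb0 hb (halfExpLp hκ s)) with hf
  have hcont : Continuous f := by
    have h1 : Continuous fun s => innerSL ℝ (mulOp hw hb0 hb (halfExpLp hκ s)) :=
      (innerSL ℝ).continuous.comp ((mulOp hw hb0 hb).continuous.comp (continuous_halfExpLp hκ))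
    have h2 : Continuous fun s => ContinuousLinearMap.toSpanSingleton ℝ (halfExpLp hκ s) :=
      (ContinuousLinearMap.toSpanSingletonLIE ℝ L2R).continuous.comp (continuous_halfExpLp hκ)
    simp_rw [hf, InnerProductSpace.rankOne_def']
    exact h2.clm_comp h1
  have hint : Integrable f := by
    refine Integrable.mono' (((integrable_exp_neg_abs (half_pos hκ)).const_mul
      (‖halfExpLp hκ 0‖ * a * ‖halfExpLp (half_pos hκ) 0‖)))
      hcont.aestronglyMeasurable (Eventually.of_forall fun s => ?_)
    rw [hf, InnerProductSpace.norm_rankOne]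
    have h1 : ‖halfExpLp hκ s‖ = ‖halfExpLp hκ 0‖ := by
      rw [halfExpLp, halfExpLp, norm_tr, norm_tr]
    rw [h1]
    refine (mul_le_mul_of_nonneg_left
      (norm_mulOp_halfExpLp_le hκ hw hb0 hb ha hdecay s) (norm_nonneg _)).trans (le_of_eq ?_)
    ring
  have e : (green κ).comp (mulOp hw hb0 hb) = κ ^ 2 • ∫ s, f s := by
    refine ContinuousLinearMap.ext fun V => ext_inner_right ℝ fun φ => ?_
    rw [ContinuousLinearMap.comp_apply, inner_green_eq_integral hκ, smul_apply, inner_smul_left,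
      RCLike.conj_to_real, ContinuousLinearMap.integral_apply hint, real_inner_comm,
      ← integral_inner (hint.apply_continuousLinearMap V)]
    congr 2; ext1 s
    rw [hf, InnerProductSpace.rankOne_apply, inner_smul_right, real_inner_comm φ,
      ← inner_mulOp_comm]
  rw [e]
  exact (IsCompactOperator.integral hint fun s => isCompactOperator_rankOne _ _).smul (κ ^ 2)

end Peridynamics

/-! ### The soliton -/

namespace Peridynamics

/-- The squared hyperbolic secant `sech²(κ x / 2)`. -/
noncomputable def sechSq (κ x : ℝ) : ℝ := (1 / Real.cosh (1 / 2 * κ * x)) ^ 2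

/-- The hyperbolic tangent `tanh(κ x / 2)`. -/
noncomputable def halfTanh (κ x : ℝ) : ℝ :=
  Real.sinh (1 / 2 * κ * x) / Real.cosh (1 / 2 * κ * x)

theorem sechSq_pos (κ x : ℝ) : 0 < sechSq κ x := by
  have := Real.cosh_pos (1 / 2 * κ * x)
  unfold sechSq; positivity

theorem sechSq_le_one (κ x : ℝ) : sechSq κ x ≤ 1 := by
  have := Real.one_le_cosh (1 / 2 * κ * x)
  unfold sechSq
  rw [div_pow, one_pow, div_le_one (by positivity)]
  exact one_le_pow₀ this

theorem sechSq_neg (κ x : ℝ) : sechSq κ (-x) = sechSq κ x := by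
  unfold sechSq; rw [mul_neg, Real.cosh_neg]

theorem sechSq_le_exp {κ : ℝ} (hκ : 0 < κ) (x : ℝ) : sechSq κ x ≤ 4 * Real.exp (-κ * |x|) := by
  have h1 : Real.exp (κ * |x| / 2) / 2 ≤ Real.cosh (1 / 2 * κ * x) := by
    rw [← Real.cosh_abs, abs_mul, abs_of_pos (by positivity : 0 < 1 / 2 * κ), Real.cosh_eq,
      show 1 / 2 * κ * |x| = κ * |x| / 2 by ring]
    have := Real.exp_pos (-(κ * |x| / 2))
    linarith
  calc sechSq κ x = 1 / Real.cosh (1 / 2 * κ * x) ^ 2 := by rw [sechSq, div_pow, one_pow]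
    _ ≤ 1 / (Real.exp (κ * |x| / 2) / 2) ^ 2 := by gcongr
    _ = 4 * Real.exp (-κ * |x|) := by
        rw [div_pow, ← Real.exp_nat_mul, neg_mul, Real.exp_neg]
        push_cast
        rw [show 2 * (κ * |x| / 2) = κ * |x| by ring]
        field_simp
        norm_num

theorem halfTanh_sq (κ x : ℝ) : halfTanh κ x ^ 2 = 1 - sechSq κ x := by
  have := Real.cosh_pos (1 / 2 * κ * x)
  have h2 := Real.cosh_sq_sub_sinh_sq (1 / 2 * κ * x)
  unfold halfTanh sechSq
  generalize 1 / 2 * κ * x = y at *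
  field_simp
  linarith

theorem abs_halfTanh_le (κ x : ℝ) : |halfTanh κ x| ≤ 1 := by
  rw [← sq_le_one_iff_abs_le_one, halfTanh_sq]
  linarith [sechSq_pos κ x]

theorem sechSq_zero (κ : ℝ) : sechSq κ 0 = 1 := by simp [sechSq]

theorem halfTanh_pos {κ x : ℝ} (hκ : 0 < κ) (hx : 0 < x) : 0 < halfTanh κ x := by
  have := Real.cosh_pos (1 / 2 * κ * x)
  have h2 : 0 < Real.sinh (1 / 2 * κ * x) := Real.sinh_pos_iff.2 (by positivity)
  unfold halfTanh; positivity

theorem hasDerivAt_halfTanh (κ x : ℝ) : HasDerivAt (halfTanh κ) (κ / 2 * sechSq κ x) x := by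
  have h0 : HasDerivAt (fun x => 1 / 2 * κ * x) (1 / 2 * κ) x := by
    simpa using (hasDerivAt_id x).const_mul (1 / 2 * κ)
  have hp := Real.cosh_pos (1 / 2 * κ * x)
  refine (h0.sinh.div h0.cosh hp.ne').congr_deriv ?_
  have h2 := Real.cosh_sq_sub_sinh_sq (1 / 2 * κ * x)
  unfold sechSq
  generalize 1 / 2 * κ * x = y at *
  field_simp
  linear_combination κ * h2

theorem hasDerivAt_sechSq (κ x : ℝ) :
    HasDerivAt (sechSq κ) (-κ * (sechSq κ x * halfTanh κ x)) x := by
  have h : sechSq κ = fun x => 1 - halfTanh κ x ^ 2 := by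
    ext1 x; rw [halfTanh_sq]; ring
  have h1 := ((hasDerivAt_halfTanh κ x).pow 2).const_sub 1
  nth_rewrite 1 [h]
  refine h1.congr_deriv ?_
  push_cast
  ring

theorem hasDerivAt_sechSq_mul_halfTanh (κ x : ℝ) :
    HasDerivAt (fun x => sechSq κ x * halfTanh κ x)
      (-κ * sechSq κ x + 3 / 2 * κ * sechSq κ x ^ 2) x := by
  refine ((hasDerivAt_sechSq κ x).mul (hasDerivAt_halfTanh κ x)).congr_deriv ?_
  linear_combination (-κ * sechSq κ x) * halfTanh_sq κ x

theorem continuous_sechSq (κ : ℝ) : Continuous (sechSq κ) :=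
  continuous_iff_continuousAt.2 fun x => (hasDerivAt_sechSq κ x).continuousAt

theorem continuous_halfTanh (κ : ℝ) : Continuous (halfTanh κ) :=
  continuous_iff_continuousAt.2 fun x => (hasDerivAt_halfTanh κ x).continuousAt

theorem tendsto_sechSq {κ : ℝ} (hκ : 0 < κ) : Tendsto (sechSq κ) atTop (𝓝 0) := by
  have h1 : Tendsto (fun x : ℝ => 4 * Real.exp (-κ * |x|)) atTop (𝓝 (4 * 0)) := by
    refine (Real.tendsto_exp_atBot.comp ?_).const_mul 4
    exact (tendsto_const_mul_atBot_of_neg (neg_lt_zero.2 hκ)).2 tendsto_abs_atTop_atTop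
  rw [mul_zero] at h1
  exact squeeze_zero (fun x => (sechSq_pos κ x).le) (fun x => sechSq_le_exp hκ x) h1

theorem memLp_of_abs_le_sechSq {κ C : ℝ} (hκ : 0 < κ) {f : ℝ → ℝ} (hf : Continuous f)
    (h : ∀ x, |f x| ≤ C * sechSq κ x) : MemLp f 2 := by
  have hC : 0 ≤ C := by
    have := (abs_nonneg _).trans (h 0)
    rwa [sechSq_zero, mul_one] at this
  rw [memLp_two_iff_integrable_sq hf.aestronglyMeasurable]
  refine Integrable.mono' ((integrable_exp_neg_abs hκ).const_mul (C ^ 2 * 4))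
    (by fun_prop) (Eventually.of_forall fun x => ?_)
  rw [Real.norm_of_nonneg (sq_nonneg _), ← sq_abs]
  calc |f x| ^ 2 ≤ (C * sechSq κ x) ^ 2 := by gcongr; exact h x
    _ = C ^ 2 * (sechSq κ x * sechSq κ x) := by ring
    _ ≤ C ^ 2 * (1 * (4 * Real.exp (-κ * |x|))) := by
        gcongr
        · exact (sechSq_pos κ x).le
        · exact sechSq_le_one κ x
        · exact sechSq_le_exp hκ x
    _ = _ := by ring

/-- The integrand is the exact derivative of `e^{-κs} (-u'/κ² - u/κ)`, which vanishes at infinity.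
Adding the mirrored identity cancels the `u'` terms, so `greenAvg` inverts `1 - κ⁻² ∂²` on bounded
classical solutions. -/
theorem expAvg_eq_of_hasDerivAt {κ M : ℝ} (hκ : 0 < κ) {u u' u'' : ℝ → ℝ}
    (hu : ∀ x, HasDerivAt u (u' x) x) (hu' : ∀ x, HasDerivAt u' (u'' x) x) (hc : Continuous u'')
    (h0 : ∀ x, |u x| ≤ M) (h1 : ∀ x, |u' x| ≤ M) (h2 : ∀ x, |u'' x| ≤ M) (t : ℝ) :
    expAvg κ (fun x => u x - u'' x / κ ^ 2) t = u' t / κ ^ 2 + u t / κ := by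
  have hcu : Continuous u := continuous_iff_continuousAt.2 fun x => (hu x).continuousAt
  have hM : 0 ≤ M := (abs_nonneg _).trans (h0 0)
  set G : ℝ → ℝ := fun s => Real.exp (-κ * s) * (-(u' (t + s) / κ ^ 2) - u (t + s) / κ) with hG
  have hd : ∀ s, HasDerivAt G (Real.exp (-κ * s) * (u (t + s) - u'' (t + s) / κ ^ 2)) s := by
    intro s
    have e1 : HasDerivAt (fun s => Real.exp (-κ * s)) (Real.exp (-κ * s) * (-κ)) s := by
      simpa using ((hasDerivAt_id s).const_mul (-κ)).exp
    have e2 : HasDerivAt (fun s => u (t + s)) (u' (t + s)) s := (hu (t + s)).comp_const_add t s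
    have e3 : HasDerivAt (fun s => u' (t + s)) (u'' (t + s)) s := (hu' (t + s)).comp_const_add t s
    refine (e1.mul (((e3.div_const (κ ^ 2)).neg).sub (e2.div_const κ))).congr_deriv ?_
    simp only [Pi.sub_apply, Pi.neg_apply]
    field_simp
    ring
  have hb : ∀ x, ‖u x - u'' x / κ ^ 2‖ ≤ M + M / κ ^ 2 := by
    intro x
    refine (norm_sub_le _ _).trans ?_
    rw [norm_div, Real.norm_of_nonneg (sq_nonneg κ)]
    gcongr
    exacts [h0 x, h2 x]
  have hlim : Tendsto G atTop (𝓝 0) := by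
    have e : Tendsto (fun s : ℝ => Real.exp (-κ * s) * (M / κ ^ 2 + M / κ)) atTop (𝓝 0) := by
      have := (Real.tendsto_exp_atBot.comp ((tendsto_const_mul_atBot_of_neg
        (neg_lt_zero.2 hκ)).2 tendsto_id)).mul_const (M / κ ^ 2 + M / κ)
      rwa [zero_mul] at this
    refine squeeze_zero_norm (fun s => ?_) e
    rw [hG, norm_mul, Real.norm_of_nonneg (Real.exp_pos _).le]
    gcongr
    refine (norm_sub_le _ _).trans ?_
    rw [norm_neg, norm_div, norm_div, Real.norm_of_nonneg (sq_nonneg κ), Real.norm_of_nonneg hκ.le]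
    gcongr
    exacts [h1 _, h0 _]
  have hi : IntegrableOn (fun s => Real.exp (-κ * s) * (u (t + s) - u'' (t + s) / κ ^ 2))
      (Ioi 0) :=
    integrableOn_exp_smul hκ (f := fun s => u (t + s) - u'' (t + s) / κ ^ 2) (by fun_prop)
      (fun s => hb _) 0
  have := integral_Ioi_of_hasDerivAt_of_tendsto' (fun s _ => hd s) hi hlim
  rw [expAvg]
  simp only [smul_eq_mul]
  rw [this, hG]
  simp
  ring

theorem greenAvg_eq_of_hasDerivAt {κ M : ℝ} (hκ : 0 < κ) {u u' u'' : ℝ → ℝ}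
    (hu : ∀ x, HasDerivAt u (u' x) x) (hu' : ∀ x, HasDerivAt u' (u'' x) x) (hc : Continuous u'')
    (h0 : ∀ x, |u x| ≤ M) (h1 : ∀ x, |u' x| ≤ M) (h2 : ∀ x, |u'' x| ≤ M) (t : ℝ) :
    greenAvg κ (fun x => u x - u'' x / κ ^ 2) t = u t := by
  have e2 := expAvg_eq_of_hasDerivAt hκ (u := fun x => u (-x)) (u' := fun x => -u' (-x))
    (u'' := fun x => u'' (-x)) (M := M)
    (fun x => ((hu (-x)).scomp x (hasDerivAt_neg x)).congr_deriv (by simp))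
    (fun x => ((hu' (-x)).scomp x (hasDerivAt_neg x)).neg.congr_deriv (by simp))
    (by fun_prop) (fun x => h0 _) (fun x => by rw [abs_neg]; exact h1 _) (fun x => h2 _) (-t)
  rw [greenAvg, expAvg_eq_of_hasDerivAt hκ hu hu' hc h0 h1 h2 t, e2, neg_neg, smul_eq_mul]
  field_simp
  ring

theorem inner_greenKernelLp_tr {κ M : ℝ} (hκ : 0 < κ) {V : L2R} {f : ℝ → ℝ} (hf : Continuous f)
    (hM : ∀ x, |f x| ≤ M) (hV : V =ᵐ[volume] f) (x : ℝ) :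
    inner ℝ (greenKernelLp hκ) (tr x V) = greenAvg κ f x := by
  rw [← integral_greenKernel_mul, ← integral_greenKernel_smul hκ hf hM]
  apply integral_congr_ae
  filter_upwards [ae_comp_add x hV] with t ht
  rw [add_comm x t, ht, smul_eq_mul]

theorem green_coe_of_continuous {κ M : ℝ} (hκ : 0 < κ) {V : L2R} {f : ℝ → ℝ} (hf : Continuous f)
    (hM : ∀ x, |f x| ≤ M) (hV : V =ᵐ[volume] f) : green κ V =ᵐ[volume] greenAvg κ f := by
  filter_upwards [green_coe hκ V] with x hx
  rw [hx, inner_greenKernelLp_tr hκ hf hM hV]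

/-- The soliton `3 / (2 q) sech²(κ x / 2)` of `w'' = κ² (w - q w²)`. -/
noncomputable def soliton (κ q x : ℝ) : ℝ := 3 / (2 * q) * sechSq κ x

/-- The derivative of the soliton. -/
noncomputable def solitonDeriv (κ q x : ℝ) : ℝ :=
  -(3 / (2 * q) * κ * (sechSq κ x * halfTanh κ x))

theorem continuous_soliton (κ q : ℝ) : Continuous (soliton κ q) :=
  (continuous_sechSq κ).const_mul _

theorem hasDerivAt_soliton (κ q x : ℝ) :
    HasDerivAt (soliton κ q) (solitonDeriv κ q x) x := by
  refine ((hasDerivAt_sechSq κ x).const_mul (3 / (2 * q))).congr_deriv ?_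
  rw [solitonDeriv]; ring

theorem hasDerivAt_solitonDeriv {κ q : ℝ} (hq : q ≠ 0) (x : ℝ) :
    HasDerivAt (solitonDeriv κ q) (κ ^ 2 * (soliton κ q x - q * soliton κ q x ^ 2)) x := by
  refine ((hasDerivAt_sechSq_mul_halfTanh κ x).const_mul (3 / (2 * q) * κ)).neg.congr_deriv ?_
  unfold soliton
  field_simp
  ring

theorem hasDerivAt_soliton_second {κ q : ℝ} (x : ℝ) :
    HasDerivAt (fun x => κ ^ 2 * (soliton κ q x - q * soliton κ q x ^ 2))
      (κ ^ 2 * (solitonDeriv κ q x - 2 * q * soliton κ q x * solitonDeriv κ q x)) x := by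
  have h := hasDerivAt_soliton κ q x
  refine ((h.sub ((h.pow 2).const_mul q)).const_mul (κ ^ 2)).congr_deriv ?_
  push_cast; ring

theorem soliton_nonneg {q : ℝ} (hq : 0 < q) (κ x : ℝ) : 0 ≤ soliton κ q x := by
  have := sechSq_pos κ x
  unfold soliton; positivity

theorem abs_soliton_le {q : ℝ} (hq : 0 < q) (κ x : ℝ) : |soliton κ q x| ≤ 3 / (2 * q) := by
  rw [abs_of_nonneg (soliton_nonneg hq κ x), soliton]
  exact mul_le_of_le_one_right (by positivity) (sechSq_le_one κ x)

theorem abs_soliton_le_exp {κ q : ℝ} (hκ : 0 < κ) (hq : 0 < q) (x : ℝ) :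
    |soliton κ q x| ≤ 3 / (2 * q) * 4 * Real.exp (-κ * |x|) := by
  rw [abs_of_nonneg (soliton_nonneg hq κ x), soliton, mul_assoc _ (4 : ℝ)]
  gcongr
  exact sechSq_le_exp hκ x

theorem abs_solitonDeriv_le {κ q : ℝ} (hκ : 0 < κ) (hq : 0 < q) (x : ℝ) :
    |solitonDeriv κ q x| ≤ 3 / (2 * q) * κ := by
  rw [solitonDeriv, abs_neg, abs_mul, abs_of_pos (by positivity : 0 < 3 / (2 * q) * κ), abs_mul,
    abs_of_pos (sechSq_pos κ x)]
  exact mul_le_of_le_one_right (by positivity)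
    (mul_le_one₀ (sechSq_le_one κ x) (abs_nonneg _) (abs_halfTanh_le κ x))

theorem abs_soliton_sub_le {κ q : ℝ} (hκ : 0 < κ) (hq : 0 < q) (x y : ℝ) :
    |soliton κ q x - soliton κ q y| ≤ 3 / (2 * q) * κ * |x - y| :=
  convex_univ.norm_image_sub_le_of_norm_hasDerivWithin_le (f := soliton κ q)
    (fun x _ => (hasDerivAt_soliton κ q x).hasDerivWithinAt)
    (fun x _ => abs_solitonDeriv_le hκ hq x) (mem_univ y) (mem_univ x)

theorem memLp_soliton {κ q : ℝ} (hκ : 0 < κ) (hq : 0 < q) : MemLp (soliton κ q) 2 :=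
  memLp_of_abs_le_sechSq hκ (continuous_soliton κ q) fun x => by
    rw [abs_of_nonneg (soliton_nonneg hq κ x), soliton]

theorem memLp_soliton_sq {κ q : ℝ} (hκ : 0 < κ) (hq : 0 < q) :
    MemLp (fun x => soliton κ q x ^ 2) 2 :=
  memLp_of_abs_le_sechSq (C := (3 / (2 * q)) ^ 2) hκ ((continuous_soliton κ q).pow 2) fun x => by
    rw [abs_of_nonneg (sq_nonneg _), soliton, mul_pow, sq (sechSq κ x)]
    gcongr
    exact mul_le_of_le_one_left (sechSq_pos κ x).le (sechSq_le_one κ x)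

/-- The soliton as an element of `L²(ℝ)`. -/
noncomputable def solitonLp {κ q : ℝ} (hκ : 0 < κ) (hq : 0 < q) : L2R := (memLp_soliton hκ hq).toLp _

/-- The square of the soliton as an element of `L²(ℝ)`. -/
noncomputable def solitonSqLp {κ q : ℝ} (hκ : 0 < κ) (hq : 0 < q) : L2R :=
  (memLp_soliton_sq hκ hq).toLp _

theorem abs_second_le {κ q : ℝ} (hq : 0 < q) (x : ℝ) :
    |κ ^ 2 * (soliton κ q x - q * soliton κ q x ^ 2)| ≤
      κ ^ 2 * (3 / (2 * q) + q * (3 / (2 * q)) ^ 2) := by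
  rw [abs_mul, abs_of_nonneg (sq_nonneg κ)]
  gcongr
  refine (abs_sub _ _).trans ?_
  rw [abs_mul, abs_of_pos hq, abs_pow]
  gcongr <;> exact abs_soliton_le hq κ x

/-- The limit equation in fixed point form: the ODE of the soliton says that `w - w''/κ² = q w²`. -/
theorem green_solitonSqLp {κ q : ℝ} (hκ : 0 < κ) (hq : 0 < q) :
    green κ (q • solitonSqLp hκ hq) = solitonLp hκ hq := by
  apply Lp.ext
  have hae : (q • solitonSqLp hκ hq : L2R) =ᵐ[volume] fun x => q * soliton κ q x ^ 2 := by
    filter_upwards [Lp.coeFn_smul q (solitonSqLp hκ hq),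
      (memLp_soliton_sq hκ hq).coeFn_toLp] with x h1 h2
    rw [h1, Pi.smul_apply, solitonSqLp, h2, smul_eq_mul]
  have hb : ∀ x, |q * soliton κ q x ^ 2| ≤ q * (3 / (2 * q)) ^ 2 := fun x => by
    rw [abs_mul, abs_of_pos hq, abs_pow]; gcongr; exact abs_soliton_le hq κ x
  have hcs := continuous_soliton κ q
  filter_upwards [green_coe_of_continuous hκ (by fun_prop) hb hae,
    (memLp_soliton hκ hq).coeFn_toLp] with x h1 h2
  rw [h1, solitonLp, h2]
  have h3 := greenAvg_eq_of_hasDerivAt (M := max (3 / (2 * q)) (max (3 / (2 * q) * κ)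
    (κ ^ 2 * (3 / (2 * q) + q * (3 / (2 * q)) ^ 2)))) hκ (hasDerivAt_soliton κ q)
    (hasDerivAt_solitonDeriv hq.ne') (by fun_prop)
    (fun x => (abs_soliton_le hq κ x).trans (le_max_left _ _))
    (fun x => (abs_solitonDeriv_le hκ hq x).trans ((le_max_left _ _).trans (le_max_right _ _)))
    (fun x => (abs_second_le hq x).trans ((le_max_right _ _).trans (le_max_right _ _))) x
  rw [← h3]
  congr 1
  ext1 y
  field_simp
  ring

/-- The witness is `w² - (w²)''/κ²`, a polynomial in `sech²` that is explicitly square integrable.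
Together with `green_solitonSqLp` it puts the soliton in the range of two successive resolvents, the
fourth order regularity needed for the residual. -/
theorem exists_green_eq_solitonSqLp {κ q : ℝ} (hκ : 0 < κ) (hq : 0 < q) :
    ∃ y : L2R, solitonSqLp hκ hq = green κ y := by
  set a := 3 / (2 * q) with ha
  have hcs := continuous_sechSq κ
  have hct := continuous_halfTanh κ
  have hS := sechSq_pos κ
  have hS1 := sechSq_le_one κ
  have hbound : ∀ x, |a ^ 2 * (-3 * sechSq κ x ^ 2 + 5 * sechSq κ x ^ 3)| ≤
      a ^ 2 * 8 * sechSq κ x := by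
    intro x
    have h2 : sechSq κ x ^ 2 ≤ sechSq κ x := by nlinarith [hS x, hS1 x]
    have h3 : sechSq κ x ^ 3 ≤ sechSq κ x := by nlinarith [hS x, hS1 x]
    rw [abs_mul, abs_of_nonneg (sq_nonneg a), mul_assoc]
    gcongr
    rw [abs_le]
    constructor <;> nlinarith [hS x, sq_nonneg (sechSq κ x), pow_pos (hS x) 3]
  have hm : MemLp (fun x => a ^ 2 * (-3 * sechSq κ x ^ 2 + 5 * sechSq κ x ^ 3)) 2 :=
    memLp_of_abs_le_sechSq hκ (by fun_prop) hbound
  refine ⟨hm.toLp _, (Lp.ext ?_).symm⟩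
  have hd1 : ∀ x, HasDerivAt (fun x => soliton κ q x ^ 2)
      (-2 * κ * a ^ 2 * (sechSq κ x * (sechSq κ x * halfTanh κ x))) x := fun x => by
    refine ((hasDerivAt_soliton κ q x).pow 2).congr_deriv ?_
    rw [soliton, solitonDeriv]; push_cast; ring
  have hd2 : ∀ x, HasDerivAt (fun x => -2 * κ * a ^ 2 * (sechSq κ x * (sechSq κ x * halfTanh κ x)))
      (a ^ 2 * κ ^ 2 * (4 * sechSq κ x ^ 2 - 5 * sechSq κ x ^ 3)) x := fun x => by
    refine (((hasDerivAt_sechSq κ x).mul (hasDerivAt_sechSq_mul_halfTanh κ x)).const_mul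
      (-2 * κ * a ^ 2)).congr_deriv ?_
    linear_combination (2 * κ ^ 2 * a ^ 2 * sechSq κ x ^ 2) * halfTanh_sq κ x
  have hST : ∀ x, |sechSq κ x * (sechSq κ x * halfTanh κ x)| ≤ 1 := fun x => by
    rw [abs_mul, abs_mul, abs_of_pos (hS x)]
    exact mul_le_one₀ (hS1 x) (by have := hS x; positivity)
      (mul_le_one₀ (hS1 x) (abs_nonneg _) (abs_halfTanh_le κ x))
  filter_upwards [green_coe_of_continuous (M := a ^ 2 * 8) hκ (by fun_prop)
    (fun x => (hbound x).trans (mul_le_of_le_one_right (by positivity) (hS1 x))) hm.coeFn_toLp,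
    (memLp_soliton_sq hκ hq).coeFn_toLp] with x h1 h2
  rw [h1, solitonSqLp, h2]
  have h3 := greenAvg_eq_of_hasDerivAt (M := a ^ 2 + |2 * κ * a ^ 2| + a ^ 2 * κ ^ 2 * 9) hκ hd1 hd2
    (by fun_prop) ?_ ?_ ?_ x
  · rw [← h3]
    congr 1
    ext1 y
    rw [soliton, ← ha]
    field_simp
    ring
  · intro x
    rw [abs_pow]
    have := abs_soliton_le hq κ x
    have h4 : |soliton κ q x| ^ 2 ≤ a ^ 2 := by gcongr
    have : 0 ≤ a ^ 2 * κ ^ 2 * 9 := by positivity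
    linarith [abs_nonneg (2 * κ * a ^ 2)]
  · intro x
    rw [abs_mul, show -2 * κ * a ^ 2 = -(2 * κ * a ^ 2) by ring, abs_neg]
    have h5 := mul_le_mul_of_nonneg_left (hST x) (abs_nonneg (2 * κ * a ^ 2))
    have : 0 ≤ a ^ 2 * κ ^ 2 * 9 := by positivity
    nlinarith [sq_nonneg a]
  · intro x
    rw [abs_mul, abs_of_nonneg (by positivity : 0 ≤ a ^ 2 * κ ^ 2)]
    have h6 : |4 * sechSq κ x ^ 2 - 5 * sechSq κ x ^ 3| ≤ 9 := by
      have h2 : sechSq κ x ^ 2 ≤ 1 := pow_le_one₀ (hS x).le (hS1 x)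
      have h3 : sechSq κ x ^ 3 ≤ 1 := pow_le_one₀ (hS x).le (hS1 x)
      have h4 := pow_pos (hS x) 2
      have h5 := pow_pos (hS x) 3
      rw [abs_le]; constructor <;> linarith
    have := mul_le_mul_of_nonneg_left h6 (by positivity : 0 ≤ a ^ 2 * κ ^ 2)
    linarith [abs_nonneg (2 * κ * a ^ 2), sq_nonneg a]

end Peridynamics

/-! ### Invertibility of the linearized stationary KdV operator on even functions -/

namespace Peridynamics

theorem aestronglyMeasurable_soliton (κ q : ℝ) : AEStronglyMeasurable (soliton κ q) volume :=
  (continuous_soliton κ q).aestronglyMeasurable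

/-- Multiplication by the soliton. -/
noncomputable def solitonMul (κ : ℝ) {q : ℝ} (hq : 0 < q) : L2R →L[ℝ] L2R :=
  mulOp (aestronglyMeasurable_soliton κ q) (by positivity) (abs_soliton_le hq κ)

theorem solitonMul_coe (κ : ℝ) {q : ℝ} (hq : 0 < q) (V : L2R) :
    solitonMul κ hq V =ᵐ[volume] fun x => soliton κ q x * V x :=
  mulOp_coe _ _ _ V

/-- The Jost solution argument: a bounded even solution of `v'' = κ² (1 - 2 q w) v` vanishes. -/
theorem eq_zero_of_bounded_of_even {κ q M : ℝ} (hκ : 0 < κ) (hq : 0 < q) {v v' : ℝ → ℝ}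
    (hv : ∀ x, HasDerivAt v (v' x) x)
    (hv' : ∀ x, HasDerivAt v' (κ ^ 2 * (v x - 2 * q * soliton κ q x * v x)) x)
    (h0 : ∀ x, |v x| ≤ M) (h1 : ∀ x, |v' x| ≤ M) (heven : ∀ x, v (-x) = v x) (x : ℝ) :
    v x = 0 := by
  set u : ℝ → ℝ := solitonDeriv κ q with hu
  set u' : ℝ → ℝ := fun x => κ ^ 2 * (soliton κ q x - q * soliton κ q x ^ 2) with hu'
  have hM : 0 ≤ M := (abs_nonneg _).trans (h0 0)
  have hud : ∀ x, HasDerivAt u (u' x) x := hasDerivAt_solitonDeriv hq.ne'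
  have hud' : ∀ x, HasDerivAt u' (κ ^ 2 * (u x - 2 * q * soliton κ q x * u x)) x :=
    fun x => hasDerivAt_soliton_second x
  -- the Wronskian is constant and tends to zero
  have hW : ∀ x, v x * u' x - v' x * u x = 0 := by
    have hd : ∀ x, HasDerivAt (fun x => v x * u' x - v' x * u x) 0 x := fun x => by
      refine (((hv x).mul (hud' x)).sub ((hv' x).mul (hud x))).congr_deriv ?_
      ring
    have hconst : ∀ x y, v x * u' x - v' x * u x = v y * u' y - v' y * u y := fun x y =>
      is_const_of_deriv_eq_zero (fun x => (hd x).differentiableAt) (fun x => (hd x).deriv) x y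
    have hS := tendsto_sechSq hκ
    have hw : Tendsto (soliton κ q) atTop (𝓝 0) := by
      have := hS.const_mul (3 / (2 * q))
      rwa [mul_zero] at this
    have hu0 : Tendsto u atTop (𝓝 0) := by
      refine squeeze_zero_norm (fun x => ?_)
        (by simpa using hS.const_mul (3 / (2 * q) * κ))
      rw [hu, solitonDeriv, norm_neg, norm_mul,
        Real.norm_of_nonneg (by positivity : 0 ≤ 3 / (2 * q) * κ), norm_mul,
        Real.norm_of_nonneg (sechSq_pos κ x).le]
      gcongr
      exact mul_le_of_le_one_right (sechSq_pos κ x).le (abs_halfTanh_le κ x)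
    have hu0' : Tendsto u' atTop (𝓝 0) := by
      have := (hw.sub ((hw.pow 2).const_mul q)).const_mul (κ ^ 2)
      simpa using this
    have hlim : Tendsto (fun x => v x * u' x - v' x * u x) atTop (𝓝 0) := by
      have e1 : Tendsto (fun x => v x * u' x) atTop (𝓝 0) := by
        refine squeeze_zero_norm (fun x => ?_) (by simpa using hu0'.norm.const_mul M)
        rw [norm_mul, ← Real.norm_eq_abs (u' x)]
        gcongr
        exact h0 x
      have e2 : Tendsto (fun x => v' x * u x) atTop (𝓝 0) := by
        refine squeeze_zero_norm (fun x => ?_) (by simpa using hu0.norm.const_mul M)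
        rw [norm_mul, ← Real.norm_eq_abs (u x)]
        gcongr
        exact h1 x
      simpa using e1.sub e2
    intro x
    refine tendsto_nhds_unique (f := fun _ : ℝ => v x * u' x - v' x * u x) (l := atTop)
      tendsto_const_nhds ?_
    exact hlim.congr fun y => hconst y x
  have hneg : ∀ x, 0 < x → u x < 0 := fun x hx => by
    have h1 := sechSq_pos κ x
    have h2 := halfTanh_pos hκ hx
    rw [hu, solitonDeriv, neg_lt_zero]
    positivity
  -- hence `v` is a multiple of `w'` on the half-line
  have hprop : ∀ x, 0 < x → v x * u 1 - v 1 * u x = 0 := by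
    have hd : ∀ x ∈ Ioi (0 : ℝ), HasDerivAt (fun x => v x / u x) 0 x := fun x hx => by
      refine ((hv x).div (hud x) (hneg x hx).ne).congr_deriv ?_
      rw [div_eq_zero_iff]; left
      linarith [hW x]
    have hc : ∀ x ∈ Ioi (0 : ℝ), v x / u x = v 1 / u 1 := fun x hx =>
      isOpen_Ioi.is_const_of_deriv_eq_zero isPreconnected_Ioi
        (fun y hy => (hd y hy).differentiableAt.differentiableWithinAt)
        (fun y hy => (hd y hy).deriv) hx (mem_Ioi.2 one_pos)
    intro x hx
    have := hc x hx
    rw [div_eq_div_iff (hneg x hx).ne (hneg 1 one_pos).ne] at this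
    linarith
  have hprop0 : ∀ x ∈ Ici (0 : ℝ), v x * u 1 - v 1 * u x = 0 := by
    have hcv : Continuous v := continuous_iff_continuousAt.2 fun x => (hv x).continuousAt
    have hcu : Continuous u := continuous_iff_continuousAt.2 fun x => (hud x).continuousAt
    have hcl : IsClosed {x | v x * u 1 - v 1 * u x = 0} :=
      isClosed_eq (by fun_prop) continuous_const
    intro x hx
    have : closure (Ioi (0 : ℝ)) ⊆ {x | v x * u 1 - v 1 * u x = 0} :=
      closure_minimal (fun x hx => hprop x hx) hcl
    rw [closure_Ioi] at this
    exact this hx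
  have hv0 : v' 0 = 0 := by
    have e1 := ((hv (-0)).scomp (0 : ℝ) (hasDerivAt_neg 0))
    have e2 : v ∘ Neg.neg = v := funext heven
    rw [e2, neg_zero] at e1
    have := e1.unique (hv 0)
    simp only [smul_eq_mul] at this
    linarith
  -- Differentiate the proportionality of `v` and `w'` from the right at zero: `v'(0) w'(1) = v(1)
  -- w''(0)`. Evenness gives `v'(0) = 0`, while `w''(0) = -3κ²/(4q)` is nonzero. This is where the
  -- translational mode is excluded.
  have hv1 : v 1 = 0 := by
    have e1 : HasDerivWithinAt (fun x => v x * u 1 - v 1 * u x)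
        (v' 0 * u 1 - v 1 * u' 0) (Ici 0) 0 :=
      (((hv 0).mul_const _).sub ((hud 0).const_mul _)).hasDerivWithinAt
    have e2 : HasDerivWithinAt (fun x => v x * u 1 - v 1 * u x) 0 (Ici 0) 0 :=
      (hasDerivWithinAt_const (0 : ℝ) (Ici 0) (0 : ℝ)).congr (fun x hx => hprop0 x hx)
        (hprop0 0 self_mem_Ici)
    have e3 := (uniqueDiffOn_Ici (0 : ℝ) 0 self_mem_Ici).eq_deriv _ e1 e2
    rw [hv0, zero_mul, zero_sub, neg_eq_zero, mul_eq_zero] at e3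
    refine e3.resolve_right ?_
    have : u' 0 = -(κ ^ 2 * (3 / (4 * q))) := by
      rw [hu']
      simp only [soliton, sechSq_zero]
      field_simp
      ring
    rw [this]
    have : 0 < κ ^ 2 * (3 / (4 * q)) := by positivity
    linarith
  have hpos : ∀ x, 0 ≤ x → v x = 0 := fun x hx => by
    have := hprop0 x hx
    rw [hv1, zero_mul, sub_zero, mul_eq_zero] at this
    exact this.resolve_right (hneg 1 one_pos).ne
  rcases le_total 0 x with h | h
  · exact hpos x h
  · rw [← heven]; exact hpos _ (by linarith)

/-- The linearization of `W ↦ q • green κ (W²)` at the soliton. -/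
noncomputable def kdvLin (κ : ℝ) {q : ℝ} (hq : 0 < q) : L2R →L[ℝ] L2R :=
  (2 * q) • (green κ).comp (solitonMul κ hq)

theorem kdvLin_apply (κ : ℝ) {q : ℝ} (hq : 0 < q) (V : L2R) :
    kdvLin κ hq V = green κ ((2 * q) • solitonMul κ hq V) := by
  rw [kdvLin, map_smul]; rfl

theorem isCompactOperator_kdvLin {κ q : ℝ} (hκ : 0 < κ) (hq : 0 < q) :
    IsCompactOperator (kdvLin κ hq) :=
  (isCompactOperator_green_mulOp hκ (aestronglyMeasurable_soliton κ q) (by positivity)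
    (abs_soliton_le hq κ) (by positivity) (abs_soliton_le_exp hκ hq)).smul (2 * q)

/-- Bootstrapping: a fixed vector has a continuous bounded representative, given by pairing with the
Green's kernel. Reinserting it into the resolvent makes it twice differentiable with bounded first
derivative, so the classical ODE argument applies. -/
theorem eq_zero_of_kdvLin_eq {κ q : ℝ} (hκ : 0 < κ) (hq : 0 < q) {V : L2R}
    (heven : refl V = V) (h : kdvLin κ hq V = V) : V = 0 := by
  set G : L2R := (2 * q) • solitonMul κ hq V with hG
  set v : ℝ → ℝ := fun x => inner ℝ (greenKernelLp hκ) (tr x G) with hv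
  have hVv : V =ᵐ[volume] v := by
    rw [← h, kdvLin_apply]
    exact green_coe hκ G
  have hcv : Continuous v := continuous_const.inner (continuous_tr G)
  have hcs := continuous_soliton κ q
  have hb : ∀ x, |v x| ≤ ‖greenKernelLp hκ‖ * ‖G‖ := fun x => by
    rw [← norm_tr x G]
    exact abs_real_inner_le_norm _ _
  set f : ℝ → ℝ := fun x => 2 * q * soliton κ q x * v x with hf
  have hGf : G =ᵐ[volume] f := by
    filter_upwards [Lp.coeFn_smul (2 * q) (solitonMul κ hq V), solitonMul_coe κ hq V, hVv]
      with x h1 h2 h3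
    rw [hG, h1, Pi.smul_apply, h2, h3, smul_eq_mul, ← mul_assoc]
  have hcf : Continuous f := by fun_prop
  set B := ‖greenKernelLp hκ‖ * ‖G‖ with hB
  have hfb : ∀ x, ‖f x‖ ≤ 3 * B := fun x => by
    rw [hf, Real.norm_eq_abs, abs_mul, abs_mul, abs_of_pos (by positivity : 0 < 2 * q)]
    have := abs_soliton_le hq κ x
    calc 2 * q * |soliton κ q x| * |v x| ≤ 2 * q * (3 / (2 * q)) * B := by gcongr; exact hb x
      _ = 3 * B := by field_simp
  have hve : v = greenAvg κ f := by
    ext1 x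
    exact inner_greenKernelLp_tr hκ hcf hfb hGf x
  have hB0 : 0 ≤ B := by positivity
  have heven' : ∀ x, v (-x) = v x := by
    have h1 : (fun x => v (-x)) =ᵐ[volume] v := by
      filter_upwards [ae_comp_neg hVv, refl_coe V, hVv] with x e1 e2 e3
      rw [← e1, ← e2, heven, e3]
    exact congrFun ((Continuous.ae_eq_iff_eq volume (by fun_prop) hcv).1 h1)
  have hv0 : ∀ x, v x = 0 := by
    refine eq_zero_of_bounded_of_even (M := B + κ * (3 * B)) (v' := greenAvgDeriv κ f) hκ hq
      ?_ ?_ ?_ ?_ heven'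
    · intro x
      rw [hve]
      exact hasDerivAt_greenAvg hκ hcf hfb x
    · intro x
      refine (hasDerivAt_greenAvgDeriv hκ hcf hfb x).congr_deriv ?_
      rw [← hve, smul_eq_mul]
    · intro x
      have := hb x
      nlinarith [mul_nonneg hκ.le hB0]
    · intro x
      have := norm_greenAvgDeriv_le hκ hfb x
      rw [Real.norm_eq_abs] at this
      linarith
  apply Lp.ext
  filter_upwards [hVv, Lp.coeFn_zero ℝ 2 (volume : Measure ℝ)] with x h1 h2
  rw [h1, h2, hv0]; rfl

/-! ### The even projection and Fredholm's alternative -/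

/-- The orthogonal projection of `L²(ℝ)` onto the even functions. -/
noncomputable def evenPart : L2R →L[ℝ] L2R :=
  (1 / 2 : ℝ) • (ContinuousLinearMap.id ℝ L2R + refl.toContinuousLinearMap)

theorem evenPart_apply (V : L2R) : evenPart V = (1 / 2 : ℝ) • (V + refl V) := rfl

theorem evenPart_of_even {V : L2R} (h : refl V = V) : evenPart V = V := by
  rw [evenPart_apply, h, ← two_smul ℝ V, smul_smul]; norm_num

theorem refl_evenPart (V : L2R) : refl (evenPart V) = evenPart V := by
  rw [evenPart_apply, map_smul, map_add, refl_refl, add_comm]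

theorem norm_evenPart_le (V : L2R) : ‖evenPart V‖ ≤ ‖V‖ := by
  rw [evenPart_apply, norm_smul, Real.norm_of_nonneg (by norm_num)]
  have := norm_add_le V (refl V)
  rw [LinearIsometry.norm_map] at this
  linarith

theorem refl_green {κ : ℝ} (hκ : 0 < κ) (V : L2R) : refl (green κ V) = green κ (refl V) := by
  apply Lp.ext
  filter_upwards [refl_coe (green κ V), ae_comp_neg (green_coe hκ V), green_coe hκ (refl V)]
    with x h1 h2 h3
  rw [h1, h2, h3, ← integral_greenKernel_mul, ← integral_greenKernel_mul,
    ← integral_neg_eq_self (fun t => greenKernel κ t * V (-x + t))]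
  apply integral_congr_ae
  filter_upwards [ae_comp_add x (refl_coe V)] with t ht
  rw [add_comm x t, ht, greenKernel_neg]
  congr 2; ring

theorem refl_solitonMul (κ : ℝ) {q : ℝ} (hq : 0 < q) (V : L2R) :
    refl (solitonMul κ hq V) = solitonMul κ hq (refl V) := by
  apply Lp.ext
  filter_upwards [refl_coe (solitonMul κ hq V), ae_comp_neg (solitonMul_coe κ hq V),
    solitonMul_coe κ hq (refl V), refl_coe V] with x h1 h2 h3 h4
  rw [h1, h2, h3, h4, soliton, soliton, sechSq_neg]

theorem refl_kdvLin {κ q : ℝ} (hκ : 0 < κ) (hq : 0 < q) (V : L2R) :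
    refl (kdvLin κ hq V) = kdvLin κ hq (refl V) := by
  rw [kdvLin_apply, kdvLin_apply, refl_green hκ, map_smul, refl_solitonMul]

/-- The linearized KdV operator is invertible once the translational mode is projected out. -/
theorem exists_equiv_one_sub_kdvLin {κ q : ℝ} (hκ : 0 < κ) (hq : 0 < q) :
    ∃ L : L2R ≃L[ℝ] L2R, ∀ V, L V = V - kdvLin κ hq (evenPart V) := by
  have hcomp : IsCompactOperator ((kdvLin κ hq).comp evenPart) :=
    (isCompactOperator_kdvLin hκ hq).comp_clm evenPart
  have hres : (1 : ℝ) ∈ resolventSet ℝ ((kdvLin κ hq).comp evenPart) := by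
    -- Fredholm's alternative for a compact operator at the spectral value 1. An eigenvector is
    -- automatically even, because `kdvLin` commutes with reflection and is applied to an even
    -- function.
    refine (hcomp.hasEigenvalue_or_mem_resolventSet one_ne_zero).resolve_left fun hev => ?_
    obtain ⟨V, hV⟩ := hev.exists_hasEigenvector
    have h1 : kdvLin κ hq (evenPart V) = V := by
      have := hV.apply_eq_smul
      rwa [one_smul] at this
    have h2 : refl V = V := by
      conv_lhs => rw [← h1]
      rw [refl_kdvLin hκ, refl_evenPart, h1]
    rw [evenPart_of_even h2] at h1
    exact hV.2 (eq_zero_of_kdvLin_eq hκ hq h2 h1)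
  rw [spectrum.mem_resolventSet_iff, map_one] at hres
  obtain ⟨L, hL⟩ := hres
  refine ⟨ContinuousLinearEquiv.unitsEquiv ℝ L2R L, fun V => ?_⟩
  rw [ContinuousLinearEquiv.unitsEquiv_apply, hL]
  rfl

end Peridynamics

/-! ### The rescaled nonlinearity -/

namespace Peridynamics

/-- The assumptions on the force law that enter the fixed point argument: the higher order part
satisfies its cubic bound globally. -/
structure GlobalLaw (α β γ : ℝ → ℝ) (P : ℝ → ℝ → ℝ) : Prop where
  alpha_nonneg : ∀ ξ, 0 < ξ → 0 ≤ α ξ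
  alpha_two : IntegrableOn (fun ξ => α ξ * ξ ^ 2) (Ioi 0)
  alpha_four : IntegrableOn (fun ξ => α ξ * ξ ^ 4) (Ioi 0)
  alpha_six : IntegrableOn (fun ξ => α ξ * ξ ^ 6) (Ioi 0)
  alpha_two_pos : 0 < moment α 2
  beta_nonneg : ∀ ξ, 0 < ξ → 0 ≤ β ξ
  beta_five_half : IntegrableOn (fun ξ => β ξ * ξ ^ (5 / 2 : ℝ)) (Ioi 0)
  beta_three : IntegrableOn (fun ξ => β ξ * ξ ^ 3) (Ioi 0)
  beta_five : IntegrableOn (fun ξ => β ξ * ξ ^ 5) (Ioi 0)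
  beta_three_pos : 0 < moment β 3
  gamma_nonneg : ∀ ξ, 0 < ξ → 0 ≤ γ ξ
  gamma_three : IntegrableOn (fun ξ => γ ξ * ξ ^ 3) (Ioi 0)
  gamma_four : IntegrableOn (fun ξ => γ ξ * ξ ^ 4) (Ioi 0)
  cont : ∀ ξ, 0 < ξ → Continuous fun r => P r ξ
  continuousOn : ∀ r, ContinuousOn (fun ξ => P r ξ) (Ioi 0)
  zero : ∀ ξ, 0 < ξ → P 0 ξ = 0
  lipschitz : ∀ ξ ρ r s, 0 < ξ → |r| ≤ ρ → |s| ≤ ρ → |P r ξ - P s ξ| ≤ γ ξ * ρ ^ 2 * |r - s|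

variable {α β γ : ℝ → ℝ} {P : ℝ → ℝ → ℝ}

theorem GlobalLaw.beta_four (h : GlobalLaw α β γ P) :
    IntegrableOn (fun ξ => β ξ * ξ ^ 4) (Ioi 0) :=
  integrableOn_moment_between h.beta_nonneg (by norm_num) (by norm_num) h.beta_three h.beta_five

theorem GlobalLaw.abs_le (h : GlobalLaw α β γ P) {ξ : ℝ} (hξ : 0 < ξ) (r : ℝ) :
    |P r ξ| ≤ γ ξ * |r| ^ 3 := by
  have := h.lipschitz ξ |r| r 0 hξ le_rfl (by simp)
  rw [h.zero ξ hξ, sub_zero, sub_zero] at this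
  exact this.trans (le_of_eq (by ring))

theorem GlobalLaw.quad (h : GlobalLaw α β γ P) {ε : ℝ} (hε : 0 < ε) (V W : L2R) :
    BondAdmissible (quadStress β ε V W) :=
  quadStress_admissible h.beta_nonneg h.beta_five_half h.beta_three hε V W

theorem GlobalLaw.law (h : GlobalLaw α β γ P) {ε : ℝ} (hε : 0 < ε) (W : L2R) :
    BondAdmissible (lawStress P ε W) :=
  lawStress_admissible h.cont h.continuousOn h.gamma_nonneg h.gamma_three hε
    fun _ _ hξ => h.abs_le hξ _

/-- The quadratic nonlinearity. -/
noncomputable def quadVec (β : ℝ → ℝ) (ε : ℝ) (V W : L2R) : L2R :=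
  (ε ^ 3)⁻¹ • bondVec ε (quadStress β ε V W)

/-- The higher order nonlinearity. -/
noncomputable def lawVec (P : ℝ → ℝ → ℝ) (ε : ℝ) (W : L2R) : L2R :=
  (ε ^ 5)⁻¹ • bondVec ε (lawStress P ε W)

/-- The full nonlinearity of the rescaled travelling wave equation. -/
noncomputable def nonlin (β : ℝ → ℝ) (P : ℝ → ℝ → ℝ) (ε : ℝ) (W : L2R) : L2R :=
  quadVec β ε W W + lawVec P ε W

theorem GlobalLaw.inner_quadVec (h : GlobalLaw α β γ P) {ε : ℝ} (hε : 0 < ε) (V W φ : L2R) :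
    inner ℝ (quadVec β ε V W) φ = (ε ^ 3)⁻¹ * bondForm ε (quadStress β ε V W) φ := by
  rw [quadVec, inner_smul_left, (h.quad hε V W).inner_bondVec hε.le]; rfl

theorem GlobalLaw.inner_lawVec (h : GlobalLaw α β γ P) {ε : ℝ} (hε : 0 < ε) (W φ : L2R) :
    inner ℝ (lawVec P ε W) φ = (ε ^ 5)⁻¹ * bondForm ε (lawStress P ε W) φ := by
  rw [lawVec, inner_smul_left, (h.law hε W).inner_bondVec hε.le]; rfl

theorem GlobalLaw.quadVec_add_left (h : GlobalLaw α β γ P) {ε : ℝ} (hε : 0 < ε) (V V' W : L2R) :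
    quadVec β ε (V + V') W = quadVec β ε V W + quadVec β ε V' W := by
  refine ext_inner_right ℝ fun φ => ?_
  rw [inner_add_left, h.inner_quadVec hε, h.inner_quadVec hε, h.inner_quadVec hε, ← mul_add,
    ← (h.quad hε V W).bondForm_add_left (h.quad hε V' W) hε.le]
  congr 2; ext ξ x
  simp only [quadStress, bond_add]; ring

theorem quadVec_comm (β : ℝ → ℝ) (ε : ℝ) (V W : L2R) : quadVec β ε V W = quadVec β ε W V := by
  rw [quadVec, quadVec]
  congr 2; ext ξ x
  simp only [quadStress]; ring

theorem quadVec_neg_left (β : ℝ → ℝ) (ε : ℝ) (h : GlobalLaw α β γ P) (hε : 0 < ε) (V W : L2R) :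
    quadVec β ε (-V) W = -quadVec β ε V W := by
  have h0 : quadVec β ε 0 W = 0 := by
    have := h.quadVec_add_left hε 0 0 W
    rwa [add_zero, left_eq_add] at this
  have := h.quadVec_add_left hε V (-V) W
  rw [add_neg_cancel, h0] at this
  exact (neg_eq_of_add_eq_zero_right this.symm).symm

/-- Polarization of the difference of two values of the quadratic nonlinearity. -/
theorem GlobalLaw.quadVec_sub (h : GlobalLaw α β γ P) {ε : ℝ} (hε : 0 < ε) (W₀ X Y : L2R) :
    quadVec β ε X X - quadVec β ε Y Y = (2 : ℝ) • quadVec β ε W₀ (X - Y) +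
      quadVec β ε ((X - W₀) + (Y - W₀)) (X - Y) := by
  have hadd := fun V V' W => h.quadVec_add_left hε V V' W
  have hneg := fun V W => quadVec_neg_left β ε h hε V W
  have hadd' : ∀ V W W', quadVec β ε V (W + W') = quadVec β ε V W + quadVec β ε V W' := by
    intro V W W'
    rw [quadVec_comm, hadd, quadVec_comm β ε W, quadVec_comm β ε W']
  have hneg' : ∀ V W, quadVec β ε V (-W) = -quadVec β ε V W := by
    intro V W
    rw [quadVec_comm, hneg, quadVec_comm]
  simp only [sub_eq_add_neg, hadd, hadd', hneg, hneg']
  rw [quadVec_comm β ε Y X]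
  module

/-- On `L²` the quadratic term may grow like `ε^{-1/2}`; the factor `√ε` on the left records this
loss. -/
theorem GlobalLaw.norm_quadVec_le (h : GlobalLaw α β γ P) {ε : ℝ} (hε : 0 < ε) (V W : L2R) :
    Real.sqrt ε * ‖quadVec β ε V W‖ ≤
      (∫ ξ in Ioi (0 : ℝ), β ξ * ξ ^ (5 / 2 : ℝ)) * ‖V‖ * ‖W‖ := by
  have hI : 0 ≤ ∫ ξ in Ioi (0 : ℝ), β ξ * ξ ^ (5 / 2 : ℝ) :=
    setIntegral_nonneg measurableSet_Ioi fun ξ hξ =>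
      mul_nonneg (h.beta_nonneg ξ hξ) (Real.rpow_nonneg (le_of_lt hξ) _)
  have hs := Real.sqrt_pos.2 hε
  have key : ‖Real.sqrt ε • quadVec β ε V W‖ ≤
      (∫ ξ in Ioi (0 : ℝ), β ξ * ξ ^ (5 / 2 : ℝ)) * ‖V‖ * ‖W‖ := by
    refine norm_le_of_abs_inner_le (by positivity) fun φ => ?_
    rw [inner_smul_left, RCLike.conj_to_real, h.inner_quadVec hε, abs_mul, abs_mul,
      abs_of_pos hs, abs_of_pos (by positivity : 0 < (ε ^ 3)⁻¹)]
    have h1 := abs_bondForm_quadStress_le h.beta_nonneg h.beta_five_half hε V W φ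
    calc Real.sqrt ε * ((ε ^ 3)⁻¹ * |bondForm ε (quadStress β ε V W) φ|)
        ≤ Real.sqrt ε * ((ε ^ 3)⁻¹ * (ε ^ 2 * Real.sqrt ε *
          (∫ ξ in Ioi (0 : ℝ), β ξ * ξ ^ (5 / 2 : ℝ)) * ‖V‖ * ‖W‖ * ‖φ‖)) := by gcongr
      _ = (Real.sqrt ε * Real.sqrt ε) * (ε ^ 3)⁻¹ * ε ^ 2 *
          ((∫ ξ in Ioi (0 : ℝ), β ξ * ξ ^ (5 / 2 : ℝ)) * ‖V‖ * ‖W‖ * ‖φ‖) := by ring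
      _ = _ := by
        rw [Real.mul_self_sqrt hε.le]
        field_simp
  rwa [norm_smul, Real.norm_of_nonneg hs.le] at key

/-- By duality the resolvent passes to the test function, which becomes essentially bounded. This
removes the loss of `ε^{-1/2}`. -/
theorem GlobalLaw.norm_green_quadVec_le (h : GlobalLaw α β γ P) {κ : ℝ} (hκ : 0 < κ) {ε : ℝ}
    (hε : 0 < ε) (V W : L2R) :
    ‖green κ (quadVec β ε V W)‖ ≤ moment β 3 * ‖greenKernelLp hκ‖ * ‖V‖ * ‖W‖ := by
  have hq := h.beta_three_pos
  refine norm_le_of_abs_inner_le (by positivity) fun φ => ?_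
  rw [inner_green_left hκ, h.inner_quadVec hε, abs_mul,
    abs_of_pos (by positivity : 0 < (ε ^ 3)⁻¹)]
  have h1 := abs_bondForm_quadStress_le_of_bounded_test h.beta_nonneg h.beta_three hε
    (by positivity) V W (abs_green_le hκ φ)
  calc (ε ^ 3)⁻¹ * |bondForm ε (quadStress β ε V W) (green κ φ)|
      ≤ (ε ^ 3)⁻¹ * (ε ^ 3 * moment β 3 * (‖greenKernelLp hκ‖ * ‖φ‖) * ‖V‖ * ‖W‖) := by gcongr
    _ = _ := by field_simp

theorem GlobalLaw.norm_quadVec_le_of_bounded (h : GlobalLaw α β γ P) {ε b : ℝ} (hε : 0 < ε)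
    (hb : 0 ≤ b) {V : L2R} (hV : ∀ᵐ x, |V x| ≤ b) (W : L2R) :
    ‖quadVec β ε V W‖ ≤ moment β 3 * b * ‖W‖ := by
  have hq := h.beta_three_pos
  refine norm_le_of_abs_inner_le (by positivity) fun φ => ?_
  rw [h.inner_quadVec hε, abs_mul, abs_of_pos (by positivity : 0 < (ε ^ 3)⁻¹)]
  calc (ε ^ 3)⁻¹ * |bondForm ε (quadStress β ε V W) φ|
      ≤ (ε ^ 3)⁻¹ * (ε ^ 3 * moment β 3 * b * ‖W‖ * ‖φ‖) := by
        gcongr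
        exact abs_bondForm_quadStress_le_of_bounded h.beta_nonneg h.beta_three hε hb hV W φ
    _ = _ := by field_simp

/-- If the bond integrals of the quadratic stress are close to their long-wave limit, then so is
the quadratic form. -/
theorem GlobalLaw.abs_bondForm_quadStress_sub_le (h : GlobalLaw α β γ P) {ε : ℝ} (hε : 0 < ε)
    {k : ℕ} (hk : IntegrableOn (fun ξ => β ξ * ξ ^ k) (Ioi 0)) {V W φ : L2R} {I C : ℝ}
    (hI : ∀ η, 0 ≤ η → |(∫ x, bond η V x * bond η W x * bond η φ x) - η ^ 3 * I| ≤ C * η ^ k) :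
    |(ε ^ 3)⁻¹ * bondForm ε (quadStress β ε V W) φ - moment β 3 * I| ≤
      (ε ^ 3)⁻¹ * (C * ε ^ k * moment β k) := by
  have e : bondForm ε (quadStress β ε V W) φ - ε ^ 3 * (moment β 3 * I) =
      ∫ ξ in Ioi (0 : ℝ), β ξ * ((∫ x, bond (ε * ξ) V x * bond (ε * ξ) W x * bond (ε * ξ) φ x) -
        (ε * ξ) ^ 3 * I) := by
    have e1 : ε ^ 3 * (moment β 3 * I) = ∫ ξ in Ioi (0 : ℝ), ε ^ 3 * I * (β ξ * ξ ^ 3) := by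
      rw [integral_const_mul, moment]; ring
    rw [bondForm, e1, ← integral_sub ((h.quad hε V W).integrableOn hε.le φ)
      (h.beta_three.const_mul _)]
    congr 1; ext1 ξ
    rw [integral_quadStress]; ring
  have e2 : (ε ^ 3)⁻¹ * bondForm ε (quadStress β ε V W) φ - moment β 3 * I =
      (ε ^ 3)⁻¹ * (bondForm ε (quadStress β ε V W) φ - ε ^ 3 * (moment β 3 * I)) := by
    field_simp
  rw [e2, abs_mul, abs_of_pos (by positivity : 0 < (ε ^ 3)⁻¹), e]
  gcongr
  rw [moment, ← integral_const_mul, ← Real.norm_eq_abs]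
  refine norm_integral_le_of_norm_le (hk.const_mul _) ?_
  filter_upwards [ae_restrict_mem measurableSet_Ioi] with ξ hξ
  have hξ' : 0 < ξ := hξ
  rw [norm_mul, Real.norm_of_nonneg (h.beta_nonneg ξ hξ)]
  calc β ξ * _ ≤ β ξ * (C * (ε * ξ) ^ k) := by
        have := h.beta_nonneg ξ hξ
        gcongr
        exact hI (ε * ξ) (by positivity)
    _ = _ := by ring

/-- The strain bound `ρ ξ` is left free: `L²` control gives `ρ` of order `ξ^{1/2}` and the moment `k
= 3`, while an `L^∞` bound gives `ρ` of order `ξ`, the moment `k = 4` and one more power of `ε`. -/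
theorem GlobalLaw.abs_bondForm_lawStress_sub_le (h : GlobalLaw α β γ P) {ε R : ℝ} (hε : 0 < ε)
    {k : ℕ} (hk : IntegrableOn (fun ξ => γ ξ * ξ ^ k) (Ioi 0)) {X Y : L2R} {ρ : ℝ → ℝ}
    (hX : ∀ ξ x, 0 < ξ → |ε * bond (ε * ξ) X x| ≤ ρ ξ)
    (hY : ∀ ξ x, 0 < ξ → |ε * bond (ε * ξ) Y x| ≤ ρ ξ)
    (hρ : ∀ ξ, 0 < ξ → ρ ξ ^ 2 * ε ^ 3 * ξ ^ 2 = R * ξ ^ k) (φ : L2R) :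
    |bondForm ε (lawStress P ε X) φ - bondForm ε (lawStress P ε Y) φ| ≤
      R * moment γ k * ‖X - Y‖ * ‖φ‖ := by
  have hXi := (h.law hε X).integrableOn hε.le φ
  have hYi := (h.law hε Y).integrableOn hε.le φ
  rw [bondForm, bondForm, ← integral_sub hXi hYi,
    show R * moment γ k * ‖X - Y‖ * ‖φ‖ = R * ‖X - Y‖ * ‖φ‖ * moment γ k by ring, moment,
    ← integral_const_mul, ← Real.norm_eq_abs]
  refine norm_integral_le_of_norm_le (hk.const_mul _) ?_
  obtain ⟨-, GX, -, hGX⟩ := h.law hε X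
  obtain ⟨-, GY, -, hGY⟩ := h.law hε Y
  filter_upwards [ae_restrict_mem measurableSet_Ioi] with ξ hξ
  have hξ' : 0 < ξ := hξ
  have hη : 0 ≤ ε * ξ := by positivity
  rw [← integral_sub ((hGX ξ hξ).2.integrable_mul (L2Bound.bond hη φ))
    ((hGY ξ hξ).2.integrable_mul (L2Bound.bond hη φ))]
  simp_rw [← sub_mul]
  refine (abs_integral_lawStress_sub_le h.cont h.gamma_nonneg h.lipschitz hε hξ'
    (fun x => hX ξ x hξ') (fun x => hY ξ x hξ') φ).trans (le_of_eq ?_)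
  linear_combination (γ ξ * ‖X - Y‖ * ‖φ‖) * hρ ξ hξ'

theorem GlobalLaw.norm_lawVec_sub_le (h : GlobalLaw α β γ P) {ε R : ℝ} (hε : 0 < ε) {X Y : L2R}
    (hX : ‖X‖ ≤ R) (hY : ‖Y‖ ≤ R) :
    ‖lawVec P ε X - lawVec P ε Y‖ ≤ ε * R ^ 2 * moment γ 3 * ‖X - Y‖ := by
  have hγ : 0 ≤ moment γ 3 := setIntegral_nonneg measurableSet_Ioi fun ξ hξ =>
    mul_nonneg (h.gamma_nonneg ξ hξ) (pow_nonneg (le_of_lt hξ) _)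
  have hb : ∀ V : L2R, ‖V‖ ≤ R → ∀ ξ x, 0 < ξ →
      |ε * bond (ε * ξ) V x| ≤ ε * (Real.sqrt (ε * ξ) * R) := fun V hV ξ x hξ => by
    rw [abs_mul, abs_of_pos hε]
    have := abs_bond_le (by positivity : 0 ≤ ε * ξ) V x
    gcongr
    exact this.trans (by gcongr)
  refine norm_le_of_abs_inner_le (by positivity) fun φ => ?_
  rw [inner_sub_left, h.inner_lawVec hε, h.inner_lawVec hε, ← mul_sub, abs_mul,
    abs_of_pos (by positivity : 0 < (ε ^ 5)⁻¹)]
  have := h.abs_bondForm_lawStress_sub_le (R := ε ^ 6 * R ^ 2) hε h.gamma_three (hb X hX) (hb Y hY)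
    (fun ξ hξ => by
      rw [mul_pow, mul_pow, Real.sq_sqrt (by positivity)]; ring) φ
  calc _ ≤ (ε ^ 5)⁻¹ * (ε ^ 6 * R ^ 2 * moment γ 3 * ‖X - Y‖ * ‖φ‖) := by gcongr
    _ = _ := by field_simp

theorem GlobalLaw.abs_inner_lawVec_le_of_bounded (h : GlobalLaw α β γ P) {ε b : ℝ} (hε : 0 < ε)
    (hb : 0 ≤ b) {X : L2R} (hX : ∀ᵐ x, |X x| ≤ b) (φ : L2R) :
    |inner ℝ (lawVec P ε X) φ| ≤ ε ^ 2 * b ^ 2 * moment γ 4 * ‖X‖ * ‖φ‖ := by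
  have h0 : ∀ η x, bond η (0 : L2R) x = 0 := fun η x => by
    have := bond_smul η 0 (0 : L2R) x
    rwa [zero_smul, zero_mul] at this
  have e0 : bondForm ε (lawStress P ε 0) φ = 0 := by
    rw [bondForm]
    refine setIntegral_eq_zero_of_forall_eq_zero fun ξ hξ => ?_
    simp_rw [lawStress, h0, mul_zero, h.zero ξ hξ, zero_mul, integral_zero]
  have := h.abs_bondForm_lawStress_sub_le (R := ε ^ 7 * b ^ 2) (X := X) (Y := 0)
    (ρ := fun ξ => ε * (ε * ξ * b)) hε h.gamma_four
    (fun ξ x hξ => by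
      rw [abs_mul, abs_of_pos hε]
      gcongr
      exact abs_bond_le_of_ae_le (by positivity) hX x)
    (fun ξ x hξ => by rw [h0, mul_zero, abs_zero]; positivity)
    (fun ξ hξ => by ring) φ
  rw [e0, sub_zero, sub_zero] at this
  rw [h.inner_lawVec hε, abs_mul, abs_of_pos (by positivity : 0 < (ε ^ 5)⁻¹)]
  calc _ ≤ (ε ^ 5)⁻¹ * (ε ^ 7 * b ^ 2 * moment γ 4 * ‖X‖ * ‖φ‖) := by gcongr
    _ = _ := by field_simp

end Peridynamics

/-! ### Linearization and residual at the soliton -/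

namespace Peridynamics

variable {α β γ : ℝ → ℝ} {P : ℝ → ℝ → ℝ}

theorem exists_solvesWave (hα : ∀ ξ, 0 < ξ → 0 ≤ α ξ)
    (h2 : IntegrableOn (fun ξ => α ξ * ξ ^ 2) (Ioi 0)) {ε : ℝ} (hε : 0 < ε) (V : L2R) :
    ∃ g, SolvesWave α ε V g := by
  refine ⟨((ε ^ 2)⁻¹ * (moment α 2 + ε ^ 2)) • V - (ε ^ 4)⁻¹ • bondVec ε (stiffStress α ε V),
    fun φ => ?_⟩
  rw [waveForm_eq hα h2 hε, inner_sub_left, inner_smul_left, inner_smul_left,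
    (stiffStress_admissible hα h2 hε V).inner_bondVec hε.le, RCLike.conj_to_real,
    RCLike.conj_to_real]
  ring

theorem SolvesWave.sub {ε : ℝ} (hα : ∀ ξ, 0 < ξ → 0 ≤ α ξ)
    (h2 : IntegrableOn (fun ξ => α ξ * ξ ^ 2) (Ioi 0)) (hε : 0 < ε) {V W f g : L2R}
    (hV : SolvesWave α ε V f) (hW : SolvesWave α ε W g) : SolvesWave α ε (V - W) (f - g) := by
  obtain ⟨S, hS⟩ := exists_waveInverse hα h2 hε
  rw [hS] at *
  rw [map_sub, hV, hW]

theorem SolvesWave.refl {ε : ℝ} (hα : ∀ ξ, 0 < ξ → 0 ≤ α ξ)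
    (h2 : IntegrableOn (fun ξ => α ξ * ξ ^ 2) (Ioi 0)) (hε : 0 < ε) {V f : L2R}
    (h : SolvesWave α ε V f) : SolvesWave α ε (refl V) (refl f) := by
  intro φ
  have := h (Peridynamics.refl φ)
  rw [waveForm_eq hα h2 hε] at this ⊢
  rw [inner_refl_left, inner_refl_left, ← this,
    bondForm_refl (g := stiffStress α ε V) (g' := stiffStress α ε (Peridynamics.refl V))
      (fun ξ x _ => by rw [stiffStress, stiffStress, bond_refl])]

theorem GlobalLaw.refl_nonlin (h : GlobalLaw α β γ P) {ε : ℝ} (hε : 0 < ε) (W : L2R) :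
    refl (nonlin β P ε W) = nonlin β P ε (refl W) := by
  refine ext_inner_right ℝ fun φ => ?_
  rw [inner_refl_left, nonlin, nonlin, inner_add_left, inner_add_left, h.inner_quadVec hε,
    h.inner_quadVec hε, h.inner_lawVec hε, h.inner_lawVec hε,
    bondForm_refl (g := quadStress β ε W W) (g' := quadStress β ε (refl W) (refl W))
      (fun ξ x _ => by rw [quadStress, quadStress, bond_refl]),
    bondForm_refl (g := lawStress P ε W) (g' := lawStress P ε (refl W))
      (fun ξ x _ => by rw [lawStress, lawStress, bond_refl])]

theorem solitonLp_coe {κ q : ℝ} (hκ : 0 < κ) (hq : 0 < q) :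
    solitonLp hκ hq =ᵐ[volume] soliton κ q := (memLp_soliton hκ hq).coeFn_toLp

theorem abs_solitonLp_le {κ q : ℝ} (hκ : 0 < κ) (hq : 0 < q) :
    ∀ᵐ x, |solitonLp hκ hq x| ≤ 3 / (2 * q) := by
  filter_upwards [solitonLp_coe hκ hq] with x hx
  rw [hx]; exact abs_soliton_le hq κ x

theorem refl_solitonLp {κ q : ℝ} (hκ : 0 < κ) (hq : 0 < q) :
    refl (solitonLp hκ hq) = solitonLp hκ hq := by
  apply Lp.ext
  filter_upwards [refl_coe (solitonLp hκ hq), ae_comp_neg (solitonLp_coe hκ hq),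
    solitonLp_coe hκ hq] with x h1 h2 h3
  rw [h1, h2, h3, soliton, soliton, sechSq_neg]

/-- In the long-wave limit, the quadratic nonlinearity linearized at the soliton becomes a
multiplication operator. -/
theorem GlobalLaw.norm_green_quadVec_soliton_sub_le (h : GlobalLaw α β γ P) {κ : ℝ}
    (hκ : 0 < κ) :
    ∃ C > 0, ∀ ε > 0, ∀ Z, ‖green κ (quadVec β ε (solitonLp hκ h.beta_three_pos) Z) -
      green κ (moment β 3 • solitonMul κ h.beta_three_pos Z)‖ ≤ C * ε * ‖Z‖ := by
  have hq := h.beta_three_pos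
  set a := 3 / (2 * moment β 3) with ha
  have ha0 : 0 < a := by positivity
  have hβ4 : 0 ≤ moment β 4 := setIntegral_nonneg measurableSet_Ioi fun ξ hξ =>
    mul_nonneg (h.beta_nonneg ξ hξ) (pow_nonneg (le_of_lt hξ) _)
  refine ⟨2 * (a * κ + a * κ) * moment β 4 + 1, by positivity, fun ε hε Z => ?_⟩
  refine norm_le_of_abs_inner_le (by positivity) fun φ => ?_
  rw [inner_sub_left, inner_green_left hκ, inner_green_left hκ, h.inner_quadVec hε,
    inner_smul_left, RCLike.conj_to_real, solitonMul, inner_mulOp]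
  refine (h.abs_bondForm_quadStress_sub_le hε h.beta_four
    (C := 2 * (a * κ + a * κ) * ‖Z‖ * ‖φ‖) fun η hη => ?_).trans ?_
  · refine (abs_integral_bond_triple_sub_le (solitonLp_coe hκ hq) (continuous_soliton _ _)
      ha0.le (by positivity) (abs_soliton_le hq κ) (abs_soliton_sub_le hκ hq) hκ hη Z φ).trans
      (le_of_eq ?_)
    ring
  · rw [show (ε ^ 3)⁻¹ * (2 * (a * κ + a * κ) * ‖Z‖ * ‖φ‖ * ε ^ 4 * moment β 4) =
      2 * (a * κ + a * κ) * moment β 4 * ε * ‖Z‖ * ‖φ‖ by field_simp]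
    gcongr
    linarith

/-- The defining estimate of the linearization: in the ball of radius `r` around the soliton, the
reduced nonlinearity differs from its linearization by a small Lipschitz constant. -/
theorem GlobalLaw.exists_linearization (h : GlobalLaw α β γ P) {κ : ℝ} (hκ : 0 < κ)
    (hκα : κ ^ 2 * moment α 4 = 12) :
    ∃ C > 0, ∀ ε > 0, ε ≤ 1 → ∀ r, 0 ≤ r → r ≤ 1 → ∀ X Y V : L2R,
      ‖X - solitonLp hκ h.beta_three_pos‖ ≤ r → ‖Y - solitonLp hκ h.beta_three_pos‖ ≤ r →
      SolvesWave α ε V (nonlin β P ε X - nonlin β P ε Y) →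
      ‖V - kdvLin κ h.beta_three_pos (X - Y)‖ ≤ C * (ε + r) * ‖X - Y‖ := by
  have hq := h.beta_three_pos
  set W₀ := solitonLp hκ h.beta_three_pos with hW0
  obtain ⟨C₁, hC₁, hS⟩ := SolvesWave.exists_norm_sub_green_le h.alpha_nonneg h.alpha_two
    h.alpha_four h.alpha_six h.alpha_two_pos hκ hκα
  obtain ⟨C₂, hC₂, hG⟩ := h.norm_green_quadVec_soliton_sub_le hκ
  set b52 := ∫ ξ in Ioi (0 : ℝ), β ξ * ξ ^ (5 / 2 : ℝ) with hb52
  have hb52' : 0 ≤ b52 := setIntegral_nonneg measurableSet_Ioi fun ξ hξ =>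
    mul_nonneg (h.beta_nonneg ξ hξ) (Real.rpow_nonneg (le_of_lt hξ) _)
  have hγ3 : 0 ≤ moment γ 3 := setIntegral_nonneg measurableSet_Ioi fun ξ hξ =>
    mul_nonneg (h.gamma_nonneg ξ hξ) (pow_nonneg (le_of_lt hξ) _)
  set R := ‖W₀‖ + 1 with hR
  set K₁ := 2 * C₁ * (3 / 2) + 2 * C₂ + R ^ 2 * moment γ 3 with hK₁
  set K₂ := 2 * (moment β 3 * ‖greenKernelLp hκ‖) + 2 * C₁ * b52 with hK₂
  have hR0 : 0 ≤ R := by positivity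
  refine ⟨K₁ + K₂, by positivity, fun ε hε hε1 r hr0 hr1 X Y V hX hY hV => ?_⟩
  obtain ⟨S, hSiff⟩ := exists_waveInverse h.alpha_nonneg h.alpha_two hε
  have hSle : ∀ f, ‖S f‖ ≤ ‖f‖ := fun f => ((hSiff _ f).2 rfl).norm_le h.alpha_nonneg hε
  have hSg : ∀ f, ‖S f - green κ f‖ ≤ C₁ * ε * ‖f‖ := fun f => hS ε hε _ f ((hSiff _ f).2 rfl)
  set Z := X - Y with hZ
  set E := (X - W₀) + (Y - W₀) with hE
  have hEn : ‖E‖ ≤ 2 * r := (norm_add_le _ _).trans (by linarith)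
  have hXR : ‖X‖ ≤ R := by
    have := norm_add_le (X - W₀) W₀
    rw [sub_add_cancel] at this
    linarith
  have hYR : ‖Y‖ ≤ R := by
    have := norm_add_le (Y - W₀) W₀
    rw [sub_add_cancel] at this
    linarith
  -- Polarization around the soliton: the first term converges to the linearization, the second is
  -- small because `E` is at most `2r`, and the third carries an explicit factor `ε`.
  have eV : V = (2 : ℝ) • S (quadVec β ε W₀ Z) + S (quadVec β ε E Z) +
      S (lawVec P ε X - lawVec P ε Y) := by
    rw [(hSiff _ _).1 hV, nonlin, nonlin, add_sub_add_comm, h.quadVec_sub hε W₀, map_add, map_add,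
      map_smul]
  have eT : kdvLin κ h.beta_three_pos Z =
      (2 : ℝ) • green κ (moment β 3 • solitonMul κ h.beta_three_pos Z) := by
    rw [kdvLin_apply, ← map_smul (green κ) (2 : ℝ), smul_smul]
  have n1 : ‖S (quadVec β ε W₀ Z) - green κ (moment β 3 • solitonMul κ h.beta_three_pos Z)‖ ≤
      (C₁ * (3 / 2) + C₂) * ε * ‖Z‖ := by
    have hb : ‖quadVec β ε W₀ Z‖ ≤ 3 / 2 * ‖Z‖ := by
      refine (h.norm_quadVec_le_of_bounded hε (by positivity) (abs_solitonLp_le hκ hq) Z).trans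
        (le_of_eq ?_)
      field_simp
    calc _ ≤ ‖S (quadVec β ε W₀ Z) - green κ (quadVec β ε W₀ Z)‖ + ‖green κ (quadVec β ε W₀ Z) -
          green κ (moment β 3 • solitonMul κ h.beta_three_pos Z)‖ := norm_sub_le_norm_sub_add_norm_sub _ _ _
      _ ≤ C₁ * ε * (3 / 2 * ‖Z‖) + C₂ * ε * ‖Z‖ := by
        gcongr
        · exact (hSg _).trans (by gcongr)
        · exact hG ε hε Z
      _ = _ := by ring
  -- Neither `S` nor the quadratic term alone suffices here. Writing `S = (S - green κ) + green κ`,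
  -- the first part gains `ε` against a loss of `ε^{-1/2}`, and the second is uniformly bounded by
  -- the `L^∞` smoothing of `green κ`.
  have n2 : ‖S (quadVec β ε E Z)‖ ≤ K₂ * r * ‖Z‖ := by
    have hsq : Real.sqrt ε * Real.sqrt ε = ε := Real.mul_self_sqrt hε.le
    have hs1 : Real.sqrt ε ≤ 1 := Real.sqrt_le_one.2 hε1
    have hg := h.norm_green_quadVec_le hκ hε E Z
    have hqv := h.norm_quadVec_le hε E Z
    have h3 : C₁ * ε * ‖quadVec β ε E Z‖ ≤ C₁ * (b52 * ‖E‖ * ‖Z‖) := by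
      calc C₁ * ε * ‖quadVec β ε E Z‖
          = C₁ * (Real.sqrt ε * (Real.sqrt ε * ‖quadVec β ε E Z‖)) := by
            rw [← mul_assoc (Real.sqrt ε), hsq]; ring
        _ ≤ C₁ * (1 * (b52 * ‖E‖ * ‖Z‖)) := by gcongr
        _ = _ := by ring
    calc ‖S (quadVec β ε E Z)‖
        = ‖(S (quadVec β ε E Z) - green κ (quadVec β ε E Z)) + green κ (quadVec β ε E Z)‖ := by
          rw [sub_add_cancel]
      _ ≤ C₁ * (b52 * ‖E‖ * ‖Z‖) + moment β 3 * ‖greenKernelLp hκ‖ * ‖E‖ * ‖Z‖ :=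
          (norm_add_le _ _).trans (add_le_add ((hSg _).trans h3) hg)
      _ = (C₁ * b52 + moment β 3 * ‖greenKernelLp hκ‖) * ‖E‖ * ‖Z‖ := by ring
      _ ≤ (C₁ * b52 + moment β 3 * ‖greenKernelLp hκ‖) * (2 * r) * ‖Z‖ := by gcongr
      _ = _ := by rw [hK₂]; ring
  have n3 : ‖S (lawVec P ε X - lawVec P ε Y)‖ ≤ R ^ 2 * moment γ 3 * ε * ‖Z‖ :=
    (hSle _).trans ((h.norm_lawVec_sub_le hε hXR hYR).trans (le_of_eq (by ring)))
  have e : V - kdvLin κ h.beta_three_pos Z =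
      (2 : ℝ) • (S (quadVec β ε W₀ Z) - green κ (moment β 3 • solitonMul κ h.beta_three_pos Z)) +
        S (quadVec β ε E Z) + S (lawVec P ε X - lawVec P ε Y) := by
    rw [eV, eT]; module
  rw [e]
  calc _ ≤ 2 * ((C₁ * (3 / 2) + C₂) * ε * ‖Z‖) + K₂ * r * ‖Z‖ +
        R ^ 2 * moment γ 3 * ε * ‖Z‖ := by
        refine (norm_add₃_le).trans ?_
        rw [norm_smul, Real.norm_of_nonneg zero_le_two]
        gcongr
    _ = (K₁ * ε + K₂ * r) * ‖Z‖ := by rw [hK₁]; ring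
    _ ≤ (K₁ + K₂) * (ε + r) * ‖Z‖ := by
        have h1 : 0 ≤ K₁ := by positivity
        have h2 : 0 ≤ K₂ := by positivity
        gcongr
        nlinarith [mul_nonneg h1 hr0, mul_nonneg h2 hε.le]

/-- Functions in the range of the resolvent have a second derivative in `L²`, so their symmetric
differences are quadratic; the Taylor remainder contributes 2 and the second order term 1 to the
constant 3. -/
theorem norm_symTr_green_sub_le_sq {κ : ℝ} (hκ : 0 < κ) (V : L2R) {t : ℝ} (ht : 0 ≤ t) :
    ‖symTr t (green κ V) - green κ V‖ ≤ 3 * κ ^ 2 * ‖V‖ * t ^ 2 := by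
  have hg : ‖green κ V - V‖ ≤ 2 * ‖V‖ := (norm_sub_le _ _).trans (by
    linarith [norm_green_le hκ V])
  have hst : ∀ s, ‖symTr s V - V‖ ≤ 2 * ‖V‖ := fun s =>
    (norm_symTr_sub_le s V).trans ((norm_sub_le _ _).trans (by rw [norm_tr]; linarith))
  have h1 := norm_symTr_green_sub_le (M := 4 * κ ^ 2 * ‖V‖) (h := t) hκ 0 V (fun s _ _ => by
    refine (norm_symTr_greenDefect_sub_le hκ s V).trans ?_
    rw [pow_zero, mul_one]
    calc 2 * κ ^ 2 * ‖symTr s V - V‖ ≤ 2 * κ ^ 2 * (2 * ‖V‖) := by gcongr; exact hst s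
      _ = _ := by ring) t ht le_rfl
  have h2 : ‖(t ^ 2 / 2) • κ ^ 2 • (green κ V - V)‖ ≤ t ^ 2 / 2 * (κ ^ 2 * (2 * ‖V‖)) := by
    rw [norm_smul, norm_smul, Real.norm_of_nonneg (by positivity),
      Real.norm_of_nonneg (by positivity)]
    gcongr
  have h3 := norm_add_le (symTr t (green κ V) - green κ V - (t ^ 2 / 2) • κ ^ 2 • (green κ V - V))
    ((t ^ 2 / 2) • κ ^ 2 • (green κ V - V))
  rw [sub_add_cancel] at h3
  norm_num at h1
  linarith

/-- The soliton solves the rescaled equation up to an error of order `ε²`. -/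
theorem GlobalLaw.exists_residual (h : GlobalLaw α β γ P) {κ : ℝ} (hκ : 0 < κ)
    (hκα : κ ^ 2 * moment α 4 = 12) :
    ∃ C > 0, ∀ ε > 0, ∀ V : L2R,
      SolvesWave α ε V (nonlin β P ε (solitonLp hκ h.beta_three_pos)) →
      ‖solitonLp hκ h.beta_three_pos - V‖ ≤ C * ε ^ 2 := by
  have hq := h.beta_three_pos
  set q := moment β 3 with hqdef
  set W₀ := solitonLp hκ h.beta_three_pos with hW0
  set w₂ := solitonSqLp hκ h.beta_three_pos with hw2
  set a := 3 / (2 * q) with ha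
  have ha0 : 0 < a := by positivity
  have hW : green κ (q • w₂) = W₀ := green_solitonSqLp hκ hq
  obtain ⟨y, hy⟩ := exists_green_eq_solitonSqLp hκ hq
  have hy' : q • w₂ = green κ (q • y) := by rw [map_smul, ← hy]
  have hα6 : 0 ≤ moment α 6 := setIntegral_nonneg measurableSet_Ioi fun ξ hξ =>
    mul_nonneg (h.alpha_nonneg ξ hξ) (pow_nonneg (le_of_lt hξ) _)
  have hβ5 : 0 ≤ moment β 5 := setIntegral_nonneg measurableSet_Ioi fun ξ hξ =>
    mul_nonneg (h.beta_nonneg ξ hξ) (pow_nonneg (le_of_lt hξ) _)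
  have hγ4 : 0 ≤ moment γ 4 := setIntegral_nonneg measurableSet_Ioi fun ξ hξ =>
    mul_nonneg (h.gamma_nonneg ξ hξ) (pow_nonneg (le_of_lt hξ) _)
  -- Since `W₀ = green κ (q • w₂)` and `q • w₂` is again a resolvent, the second derivative of `W₀`
  -- has quadratic symmetric differences. The Taylor remainder is then at most `M u⁴ / 12`.
  set M := 2 * κ ^ 2 * (3 * κ ^ 2 * ‖q • y‖) with hM
  set M₁ := 3 * κ ^ 2 * ‖q • w₂‖ with hM1
  set M₂ := 3 * κ ^ 2 * ‖y‖ with hM2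
  have hs : ∀ t, 0 ≤ t → ‖symTr t W₀ - W₀‖ ≤ M₁ * t ^ 2 := fun t ht => by
    rw [← hW]; exact norm_symTr_green_sub_le_sq hκ _ ht
  have hs2 : ∀ t, 0 ≤ t → ‖symTr t w₂ - w₂‖ ≤ M₂ * t ^ 2 := fun t ht => by
    rw [hw2, hy]; exact norm_symTr_green_sub_le_sq hκ _ ht
  set K := M / 12 * moment α 6 + (2 * a * M₁ + M₂) * moment β 5 + a ^ 2 * moment γ 4 * ‖W₀‖ with hK
  refine ⟨K + 1, by positivity, fun ε hε V hV => ?_⟩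
  -- Let `g` be the wave operator applied to `W₀`. The inverse has norm at most one, so it is enough
  -- to bound `g` minus the nonlinearity. The linear part, the quadratic part and the higher order
  -- law each contribute `ε²`, through the moments `α` 6, `β` 5 and `γ` 4.
  obtain ⟨g, hg⟩ := exists_solvesWave h.alpha_nonneg h.alpha_two hε W₀
  refine ((hg.sub h.alpha_nonneg h.alpha_two hε hV).norm_le h.alpha_nonneg hε).trans ?_
  suffices h' : ‖g - nonlin β P ε W₀‖ ≤ K * ε ^ 2 from h'.trans (by gcongr; linarith)
  refine norm_le_of_abs_inner_le (by positivity) fun φ => ?_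
  have n1 : |waveForm α ε W₀ φ - inner ℝ (q • w₂) φ| ≤ M / 12 * moment α 6 * ε ^ 2 * ‖φ‖ := by
    have e : ∀ ξ, α ξ * (ξ ^ 2 * (M / 12 * (ε * ξ) ^ 4)) = M / 12 * ε ^ 4 * (α ξ * ξ ^ 6) := by
      intro ξ; ring
    have := abs_waveForm_green_sub_le h.alpha_nonneg h.alpha_two h.alpha_four hκα hε (q • w₂) φ
      (B := fun ξ => M / 12 * (ε * ξ) ^ 4)
      (by simp_rw [e]; exact h.alpha_six.const_mul _) (fun ξ hξ u hu0 hu => by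
        have hgd := norm_symTr_green_sub_le (M := M) (h := ε * ξ) hκ 2 (q • w₂) (fun s hs0 _ => by
          refine (norm_symTr_greenDefect_sub_le hκ s _).trans ?_
          rw [hM, mul_assoc (2 * κ ^ 2)]
          gcongr
          rw [hy']
          exact norm_symTr_green_sub_le_sq hκ _ hs0) u hu0 hu
        refine hgd.trans ?_
        norm_num
        rw [div_div]
        norm_num
        gcongr)
    rw [hW] at this
    refine this.trans (le_of_eq ?_)
    simp_rw [e, integral_const_mul]
    rw [← moment]
    field_simp
  have n2 : |(ε ^ 3)⁻¹ * bondForm ε (quadStress β ε W₀ W₀) φ - inner ℝ (q • w₂) φ| ≤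
      (2 * a * M₁ + M₂) * moment β 5 * ε ^ 2 * ‖φ‖ := by
    have := h.abs_bondForm_quadStress_sub_le hε h.beta_five (V := W₀) (W := W₀) (φ := φ)
      (I := inner ℝ w₂ φ) (C := (2 * a * M₁ + M₂) * ‖φ‖) (fun η hη => by
        refine (abs_integral_bond_sq_sub_le (solitonLp_coe hκ hq)
          (memLp_soliton_sq hκ hq).coeFn_toLp ha0.le (abs_soliton_le hq κ) (by positivity)
          (by positivity) hs hs2 hη φ).trans (le_of_eq (by ring)))
    rw [inner_smul_left, RCLike.conj_to_real]
    refine this.trans (le_of_eq ?_)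
    field_simp
  have n3 := h.abs_inner_lawVec_le_of_bounded hε ha0.le (abs_solitonLp_le hκ hq) φ
  rw [inner_sub_left, ← hg φ, nonlin, inner_add_left, h.inner_quadVec hε]
  have e : waveForm α ε W₀ φ - ((ε ^ 3)⁻¹ * bondForm ε (quadStress β ε W₀ W₀) φ +
      inner ℝ (lawVec P ε W₀) φ) = (waveForm α ε W₀ φ - inner ℝ (q • w₂) φ) -
      ((ε ^ 3)⁻¹ * bondForm ε (quadStress β ε W₀ W₀) φ - inner ℝ (q • w₂) φ) -
      inner ℝ (lawVec P ε W₀) φ := by ring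
  rw [e]
  refine (abs_sub _ _).trans ?_
  have n4 := abs_sub (waveForm α ε W₀ φ - inner ℝ (q • w₂) φ)
    ((ε ^ 3)⁻¹ * bondForm ε (quadStress β ε W₀ W₀) φ - inner ℝ (q • w₂) φ)
  have e2 : K * ε ^ 2 * ‖φ‖ = M / 12 * moment α 6 * ε ^ 2 * ‖φ‖ +
      (2 * a * M₁ + M₂) * moment β 5 * ε ^ 2 * ‖φ‖ + ε ^ 2 * a ^ 2 * moment γ 4 * ‖W₀‖ * ‖φ‖ := by
    rw [hK]; ring
  rw [e2]
  linarith

end Peridynamics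

/-! ### Existence and local uniqueness -/

namespace Peridynamics

variable {α β γ : ℝ → ℝ} {P : ℝ → ℝ → ℝ}

/-- A map close to an invertible linear map on a ball has exactly one zero there, located near the
centre if the value at the centre is small. -/
theorem exists_zero_of_approximates_equiv {E : Type*} [NormedAddCommGroup E] [NormedSpace ℝ E]
    [CompleteSpace E] (L : E ≃L[ℝ] E) :
    ∃ c > 0, ∃ K > 0, ∀ (f : E → E) (b : E) (δ : ℝ),
      (∀ x y, ‖x - b‖ ≤ δ → ‖y - b‖ ≤ δ → ‖f x - f y - L (x - y)‖ ≤ c * ‖x - y‖) →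
      (∀ x y, ‖x - b‖ ≤ δ → ‖y - b‖ ≤ δ → f x = f y → x = y) ∧
      ∀ r, 0 ≤ r → r ≤ δ → K * ‖f b‖ ≤ r → ∃ x, ‖x - b‖ ≤ r ∧ f x = 0 := by
  set N : NNReal := ‖(L.symm : E →L[ℝ] E)‖₊ + 1 with hN
  have hN0 : 0 < N := by positivity
  have hle : ∀ x, ‖L.symm x‖ ≤ N * ‖x‖ := fun x =>
    ((L.symm : E →L[ℝ] E).le_opNorm x).trans (by rw [hN]; push_cast; gcongr; simp)
  refine ⟨(N : ℝ)⁻¹ / 2, by positivity, 2 * N, by positivity, fun f b δ hf => ⟨?_, ?_⟩⟩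
  · intro x y hx hy hxy
    have h1 := hf x y hx hy
    rw [hxy, sub_self, zero_sub, norm_neg] at h1
    have h2 := hle (L (x - y))
    rw [L.symm_apply_apply] at h2
    have h3 : (N : ℝ) * ‖L (x - y)‖ ≤ N * ((N : ℝ)⁻¹ / 2 * ‖x - y‖) := by gcongr
    have h4 : (N : ℝ) * ((N : ℝ)⁻¹ / 2 * ‖x - y‖) = ‖x - y‖ / 2 := by
      have : (N : ℝ) ≠ 0 := by positivity
      field_simp
    have h5 : ‖x - y‖ = 0 := by linarith [norm_nonneg (x - y)]
    exact sub_eq_zero.1 (norm_eq_zero.1 h5)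
  · intro r hr0 hrδ hr
    let Linv : (L : E →L[ℝ] E).NonlinearRightInverse :=
      { toFun := L.symm
        nnnorm := N
        bound' := hle
        right_inv' := L.apply_symm_apply }
    have happ : ApproximatesLinearOn f (L : E →L[ℝ] E) (Metric.closedBall b r) (N⁻¹ / 2) :=
      fun x hx y hy => by
        rw [NNReal.coe_div, NNReal.coe_inv]
        exact hf x y ((mem_closedBall_iff_norm.1 hx).trans hrδ)
          ((mem_closedBall_iff_norm.1 hy).trans hrδ)
    have hsurj := happ.surjOn_closedBall_of_nonlinearRightInverse Linv hr0 subset_rfl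
    -- The image of the ball of radius `r` contains a ball of radius `(N⁻¹ - N⁻¹/2) r = r/(2N)`
    -- around `f b`, which explains the constant `K = 2N`.
    have h0 : (0 : E) ∈ Metric.closedBall (f b) (((Linv.nnnorm : ℝ)⁻¹ - (N⁻¹ / 2 : NNReal)) * r) := by
      rw [mem_closedBall_iff_norm, zero_sub, norm_neg]
      change ‖f b‖ ≤ ((N : ℝ)⁻¹ - (N⁻¹ / 2 : NNReal)) * r
      push_cast
      have hN' : (0 : ℝ) < N := by positivity
      have e : ((N : ℝ)⁻¹ - (N : ℝ)⁻¹ / 2) * r = r / (2 * N) := by field_simp; ring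
      rw [e, le_div_iff₀ (by positivity)]
      linarith
    obtain ⟨x, hx, hfx⟩ := hsurj h0
    exact ⟨x, mem_closedBall_iff_norm.1 hx, hfx⟩

/-- Existence and local uniqueness of even solutions close to the soliton. -/
theorem GlobalLaw.exists_solution (h : GlobalLaw α β γ P) {κ : ℝ} (hκ : 0 < κ)
    (hκα : κ ^ 2 * moment α 4 = 12) :
    ∃ ε₀ > 0, ε₀ ≤ 1 ∧ ∃ δ > 0, δ ≤ 1 ∧ ∃ C > 0, ∀ ε, 0 < ε → ε ≤ ε₀ →
      ∃ W : L2R, refl W = W ∧ SolvesWave α ε W (nonlin β P ε W) ∧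
        ‖W - solitonLp hκ h.beta_three_pos‖ ≤ δ ∧
        ‖W - solitonLp hκ h.beta_three_pos‖ ≤ C * ε ^ 2 ∧
        ∀ W' : L2R, refl W' = W' → SolvesWave α ε W' (nonlin β P ε W') →
          ‖W' - solitonLp hκ h.beta_three_pos‖ ≤ δ → W' = W := by
  set W₀ := solitonLp hκ h.beta_three_pos with hW0
  obtain ⟨L, hL⟩ := exists_equiv_one_sub_kdvLin hκ h.beta_three_pos
  obtain ⟨c, hc, K, hK, hzero⟩ := exists_zero_of_approximates_equiv L
  obtain ⟨C₁, hC₁, hlin⟩ := h.exists_linearization hκ hκα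
  obtain ⟨C₂, hC₂, hres⟩ := h.exists_residual hκ hκα
  -- The radii are chosen so that `C₁ (ε + δ) ≤ c`, the closeness to `L` that the inverse theorem
  -- needs, and `K C₂ ε² ≤ δ`, which keeps the solution in the ball.
  set δ := min 1 (c / (2 * C₁)) with hδ
  have hδ0 : 0 < δ := lt_min one_pos (by positivity)
  set ε₀ := min (min 1 (c / (2 * C₁))) (δ / (K * C₂)) with hε₀
  refine ⟨ε₀, lt_min (lt_min one_pos (by positivity)) (by positivity),
    (min_le_left _ _).trans (min_le_left _ _), δ, hδ0, min_le_left _ _, K * C₂, by positivity,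
    fun ε hε hεε => ?_⟩
  have hε1 : ε ≤ 1 := hεε.trans ((min_le_left _ _).trans (min_le_left _ _))
  have hεc : ε ≤ c / (2 * C₁) := hεε.trans ((min_le_left _ _).trans (min_le_right _ _))
  have hεδ : ε ≤ δ / (K * C₂) := hεε.trans (min_le_right _ _)
  have hδc : δ ≤ c / (2 * C₁) := min_le_right _ _
  have hεδ' : K * (C₂ * ε ^ 2) ≤ δ := by
    rw [le_div_iff₀ (by positivity)] at hεδ
    have : ε ^ 2 ≤ ε := by nlinarith
    calc K * (C₂ * ε ^ 2) ≤ K * (C₂ * ε) := by gcongr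
      _ ≤ δ := by linarith
  obtain ⟨S, hS⟩ := exists_waveInverse h.alpha_nonneg h.alpha_two hε
  have hP0 : evenPart W₀ = W₀ := evenPart_of_even (refl_solitonLp hκ _)
  have hPball : ∀ X r, ‖X - W₀‖ ≤ r → ‖evenPart X - W₀‖ ≤ r := fun X r hX => by
    rw [← hP0, ← map_sub]
    exact (norm_evenPart_le _).trans hX
  -- The even projection inside `f` makes the linearization invertible on all of `L²`. No solutions
  -- are lost or added: an even solution is a zero of `f`, and a zero is even because the
  -- nonlinearity and the linear solver both respect reflection.
  set f : L2R → L2R := fun W => W - S (nonlin β P ε (evenPart W)) with hf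
  have happ : ∀ X Y, ‖X - W₀‖ ≤ δ → ‖Y - W₀‖ ≤ δ → ‖f X - f Y - L (X - Y)‖ ≤ c * ‖X - Y‖ := by
    intro X Y hX hY
    have h1 := hlin ε hε hε1 δ hδ0.le (min_le_left _ _) (evenPart X) (evenPart Y)
      (S (nonlin β P ε (evenPart X) - nonlin β P ε (evenPart Y))) (hPball X δ hX) (hPball Y δ hY)
      ((hS _ _).2 rfl)
    rw [← map_sub] at h1
    have e : f X - f Y - L (X - Y) =
        -(S (nonlin β P ε (evenPart X) - nonlin β P ε (evenPart Y)) -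
          kdvLin κ h.beta_three_pos (evenPart (X - Y))) := by
      rw [hL, map_sub S]
      simp only [hf]
      abel
    rw [e, norm_neg]
    refine h1.trans ?_
    have h2 : C₁ * (ε + δ) ≤ c := by
      have h3 : ε + δ ≤ c / C₁ := by
        calc ε + δ ≤ c / (2 * C₁) + c / (2 * C₁) := by gcongr
          _ = c / C₁ := by field_simp; norm_num
      rw [le_div_iff₀ hC₁] at h3
      linarith
    exact mul_le_mul h2 (norm_evenPart_le _) (norm_nonneg _) hc.le
  obtain ⟨hinj, hex⟩ := hzero f W₀ δ happ
  have hfW0 : ‖f W₀‖ ≤ C₂ * ε ^ 2 := by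
    rw [hf]
    simp only
    rw [hP0]
    exact hres ε hε _ ((hS _ _).2 rfl)
  obtain ⟨W, hWr, hW⟩ := hex (K * (C₂ * ε ^ 2)) (by positivity) hεδ' (by gcongr)
  have hW' : W = S (nonlin β P ε (evenPart W)) := sub_eq_zero.1 hW
  have heven : refl W = W := by
    have h1 := (((hS _ _).2 hW').refl h.alpha_nonneg h.alpha_two hε)
    rw [h.refl_nonlin hε, refl_evenPart, hS] at h1
    rw [h1, ← hW']
  refine ⟨W, heven, ?_, hWr.trans hεδ', hWr.trans (le_of_eq (by ring)), fun W' he hs hd => ?_⟩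
  · rw [evenPart_of_even heven] at hW'
    exact (hS _ _).2 hW'
  · refine hinj W' W hd (hWr.trans hεδ') ?_
    rw [hW, hf]
    simp only
    rw [evenPart_of_even he, sub_eq_zero]
    exact (hS _ _).1 hs

end Peridynamics

/-! ### Uniform bounds for the bond elongations -/

namespace Peridynamics

variable {α β γ : ℝ → ℝ} {P : ℝ → ℝ → ℝ}

/-- The rescaled travelling wave equation, tested with square integrable functions. -/
def SolvesWeak (α β : ℝ → ℝ) (P : ℝ → ℝ → ℝ) (ε : ℝ) (W : L2R) : Prop :=
  ∀ φ, waveForm α ε W φ = (ε ^ 3)⁻¹ * bondForm ε (quadStress β ε W W) φ +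
    (ε ^ 5)⁻¹ * bondForm ε (lawStress P ε W) φ

theorem GlobalLaw.solvesWeak_iff (h : GlobalLaw α β γ P) {ε : ℝ} (hε : 0 < ε) (W : L2R) :
    SolvesWeak α β P ε W ↔ SolvesWave α ε W (nonlin β P ε W) := by
  refine forall_congr' fun φ => ?_
  rw [nonlin, inner_add_left, h.inner_quadVec hε, h.inner_lawVec hε]

theorem solvesWeak_congr {Q : ℝ → ℝ → ℝ} {ε : ℝ} {W : L2R}
    (h : ∀ ξ x, 0 < ξ → lawStress P ε W ξ x = lawStress Q ε W ξ x) :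
    SolvesWeak α β P ε W ↔ SolvesWeak α β Q ε W := by
  refine forall_congr' fun φ => ?_
  have : bondForm ε (lawStress P ε W) φ = bondForm ε (lawStress Q ε W) φ :=
    setIntegral_congr_fun measurableSet_Ioi fun ξ hξ => by
      simp only [h ξ _ hξ]
  rw [this]

/-- The form is an average of translated pairings with total weight `ε² ∫ α ξ²`. The sharp constant
matters: it has to be absorbed into the slightly larger `ε² c_ε²`. -/
theorem abs_bondForm_stiffStress_le (hα : ∀ ξ, 0 < ξ → 0 ≤ α ξ)
    (h2 : IntegrableOn (fun ξ => α ξ * ξ ^ 2) (Ioi 0)) {ε m : ℝ} (hε : 0 < ε) {W φ : L2R}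
    (hm : ∀ u, |inner ℝ (tr u W) φ| ≤ m) :
    |bondForm ε (stiffStress α ε W) φ| ≤ ε ^ 2 * moment α 2 * m := by
  have e : ε ^ 2 * moment α 2 * m = ∫ ξ in Ioi (0 : ℝ), ε ^ 2 * m * (α ξ * ξ ^ 2) := by
    rw [integral_const_mul, moment]; ring
  rw [e]
  refine abs_bondForm_le (h2.const_mul _) fun ξ hξ => ?_
  rw [stiffStress_integral hε hξ, inner_bondOp_bondOp (by positivity), abs_mul,
    abs_of_nonneg (hα ξ hξ)]
  calc α ξ * _ ≤ α ξ * ((ε * ξ) ^ 2 * m) := by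
        have := hα ξ hξ
        gcongr
        exact abs_diffInt_le (by positivity) fun u _ => hm u
    _ = _ := by ring

theorem abs_bondForm_lawStress_le_of_bounded_test (hγ : ∀ ξ, 0 < ξ → 0 ≤ γ ξ)
    (h3 : IntegrableOn (fun ξ => γ ξ * ξ ^ 3) (Ioi 0))
    (h4 : IntegrableOn (fun ξ => γ ξ * ξ ^ 4) (Ioi 0)) {ε : ℝ} (hε : 0 < ε) (hε1 : ε ≤ 1)
    {W φ : L2R} (hb : ∀ ξ x, 0 < ξ → |lawStress P ε W ξ x| ≤ γ ξ * |ε * bond (ε * ξ) W x| ^ 3)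
    (hφ : ∀ᵐ x, |φ x| ≤ 1) :
    |bondForm ε (lawStress P ε W) φ| ≤ ε ^ 6 * ‖W‖ ^ 3 * (moment γ 3 + moment γ 4) := by
  have e : ε ^ 6 * ‖W‖ ^ 3 * (moment γ 3 + moment γ 4) =
      ∫ ξ in Ioi (0 : ℝ), ε ^ 6 * ‖W‖ ^ 3 * (γ ξ * ξ ^ 3 + γ ξ * ξ ^ 4) := by
    rw [integral_const_mul, integral_add h3 h4, moment, moment]
  rw [e]
  refine abs_bondForm_le ((h3.add h4).const_mul _) fun ξ hξ => ?_
  have hη : 0 ≤ ε * ξ := by positivity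
  have hγξ := hγ ξ hξ
  set c := γ ξ * ε ^ 3 * (Real.sqrt (ε * ξ) * ‖W‖) * (ε * ξ) with hc
  have hpt : ∀ x, ‖lawStress P ε W ξ x * bond (ε * ξ) φ x‖ ≤
      c * (bond (ε * ξ) W x * bond (ε * ξ) W x) := fun x => by
    have h1 : |bond (ε * ξ) φ x| ≤ ε * ξ := by
      have := abs_bond_le_of_ae_le hη hφ x
      rwa [mul_one] at this
    rw [norm_mul, Real.norm_eq_abs, Real.norm_eq_abs, ← abs_mul_abs_self (bond (ε * ξ) W x)]
    calc _ ≤ γ ξ * |ε * bond (ε * ξ) W x| ^ 3 * (ε * ξ) := by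
          gcongr
          exact hb ξ x hξ
      _ = γ ξ * ε ^ 3 * |bond (ε * ξ) W x| * (ε * ξ) *
          (|bond (ε * ξ) W x| * |bond (ε * ξ) W x|) := by
          rw [abs_mul, abs_of_pos hε]; ring
      _ ≤ _ := by
          rw [hc]
          gcongr
          exact abs_bond_le hη W x
  have hB := L2Bound.bond hη W
  calc |∫ x, lawStress P ε W ξ x * bond (ε * ξ) φ x|
      ≤ ∫ x, c * (bond (ε * ξ) W x * bond (ε * ξ) W x) :=
        norm_integral_le_of_norm_le ((hB.integrable_mul hB).const_mul c)
          (Eventually.of_forall hpt)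
    _ ≤ c * (ε * ξ * ‖W‖ * (ε * ξ * ‖W‖)) := by
        rw [integral_const_mul]
        gcongr
        exact (le_abs_self _).trans (hB.abs_integral_mul_le hB (by positivity) (by positivity))
    _ = ε ^ 6 * ‖W‖ ^ 3 * (γ ξ * ξ ^ 3) * Real.sqrt (ε * ξ) := by rw [hc]; ring
    -- The bound `√(εξ) ≤ 1 + ξ`, valid for `ε ≤ 1`, replaces a moment of order 7/2 by those of
    -- order 3 and 4.
    _ ≤ ε ^ 6 * ‖W‖ ^ 3 * (γ ξ * ξ ^ 3) * (1 + ξ) := by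
        gcongr
        rw [Real.sqrt_le_left (by positivity)]
        nlinarith [mul_nonneg hξ.le (sub_nonneg.2 hε1)]
    _ = _ := by ring

/-- The bond elongations of a solution are bounded uniformly in the bond length. -/
theorem SolvesWeak.abs_bond_le {ε : ℝ} {W : L2R} (h : SolvesWeak α β P ε W) (hα : ∀ ξ, 0 < ξ → 0 ≤ α ξ)
    (h2 : IntegrableOn (fun ξ => α ξ * ξ ^ 2) (Ioi 0)) (hβ : ∀ ξ, 0 < ξ → 0 ≤ β ξ)
    (hb3 : IntegrableOn (fun ξ => β ξ * ξ ^ 3) (Ioi 0)) (hγ : ∀ ξ, 0 < ξ → 0 ≤ γ ξ)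
    (h3 : IntegrableOn (fun ξ => γ ξ * ξ ^ 3) (Ioi 0))
    (h4 : IntegrableOn (fun ξ => γ ξ * ξ ^ 4) (Ioi 0)) (hε : 0 < ε) (hε1 : ε ≤ 1)
    (hb : ∀ ξ x, 0 < ξ → |lawStress P ε W ξ x| ≤ γ ξ * |ε * bond (ε * ξ) W x| ^ 3)
    {η : ℝ} (hη : 0 ≤ η) (x : ℝ) :
    |bond η W x| ≤ moment β 3 * ‖W‖ ^ 2 + (moment γ 3 + moment γ 4) * ‖W‖ ^ 3 := by
  have hfin : volume (Ioc (0 : ℝ) η) ≠ ⊤ := by simp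
  set φ₀ : L2R := indicatorConstLp 2 measurableSet_Ioc hfin (1 : ℝ) with hφ₀
  have hbond : ∀ y, bond η W y = inner ℝ (tr y W) φ₀ := fun y => by
    rw [real_inner_comm, hφ₀, ← setIntegral_eq_inner, bond_eq', intervalIntegral.integral_of_le hη]
    refine setIntegral_congr_ae measurableSet_Ioc ?_
    filter_upwards [tr_coe y W] with t ht _
    rw [ht, add_comm]
  have hφ1 : ∀ y, ∀ᵐ x, |tr (-y) φ₀ x| ≤ 1 := fun y => by
    filter_upwards [tr_coe (-y) φ₀, ae_comp_add (-y) (indicatorConstLp_coeFn (p := 2)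
      (hs := measurableSet_Ioc) (hμs := hfin) (c := (1 : ℝ)))] with x h1 h2
    rw [h1, hφ₀, h2]
    by_cases hx : x + -y ∈ Ioc 0 η <;> simp [hx]
  -- Finiteness of the supremum is needed before it can be absorbed; this preliminary bound may
  -- depend on `η`.
  have hbdd : BddAbove (range fun y => |bond η W y|) := by
    refine ⟨‖W‖ * ‖φ₀‖, ?_⟩
    rintro _ ⟨y, rfl⟩
    simp only
    rw [hbond, ← norm_tr y W]
    exact abs_real_inner_le_norm _ _
  set m := ⨆ y, |bond η W y| with hm
  have hle : ∀ y, |bond η W y| ≤ m := fun y => le_ciSup hbdd y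
  set K := moment β 3 * ‖W‖ ^ 2 + (moment γ 3 + moment γ 4) * ‖W‖ ^ 3 with hK
  have hα2 : 0 ≤ moment α 2 := setIntegral_nonneg measurableSet_Ioi fun ξ hξ =>
    mul_nonneg (hα ξ hξ) (sq_nonneg _)
  -- Testing with a translated indicator turns the equation into one for a single increment. The
  -- linear stress is at most `∫ α ξ²` times the supremum, whereas the left side carries `∫ α ξ² +
  -- ε²`. Absorption leaves `ε² m ≤ ε² K`, uniformly in `ε` and `η`.
  have hmain : ∀ y, (moment α 2 + ε ^ 2) * |bond η W y| ≤ moment α 2 * m + ε ^ 2 * K := by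
    intro y
    have e := h (tr (-y) φ₀)
    rw [waveForm_eq hα h2 hε] at e
    have hin : ∀ u, |inner ℝ (tr u W) (tr (-y) φ₀)| ≤ m := fun u => by
      rw [inner_tr_tr, ← hbond]; exact hle _
    have n1 := abs_bondForm_stiffStress_le hα h2 hε hin
    have n2 := abs_bondForm_quadStress_le_of_bounded_test hβ hb3 hε zero_le_one W W (hφ1 y)
    have n3 := abs_bondForm_lawStress_le_of_bounded_test hγ h3 h4 hε hε1 hb (hφ1 y)
    have e0 : inner ℝ W (tr (-y) φ₀) = bond η W y := by rw [hbond, inner_tr_left]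
    rw [e0] at e
    have e2 : (moment α 2 + ε ^ 2) * bond η W y =
        (ε ^ 2)⁻¹ * bondForm ε (stiffStress α ε W) (tr (-y) φ₀) +
        ε⁻¹ * bondForm ε (quadStress β ε W W) (tr (-y) φ₀) +
        (ε ^ 3)⁻¹ * bondForm ε (lawStress P ε W) (tr (-y) φ₀) := by
      field_simp at e ⊢
      linear_combination e
    have e3 : (moment α 2 + ε ^ 2) * |bond η W y| = |(moment α 2 + ε ^ 2) * bond η W y| := by
      rw [abs_mul, abs_of_nonneg (by positivity : 0 ≤ moment α 2 + ε ^ 2)]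
    rw [e3, e2]
    refine (abs_add_three _ _ _).trans ?_
    rw [abs_mul, abs_mul, abs_mul, abs_of_pos (by positivity : 0 < (ε ^ 2)⁻¹),
      abs_of_pos (by positivity : 0 < ε⁻¹), abs_of_pos (by positivity : 0 < (ε ^ 3)⁻¹)]
    have hγ34 : 0 ≤ moment γ 3 + moment γ 4 := add_nonneg
      (setIntegral_nonneg measurableSet_Ioi fun ξ hξ =>
        mul_nonneg (hγ ξ hξ) (pow_nonneg (le_of_lt hξ) _))
      (setIntegral_nonneg measurableSet_Ioi fun ξ hξ =>
        mul_nonneg (hγ ξ hξ) (pow_nonneg (le_of_lt hξ) _))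
    calc _ ≤ (ε ^ 2)⁻¹ * (ε ^ 2 * moment α 2 * m) +
          ε⁻¹ * (ε ^ 3 * moment β 3 * 1 * ‖W‖ * ‖W‖) +
          (ε ^ 3)⁻¹ * (ε ^ 6 * ‖W‖ ^ 3 * (moment γ 3 + moment γ 4)) := by gcongr
      _ = moment α 2 * m + ε ^ 2 * (moment β 3 * ‖W‖ ^ 2) +
          ε ^ 2 * (ε * ((moment γ 3 + moment γ 4) * ‖W‖ ^ 3)) := by field_simp
      _ ≤ moment α 2 * m + ε ^ 2 * (moment β 3 * ‖W‖ ^ 2) +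
          ε ^ 2 * (1 * ((moment γ 3 + moment γ 4) * ‖W‖ ^ 3)) := by gcongr
      _ = _ := by rw [hK]; ring
  have hsup : m ≤ (moment α 2 * m + ε ^ 2 * K) / (moment α 2 + ε ^ 2) :=
    ciSup_le fun y => by
      rw [le_div_iff₀ (by positivity)]
      linarith [hmain y]
  rw [le_div_iff₀ (by positivity)] at hsup
  have hmK : m ≤ K := by
    have : 0 < ε ^ 2 := by positivity
    nlinarith
  exact (hle x).trans hmK

end Peridynamics

/-! ### The distributional travelling wave equation -/

namespace Peridynamics

variable {α β γ : ℝ → ℝ} {P : ℝ → ℝ → ℝ}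

theorem HasCompactSupport.exists_abs_le {ψ : ℝ → ℝ} (h : HasCompactSupport ψ) :
    ∃ R > 0, ∀ x, R < |x| → ψ x = 0 := by
  obtain ⟨R, hR⟩ := h.isCompact.isBounded.subset_closedBall 0
  refine ⟨max R 1, by positivity, fun x hx => image_eq_zero_of_notMem_tsupport fun hx' => ?_⟩
  have h1 := mem_closedBall_zero_iff.1 (hR hx')
  rw [Real.norm_eq_abs] at h1
  exact (h1.trans (le_max_left _ _)).not_gt hx

/-- The difference of a function and its translate has zero mean, so its primitive is again
compactly supported. -/
theorem exists_primitive_translate_sub {ψ : ℝ → ℝ} (hψ : ContDiff ℝ ∞ ψ)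
    (hc : HasCompactSupport ψ) (h : ℝ) :
    ∃ φ : ℝ → ℝ, ContDiff ℝ ∞ φ ∧ HasCompactSupport φ ∧
      ∀ x, deriv φ x = ψ (x + h) - ψ x := by
  set Ψ : ℝ → ℝ := fun x => ∫ t in (0 : ℝ)..x, ψ t with hΨ
  have hcont := hψ.continuous
  have hd : ∀ x, HasDerivAt Ψ (ψ x) x := fun x =>
    intervalIntegral.integral_hasDerivAt_right (hcont.intervalIntegrable _ _)
      (hcont.stronglyMeasurableAtFilter _ _) hcont.continuousAt
  have hΨs : ContDiff ℝ ∞ Ψ := by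
    rw [contDiff_infty_iff_deriv]
    refine ⟨fun x => (hd x).differentiableAt, ?_⟩
    rwa [funext fun x => (hd x).deriv]
  obtain ⟨R, hR0, hR⟩ := HasCompactSupport.exists_abs_le hc
  refine ⟨fun x => Ψ (x + h) - Ψ x, (hΨs.comp (contDiff_id.add contDiff_const)).sub hΨs, ?_,
    fun x => (((hd (x + h)).comp_add_const x h).sub (hd x)).deriv⟩
  refine HasCompactSupport.intro (isCompact_Icc (a := -(R + |h|)) (b := R + |h|)) fun x hx => ?_
  simp only [hΨ]
  rw [intervalIntegral.integral_interval_sub_left (hcont.intervalIntegrable _ _)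
    (hcont.intervalIntegrable _ _)]
  refine intervalIntegral.integral_zero_ae (Eventually.of_forall fun t ht => hR t ?_)
  have h1 := abs_nonneg h
  have hx' : R + |h| < |x| := by
    by_contra hcon
    exact hx (abs_le.1 (not_lt.1 hcon))
  have h2 : |t - x| ≤ |h| := by
    have := abs_sub_left_of_mem_uIcc (uIoc_subset_uIcc ht)
    rwa [add_sub_cancel_left] at this
  have h3 := abs_sub_abs_le_abs_sub x t
  rw [abs_sub_comm] at h3
  linarith

theorem locallyIntegrable_coe (V : L2R) : LocallyIntegrable (V : ℝ → ℝ) volume :=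
  (Lp.memLp V).locallyIntegrable (by norm_num)

/-- A square integrable function whose distributional derivative vanishes is zero. -/
theorem eq_zero_of_integral_mul_deriv_eq_zero {v : L2R}
    (h : ∀ φ : ℝ → ℝ, ContDiff ℝ ∞ φ → HasCompactSupport φ → ∫ x, v x * deriv φ x = 0) :
    v = 0 := by
  -- Inserting the primitives of translation differences as test functions shows that `v` is
  -- translation invariant.
  have htr : ∀ s, tr s v = v := by
    intro s
    apply Lp.ext
    refine ae_eq_of_integral_contDiff_smul_eq (locallyIntegrable_coe _) (locallyIntegrable_coe _)
      fun ψ hψ hc => ?_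
    obtain ⟨φ, hφ, hφc, hd⟩ := exists_primitive_translate_sub hψ hc (-s)
    have h0 := h φ hφ hφc
    have hm : MemLp ψ 2 := hψ.continuous.memLp_of_hasCompactSupport hc
    have hb : L2Bound ψ ‖hm.toLp ψ‖ := (L2Bound.coe (hm.toLp ψ)).congr hm.coeFn_toLp
    have i1 := (L2Bound.coe v).integrable_mul (hb.comp_add (-s))
    have i2 := (L2Bound.coe v).integrable_mul hb
    simp_rw [hd, mul_sub] at h0
    rw [integral_sub i1 i2, sub_eq_zero] at h0
    calc ∫ x, ψ x • tr s v x = ∫ x, v (x + s) * ψ x := by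
          apply integral_congr_ae
          filter_upwards [tr_coe s v] with x hx
          rw [hx, smul_eq_mul, mul_comm]
      _ = ∫ x, v x * ψ (x + -s) := by
          rw [← integral_add_right_eq_self (fun x => v x * ψ (x + -s)) s]
          simp_rw [add_neg_cancel_right]
      _ = ∫ x, ψ x • v x := by
          rw [h0]
          simp_rw [smul_eq_mul, mul_comm]
  have hκ : (0 : ℝ) < 1 := one_pos
  -- An invariant function equals its own Green average, whose pointwise formula is then constant; a
  -- constant in `L²(ℝ)` is zero.
  have hg : green 1 v = v := by
    rw [green, trAvg_apply (integrable_greenKernel hκ)]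
    simp_rw [htr]
    rw [integral_smul_const, integral_greenKernel hκ, one_smul]
  have hconst : (v : ℝ → ℝ) =ᵐ[volume] fun _ => inner ℝ (greenKernelLp hκ) v := by
    have := green_coe hκ v
    simp_rw [htr] at this
    rwa [hg] at this
  have hm := (memLp_congr_ae hconst).1 (Lp.memLp v)
  rw [memLp_const_iff (by norm_num) (by norm_num)] at hm
  have hz : inner ℝ (greenKernelLp hκ) v = 0 := hm.resolve_right (by simp)
  apply Lp.ext
  filter_upwards [hconst, Lp.coeFn_zero ℝ 2 (volume : Measure ℝ)] with x h1 h2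
  rw [h1, h2, hz]; rfl

/-- Integration by parts against the profile `U' = W`. -/
theorem integral_profile_mul_deriv (W : L2R) {ψ : ℝ → ℝ} (hψ : ContDiff ℝ 1 ψ)
    (hc : HasCompactSupport ψ) :
    ∫ x, profile W x * deriv ψ x = -∫ x, W x * ψ x := by
  obtain ⟨R, hR0, hR⟩ := HasCompactSupport.exists_abs_le hc
  obtain ⟨R', hR0', hR'⟩ := HasCompactSupport.exists_abs_le hc.deriv
  set a := R + R' with ha
  have hsupp : ∀ f : ℝ → ℝ, (∀ x, a < |x| → f x = 0) → ∫ x, f x = ∫ x in (-a)..a, f x := by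
    intro f hf
    rw [intervalIntegral.integral_of_le (by linarith), ← integral_Icc_eq_integral_Ioc,
      setIntegral_eq_integral_of_forall_compl_eq_zero fun x hx => hf x ?_]
    by_contra hcon
    exact hx (abs_le.1 (not_lt.1 hcon))
  have hW := intervalIntegrable_coe W (-a) a
  -- Since `W` is only locally integrable, the profile need not be differentiable everywhere, and
  -- integration by parts is used for absolutely continuous functions on an interval containing both
  -- supports.
  have hac : AbsolutelyContinuousOnInterval (profile W) (-a) a :=
    hW.absolutelyContinuousOnInterval_intervalIntegral (c := 0)
      (by rw [uIcc_of_le (by linarith)]; exact ⟨by linarith, by linarith⟩)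
  have hac' : AbsolutelyContinuousOnInterval ψ (-a) a :=
    (hψ.contDiffOn).absolutelyContinuousOnInterval
  rw [hsupp _ fun x hx => by rw [hR' x (by linarith), mul_zero],
    hsupp _ fun x hx => by rw [hR x (by linarith), mul_zero],
    hac.integral_mul_deriv_eq_deriv_mul hac', hR a (by rw [abs_of_pos] <;> linarith),
    hR (-a) (by rw [abs_neg, abs_of_pos] <;> linarith), mul_zero, mul_zero, sub_zero, zero_sub,
    neg_inj]
  refine intervalIntegral.integral_congr_ae ?_
  filter_upwards [hW.ae_hasDerivAt_integral] with x hx hx'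
  have := (hx (uIoc_subset_uIcc hx') 0
    (by rw [uIcc_of_le (by linarith)]; exact ⟨by linarith, by linarith⟩)).deriv
  rw [← this]; rfl

theorem memLp_of_test {φ : ℝ → ℝ} (hφ : ContDiff ℝ ∞ φ) (hc : HasCompactSupport φ) :
    MemLp φ 2 := hφ.continuous.memLp_of_hasCompactSupport hc

theorem contDiff_deriv_of_test {φ : ℝ → ℝ} (hφ : ContDiff ℝ ∞ φ) : ContDiff ℝ ∞ (deriv φ) :=
  (contDiff_infty_iff_deriv.1 hφ).2

theorem bond_deriv {φ : ℝ → ℝ} (hφ : ContDiff ℝ ∞ φ) {φ' : L2R} (h : φ' =ᵐ[volume] deriv φ)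
    (η x : ℝ) : bond η φ' x = φ (x + η) - φ x := by
  rw [bond_eq, bond_congr h]
  have hd := contDiff_infty_iff_deriv.1 hφ
  exact intervalIntegral.integral_deriv_eq_sub (fun x _ => hd.1 x)
    (hd.2.continuous.intervalIntegrable _ _)

/-- Summation by parts moves the difference of stresses onto `φ`, whose increments are bond
elongations of `φ'`. This is how the equation is integrated once. -/
theorem integral_bond_difference_mul {φ : ℝ → ℝ} (hφ : ContDiff ℝ ∞ φ)
    (hc : HasCompactSupport φ) {φ' : L2R} (h : φ' =ᵐ[volume] deriv φ) {g : ℝ → ℝ} {A : ℝ}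
    (hg : L2Bound g A) (η : ℝ) :
    ∫ x, (g x - g (x - η)) * φ x = -∫ x, g x * bond η φ' x := by
  have hm := memLp_of_test hφ hc
  have hb : L2Bound φ ‖hm.toLp φ‖ := (L2Bound.coe (hm.toLp φ)).congr hm.coeFn_toLp
  have i1 := hg.integrable_mul hb
  have i2 : Integrable fun x => g (x - η) * φ x := (hg.comp_add (-η)).integrable_mul hb
  have i3 := hg.integrable_mul (hb.comp_add η)
  simp_rw [bond_deriv hφ h, sub_mul, mul_sub]
  rw [integral_sub i1 i2, integral_sub i3 i1, neg_sub]
  congr 1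
  rw [← integral_add_right_eq_self (fun x => g (x - η) * φ x) η]
  simp_rw [add_sub_cancel_right]

theorem force_difference (F : ℝ → ℝ → ℝ) (ε : ℝ) (W : L2R) (ξ x : ℝ) :
    F (ε * profile W (x + ε * ξ) - ε * profile W x) ξ -
      F (ε * profile W x - ε * profile W (x - ε * ξ)) ξ =
    lawStress F ε W ξ x - lawStress F ε W ξ (x - ε * ξ) := by
  rw [lawStress, lawStress, bond, bond, sub_add_cancel, mul_sub, mul_sub]

/-- The distributional equation is equivalent to its formulation with square integrable test
functions. -/
theorem solvesScaledEquation_iff {F : ℝ → ℝ → ℝ} {ε : ℝ} (hε : 0 < ε) {c : ℝ} {W : L2R}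
    (hadm : BondAdmissible (lawStress F ε W)) :
    SolvesScaledEquation F ε c W ↔
      ∀ φ : L2R, ε ^ 3 * c ^ 2 * inner ℝ W φ = bondForm ε (lawStress F ε W) φ := by
  obtain ⟨-, G, -, hG⟩ := id hadm
  have hleft : ∀ φ : ℝ → ℝ, ContDiff ℝ ∞ φ → HasCompactSupport φ → ∀ φ' : L2R,
      φ' =ᵐ[volume] deriv φ →
      ∫ x, profile W x * iteratedDeriv 2 φ x = -inner ℝ W φ' := by
    intro φ hφ hc φ' hφ'
    rw [iteratedDeriv_succ, iteratedDeriv_one, integral_profile_mul_deriv W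
      ((contDiff_deriv_of_test hφ).of_le (by exact_mod_cast le_top)) hc.deriv, inner_eq_integral]
    congr 1
    apply integral_congr_ae
    filter_upwards [hφ'] with x hx
    rw [hx]
  have hright : ∀ φ : ℝ → ℝ, ContDiff ℝ ∞ φ → HasCompactSupport φ → ∀ φ' : L2R,
      φ' =ᵐ[volume] deriv φ → ∀ ξ, 0 < ξ →
      ∫ x, (F (ε * profile W (x + ε * ξ) - ε * profile W x) ξ -
        F (ε * profile W x - ε * profile W (x - ε * ξ)) ξ) * φ x =
      -∫ x, lawStress F ε W ξ x * bond (ε * ξ) φ' x := by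
    intro φ hφ hc φ' hφ' ξ hξ
    simp_rw [force_difference]
    exact integral_bond_difference_mul hφ hc hφ' (hG ξ hξ).2 (ε * ξ)
  constructor
  · intro h
    obtain ⟨v, hv⟩ := hadm.exists_vec hε.le
    -- Smooth tests only give the equation paired with derivatives, so the defect has zero
    -- distributional derivative; being square integrable, it vanishes.
    suffices h0 : (ε ^ 3 * c ^ 2) • W - v = 0 by
      intro φ
      rw [← hv, ← sub_eq_zero.1 h0, inner_smul_left, RCLike.conj_to_real]
    refine eq_zero_of_integral_mul_deriv_eq_zero fun φ hφ hc => ?_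
    have hm := memLp_of_test (contDiff_deriv_of_test hφ) hc.deriv
    have h1 := (h φ hφ hc).2
    rw [hleft φ hφ hc _ hm.coeFn_toLp,
      setIntegral_congr_fun measurableSet_Ioi (hright φ hφ hc _ hm.coeFn_toLp),
      integral_neg, ← bondForm, ← hv] at h1
    have h2 : inner ℝ ((ε ^ 3 * c ^ 2) • W - v) (hm.toLp _) = 0 := by
      rw [inner_sub_left, inner_smul_left, RCLike.conj_to_real]
      linarith
    rw [← h2, inner_eq_integral]
    apply integral_congr_ae
    filter_upwards [hm.coeFn_toLp] with x hx
    rw [hx]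
  · intro h φ hφ hc
    have hm := memLp_of_test (contDiff_deriv_of_test hφ) hc.deriv
    have hr := hright φ hφ hc _ hm.coeFn_toLp
    refine ⟨?_, ?_⟩
    · exact ((hadm.integrableOn hε.le (hm.toLp _)).neg).congr_fun (fun ξ hξ => (hr ξ hξ).symm)
        measurableSet_Ioi
    · rw [hleft φ hφ hc _ hm.coeFn_toLp, setIntegral_congr_fun measurableSet_Ioi hr, integral_neg,
        ← bondForm, ← h]
      ring

end Peridynamics

/-! ### The distributional wave equation in the plane -/

namespace Peridynamics

/-- Smooth compactly supported functions on the plane. -/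
def IsTest (φ : ℝ × ℝ → ℝ) : Prop := ContDiff ℝ ∞ φ ∧ HasCompactSupport φ

/-- The directional derivative. -/
noncomputable def dirDeriv (v : ℝ × ℝ) (φ : ℝ × ℝ → ℝ) (q : ℝ × ℝ) : ℝ := fderiv ℝ φ q v

theorem IsTest.isTest_dirDeriv {φ : ℝ × ℝ → ℝ} (h : IsTest φ) (v : ℝ × ℝ) : IsTest (dirDeriv v φ) :=
  ⟨(h.1.fderiv_right (m := ∞) (by exact_mod_cast le_top)).clm_apply contDiff_const,
    h.2.fderiv_apply (𝕜 := ℝ) v⟩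

theorem IsTest.differentiableAt {φ : ℝ × ℝ → ℝ} (h : IsTest φ) (q : ℝ × ℝ) :
    DifferentiableAt ℝ φ q := (h.1.differentiable (by simp)) q

theorem IsTest.continuous {φ : ℝ × ℝ → ℝ} (h : IsTest φ) : Continuous φ := h.1.continuous

theorem IsTest.exists_bound {φ : ℝ × ℝ → ℝ} (h : IsTest φ) : ∃ M, ∀ q, |φ q| ≤ M :=
  h.continuous.bounded_above_of_compact_support h.2

theorem IsTest.exists_radius {φ : ℝ × ℝ → ℝ} (h : IsTest φ) :
    ∃ R > 0, ∀ t y, φ (t, y) ≠ 0 → |t| ≤ R ∧ |y| ≤ R := by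
  obtain ⟨R, hR⟩ := h.2.isCompact.isBounded.subset_closedBall 0
  refine ⟨max R 1, by positivity, fun t y hq => ?_⟩
  have h1 := mem_closedBall_zero_iff.1 (hR (subset_tsupport φ hq))
  rw [Prod.norm_def] at h1
  exact ⟨(le_max_left _ _).trans (h1.trans (le_max_left _ _)),
    (le_max_right _ _).trans (h1.trans (le_max_left _ _))⟩

theorem IsTest.hasDerivAt_line {φ : ℝ × ℝ → ℝ} (h : IsTest φ) {p : ℝ → ℝ × ℝ} {v : ℝ × ℝ} {t : ℝ}
    (hp : HasDerivAt p v t) : HasDerivAt (fun s => φ (p s)) (dirDeriv v φ (p t)) t :=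
  (h.differentiableAt (p t)).hasFDerivAt.comp_hasDerivAt t hp

theorem iteratedDeriv_two_slice {φ : ℝ × ℝ → ℝ} (h : IsTest φ) (t y : ℝ) :
    iteratedDeriv 2 (fun s => φ (s, y)) t = dirDeriv (1, 0) (dirDeriv (1, 0) φ) (t, y) := by
  have hp : ∀ s, HasDerivAt (fun s : ℝ => (s, y)) ((1, 0) : ℝ × ℝ) s := fun s =>
    (hasDerivAt_id s).prodMk (hasDerivAt_const s y)
  have e : deriv (fun s => φ (s, y)) = fun s => dirDeriv (1, 0) φ (s, y) :=
    funext fun s => (h.hasDerivAt_line (hp s)).deriv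
  rw [iteratedDeriv_succ, iteratedDeriv_one, e]
  exact ((h.isTest_dirDeriv (1, 0)).hasDerivAt_line (hp t)).deriv

/-- The integral of a test function along the characteristic `y = x / ε + c t`. -/
noncomputable def lineIntegral (ε c : ℝ) (φ : ℝ × ℝ → ℝ) (x : ℝ) : ℝ :=
  ∫ t, φ (t, x / ε + c * t)

theorem IsTest.integrable_line {φ : ℝ × ℝ → ℝ} (h : IsTest φ) (ε c x : ℝ) :
    Integrable fun t => φ (t, x / ε + c * t) := by
  obtain ⟨R, -, hR⟩ := h.exists_radius
  have hc := h.continuous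
  refine Continuous.integrable_of_hasCompactSupport (by fun_prop)
    (HasCompactSupport.intro (isCompact_Icc (a := -R) (b := R)) fun t ht => ?_)
  by_contra hne
  exact ht (abs_le.1 (hR _ _ hne).1)

theorem hasDerivAt_lineIntegral {φ : ℝ × ℝ → ℝ} (h : IsTest φ) (ε c x : ℝ) :
    HasDerivAt (lineIntegral ε c φ) (ε⁻¹ * lineIntegral ε c (dirDeriv (0, 1) φ) x) x := by
  have hd := h.isTest_dirDeriv (0, 1)
  obtain ⟨M, hM⟩ := hd.exists_bound
  obtain ⟨R, -, hR⟩ := hd.exists_radius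
  have hcφ := h.continuous
  have hcd := hd.continuous
  have key := hasDerivAt_integral_of_dominated_loc_of_deriv_le (μ := volume)
    (F := fun x t => φ (t, x / ε + c * t))
    (F' := fun x t => ε⁻¹ * dirDeriv (0, 1) φ (t, x / ε + c * t))
    (bound := (Icc (-R) R).indicator fun _ => |ε⁻¹| * M) (x₀ := x) (s := univ) univ_mem
    (Eventually.of_forall fun y => (h.integrable_line ε c y).aestronglyMeasurable)
    (h.integrable_line ε c x)
    ((hd.integrable_line ε c x).aestronglyMeasurable.const_mul _)
    (Eventually.of_forall fun t y _ => by
      by_cases ht : t ∈ Icc (-R) R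
      · rw [indicator_of_mem ht, norm_mul]
        exact mul_le_mul_of_nonneg_left (hM _) (abs_nonneg _)
      · rw [indicator_of_notMem ht]
        have : dirDeriv (0, 1) φ (t, y / ε + c * t) = 0 := by
          by_contra hne
          exact ht (abs_le.1 (hR _ _ hne).1)
        rw [this, mul_zero, norm_zero])
    ((integrable_indicator_iff measurableSet_Icc).2 (integrableOn_const (by simp)))
    (Eventually.of_forall fun t y _ => by
      have hp : HasDerivAt (fun y : ℝ => (t, y / ε + c * t)) ((0, ε⁻¹) : ℝ × ℝ) y := by
        have h2 : HasDerivAt (fun y : ℝ => y / ε + c * t) ε⁻¹ y := by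
          simpa using ((hasDerivAt_id y).div_const ε).add_const (c * t)
        exact (hasDerivAt_const y t).prodMk h2
      refine (h.hasDerivAt_line hp).congr_deriv ?_
      rw [dirDeriv, dirDeriv, show ((0, ε⁻¹) : ℝ × ℝ) = ε⁻¹ • (0, 1) by simp, map_smul,
        smul_eq_mul])
  refine key.2.congr_deriv ?_
  rw [integral_const_mul, lineIntegral]

/-- The derivative of a line integral is a multiple of the line integral of another test function,
which makes the induction on the order work. -/
theorem contDiff_lineIntegral {φ : ℝ × ℝ → ℝ} (h : IsTest φ) (ε c : ℝ) :
    ContDiff ℝ ∞ (lineIntegral ε c φ) := by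
  rw [contDiff_infty]
  intro n
  induction n generalizing φ with
  | zero =>
    exact contDiff_zero.2 (continuous_iff_continuousAt.2 fun x =>
      (hasDerivAt_lineIntegral h ε c x).continuousAt)
  | succ n ih =>
    push_cast
    rw [contDiff_succ_iff_deriv]
    refine ⟨fun x => (hasDerivAt_lineIntegral h ε c x).differentiableAt, by simp, ?_⟩
    rw [funext fun x => (hasDerivAt_lineIntegral h ε c x).deriv]
    exact contDiff_const.mul (ih (h.isTest_dirDeriv (0, 1)))

theorem abs_le_of_line_ne_zero {ε c R x t : ℝ} (hε : 0 < ε) (ht : |t| ≤ R)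
    (hy : |x / ε + c * t| ≤ R) : |x| ≤ ε * (R + |c| * R) := by
  have h1 : |x / ε| ≤ R + |c| * R := by
    have h2 := abs_sub (x / ε + c * t) (c * t)
    rw [add_sub_cancel_right, abs_mul] at h2
    have h3 : |c| * |t| ≤ |c| * R := by gcongr
    linarith
  rwa [abs_div, abs_of_pos hε, div_le_iff₀ hε, mul_comm] at h1

theorem hasCompactSupport_lineIntegral {φ : ℝ × ℝ → ℝ} (h : IsTest φ) {ε : ℝ} (hε : 0 < ε)
    (c : ℝ) : HasCompactSupport (lineIntegral ε c φ) := by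
  obtain ⟨R, -, hR⟩ := h.exists_radius
  refine HasCompactSupport.intro
    (isCompact_Icc (a := -(ε * (R + |c| * R))) (b := ε * (R + |c| * R))) fun x hx => ?_
  refine integral_eq_zero_of_ae (Eventually.of_forall fun t => ?_)
  by_contra hne
  obtain ⟨h1, h2⟩ := hR _ _ hne
  exact hx (abs_le.1 (abs_le_of_line_ne_zero hε h1 h2))

/-- Integration along characteristics turns `∂ₜ` into `- c ε ∂ₓ`. -/
theorem lineIntegral_dirDeriv {φ : ℝ × ℝ → ℝ} (h : IsTest φ) {ε : ℝ} (hε : 0 < ε) (c : ℝ) :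
    lineIntegral ε c (dirDeriv (1, 0) φ) = fun x => -(c * ε) * deriv (lineIntegral ε c φ) x := by
  ext1 x
  rw [(hasDerivAt_lineIntegral h ε c x).deriv]
  have h1 := (h.isTest_dirDeriv (1, 0)).integrable_line ε c x
  have h2 := (h.isTest_dirDeriv (0, 1)).integrable_line ε c x
  have hd : ∀ t, HasDerivAt (fun t => φ (t, x / ε + c * t))
      (dirDeriv (1, 0) φ (t, x / ε + c * t) + c * dirDeriv (0, 1) φ (t, x / ε + c * t)) t := by
    intro t
    have hp : HasDerivAt (fun t : ℝ => (t, x / ε + c * t)) ((1, c) : ℝ × ℝ) t := by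
      have h2 : HasDerivAt (fun t : ℝ => x / ε + c * t) c t := by
        simpa using ((hasDerivAt_id t).const_mul c).const_add (x / ε)
      exact (hasDerivAt_id t).prodMk h2
    refine (h.hasDerivAt_line hp).congr_deriv ?_
    rw [dirDeriv, dirDeriv, dirDeriv,
      show ((1, c) : ℝ × ℝ) = (1, 0) + c • (0, 1) by simp, map_add, map_smul, smul_eq_mul]
  -- The total derivative along a characteristic integrates to zero, which expresses the time
  -- derivative through the space derivative.
  have h0 := integral_eq_zero_of_hasDerivAt_of_integrable hd (h1.add (h2.const_mul c))
    (h.integrable_line ε c x)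
  rw [integral_add h1 (h2.const_mul c), integral_const_mul] at h0
  have e : -(c * ε) * (ε⁻¹ * lineIntegral ε c (dirDeriv (0, 1) φ) x) =
      -(c * lineIntegral ε c (dirDeriv (0, 1) φ) x) := by field_simp
  rw [e, lineIntegral, lineIntegral]
  linarith

theorem lineIntegral_dirDeriv_two {φ : ℝ × ℝ → ℝ} (h : IsTest φ) {ε : ℝ} (hε : 0 < ε) (c x : ℝ) :
    lineIntegral ε c (dirDeriv (1, 0) (dirDeriv (1, 0) φ)) x =
      c ^ 2 * ε ^ 2 * iteratedDeriv 2 (lineIntegral ε c φ) x := by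
  rw [lineIntegral_dirDeriv (h.isTest_dirDeriv (1, 0)) hε, lineIntegral_dirDeriv h hε,
    iteratedDeriv_succ, iteratedDeriv_one]
  simp only [deriv_const_mul_field]
  ring

/-- Fubini's theorem in the characteristic coordinates. -/
theorem integral_comp_characteristic {φ : ℝ × ℝ → ℝ} (h : IsTest φ) {ε : ℝ} (hε : 0 < ε) (c : ℝ)
    {H : ℝ → ℝ} (hH : Continuous H) :
    ∫ q : ℝ × ℝ, H (ε * q.2 - ε * c * q.1) * φ q = ε⁻¹ * ∫ x, H x * lineIntegral ε c φ x := by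
  obtain ⟨R, -, hR⟩ := h.exists_radius
  have hcφ := h.continuous
  have hint : Integrable fun q : ℝ × ℝ => H (ε * q.2 - ε * c * q.1) * φ q :=
    Continuous.integrable_of_hasCompactSupport (by fun_prop) h.2.mul_left
  rw [Measure.volume_eq_prod, integral_prod _ hint]
  have hinner : ∀ t, ∫ y, H (ε * y - ε * c * t) * φ (t, y) =
      ε⁻¹ * ∫ x, H x * φ (t, x / ε + c * t) := by
    intro t
    have e1 : ∀ y, H (ε * y - ε * c * t) * φ (t, y) =
        (fun z => H (z - ε * c * t) * φ (t, (z - ε * c * t) / ε + c * t)) (ε * y) := by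
      intro y
      have : (ε * y - ε * c * t) / ε + c * t = y := by field_simp; ring
      simp only [this]
    rw [funext e1, Measure.integral_comp_mul_left
      (fun z => H (z - ε * c * t) * φ (t, (z - ε * c * t) / ε + c * t)) ε, abs_of_pos (by positivity : 0 < ε⁻¹), smul_eq_mul,
      integral_sub_right_eq_self (fun z => H z * φ (t, z / ε + c * t)) (ε * c * t)]
  simp_rw [hinner]
  rw [integral_const_mul, integral_integral_swap_of_hasCompactSupport]
  · simp_rw [integral_const_mul, lineIntegral]
  · simp only [Function.uncurry_def]
    fun_prop
  · refine HasCompactSupport.intro (isCompact_Icc.prod isCompact_Icc : IsCompact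
      (Icc (-R) R ×ˢ Icc (-(ε * (R + |c| * R))) (ε * (R + |c| * R)))) fun q hq => ?_
    by_contra hne
    obtain ⟨h1, h2⟩ := hR _ _ (right_ne_zero_of_mul hne)
    exact hq ⟨abs_le.1 h1, abs_le.1 (abs_le_of_line_ne_zero hε h1 h2)⟩

/-- A solution of the travelling wave equation yields a solution of the wave equation. -/
theorem SolvesScaledEquation.solvesPeridynamicEquation {F : ℝ → ℝ → ℝ} {α : ℝ → ℝ} {ε : ℝ}
    (hε : 0 < ε) {W : L2R} (hF : ∀ ξ, 0 < ξ → Continuous fun r => F r ξ)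
    (h : SolvesScaledEquation F ε (waveSpeed α ε) W) :
    SolvesPeridynamicEquation F (displacement α ε W) := by
  intro φ hφ hc
  have hφt : IsTest φ := ⟨hφ, hc⟩
  set c := waveSpeed α ε with hcdef
  set H : ℝ → ℝ → ℝ := fun ξ x => F (ε * profile W (x + ε * ξ) - ε * profile W x) ξ -
    F (ε * profile W x - ε * profile W (x - ε * ξ)) ξ with hH
  have hHc : ∀ ξ, 0 < ξ → Continuous (H ξ) := fun ξ hξ => by
    have h1 := hF ξ hξ
    have h2 := continuous_profile W
    exact (h1.comp (by fun_prop)).sub (h1.comp (by fun_prop))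
  have hforce : ∀ ξ, 0 < ξ → ∫ q : ℝ × ℝ,
      (F (displacement α ε W q.1 (q.2 + ξ) - displacement α ε W q.1 q.2) ξ -
        F (displacement α ε W q.1 q.2 - displacement α ε W q.1 (q.2 - ξ)) ξ) * φ q =
      ε⁻¹ * ∫ x, H ξ x * lineIntegral ε c φ x := by
    intro ξ hξ
    rw [← integral_comp_characteristic hφt hε c (hHc ξ hξ)]
    congr 1; ext1 q
    have e1 : ε * (q.2 + ξ) - ε * c * q.1 = ε * q.2 - ε * c * q.1 + ε * ξ := by ring
    have e2 : ε * (q.2 - ξ) - ε * c * q.1 = ε * q.2 - ε * c * q.1 - ε * ξ := by ring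
    simp only [displacement, hH, ← hcdef, e1, e2]
  -- The displacement is constant along characteristics, so testing with `φ` in the plane amounts to
  -- testing the profile equation with the line integral of `φ`.
  obtain ⟨hint, heq⟩ := h (lineIntegral ε c φ) (contDiff_lineIntegral hφt ε c)
    (hasCompactSupport_lineIntegral hφt hε c)
  refine ⟨IntegrableOn.congr_fun (hint.const_mul ε⁻¹) (fun ξ hξ => (hforce ξ hξ).symm) measurableSet_Ioi, ?_⟩
  rw [setIntegral_congr_fun measurableSet_Ioi hforce, integral_const_mul, ← heq]
  have hd := (hφt.isTest_dirDeriv (1, 0)).isTest_dirDeriv (1, 0)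
  have hleft : ∀ q : ℝ × ℝ, displacement α ε W q.1 q.2 *
      iteratedDeriv 2 (fun s => φ (s, q.2)) q.1 =
      ε * (profile W (ε * q.2 - ε * c * q.1) * dirDeriv (1, 0) (dirDeriv (1, 0) φ) q) := by
    intro q
    rw [iteratedDeriv_two_slice hφt, displacement, mul_assoc]
  simp_rw [hleft]
  rw [integral_const_mul, integral_comp_characteristic hd hε c (continuous_profile W)]
  simp_rw [lineIntegral_dirDeriv_two hφt hε]
  have e3 : ∀ x, profile W x * (c ^ 2 * ε ^ 2 * iteratedDeriv 2 (lineIntegral ε c φ) x) =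
      c ^ 2 * ε ^ 2 * (profile W x * iteratedDeriv 2 (lineIntegral ε c φ) x) := by
    intro x; ring
  simp_rw [e3]
  rw [integral_const_mul]
  field_simp

end Peridynamics

/-! ### Force laws satisfying the constitutive assumption -/

namespace Peridynamics

theorem BondAdmissible.congr {g h : ℝ → ℝ → ℝ} (hg : BondAdmissible g)
    (hgh : ∀ ξ x, 0 < ξ → h ξ x = g ξ x) : BondAdmissible h := by
  obtain ⟨hm, G, hGi, hG⟩ := hg
  refine ⟨hm.congr ?_, G, hGi, fun ξ hξ => ⟨(hG ξ hξ).1, ?_⟩⟩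
  · have : ∀ᵐ q ∂((volume.restrict (Ioi (0 : ℝ))).prod (volume : Measure ℝ)), q.1 ∈ Ioi (0 : ℝ) :=
      Measure.quasiMeasurePreserving_fst.ae (ae_restrict_mem measurableSet_Ioi)
    filter_upwards [this] with q hq
    exact (hgh q.1 q.2 hq).symm
  · rw [funext fun x => hgh ξ x hξ]
    exact (hG ξ hξ).2

theorem BondAdmissible.const_mul {g : ℝ → ℝ → ℝ} (hg : BondAdmissible g) (c : ℝ) :
    BondAdmissible fun ξ x => c * g ξ x := by
  obtain ⟨hm, G, hGi, hG⟩ := hg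
  refine ⟨hm.const_mul c, fun ξ => |c| * G ξ, ?_, fun ξ hξ => ⟨?_, ?_⟩⟩
  · refine IntegrableOn.congr_fun (hGi.const_mul |c|) (fun ξ _ => ?_) measurableSet_Ioi
    exact mul_left_comm _ _ _
  · exact mul_nonneg (abs_nonneg c) (hG ξ hξ).1
  · exact (hG ξ hξ).2.mul (f := fun _ => c) aestronglyMeasurable_const (abs_nonneg c)
      (Eventually.of_forall fun _ => le_rfl)

namespace ForceAssumption

variable {F : ℝ → ℝ → ℝ} {α β γ : ℝ → ℝ} {p : ℝ → ℝ → ℝ}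

theorem gamma_nonneg (hF : ForceAssumption F α β γ p) (ξ : ℝ) (hξ : 0 < ξ) : 0 ≤ γ ξ := by
  have := (abs_nonneg _).trans (hF.p_deriv_bound 1 ξ hξ (by simp))
  simpa using this

theorem globalLaw (hF : ForceAssumption F α β γ p) : GlobalLaw α β γ (clampLaw p) where
  alpha_nonneg := hF.alpha_nonneg
  alpha_two := hF.alpha_two
  alpha_four := hF.alpha_four
  alpha_six := hF.alpha_six
  alpha_two_pos := hF.alpha_two_pos
  beta_nonneg := hF.beta_nonneg
  beta_five_half := hF.beta_five_half
  beta_three := hF.beta_three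
  beta_five := hF.beta_five
  beta_three_pos := hF.beta_three_pos
  gamma_nonneg := hF.gamma_nonneg
  gamma_three := hF.gamma_three
  gamma_four := hF.gamma_four
  cont := clampLaw_continuous hF.p_contDiff
  continuousOn := fun r => hF.p_continuousOn _
  zero := fun ξ hξ => by rw [clampLaw_eq p (by simp), hF.p_zero ξ hξ]
  lipschitz := clampLaw_lipschitz hF.p_contDiff hF.p_deriv_bound hF.gamma_nonneg

theorem continuous_force (hF : ForceAssumption F α β γ p) (ξ : ℝ) (hξ : 0 < ξ) :
    Continuous fun r => F r ξ := by
  have h := (hF.p_contDiff ξ hξ).continuous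
  simp_rw [hF.decomposition _ ξ hξ]
  fun_prop

theorem lawStress_force (hF : ForceAssumption F α β γ p) (ε : ℝ) (W : L2R) (ξ x : ℝ)
    (hξ : 0 < ξ) : lawStress F ε W ξ x = ε * stiffStress α ε W ξ x +
      ε ^ 2 * quadStress β ε W W ξ x + lawStress p ε W ξ x := by
  rw [lawStress, hF.decomposition _ ξ hξ, stiffStress, quadStress, lawStress]
  ring

theorem stiff (hF : ForceAssumption F α β γ p) {ε : ℝ} (hε : 0 < ε) (W : L2R) :
    BondAdmissible (stiffStress α ε W) :=
  stiffStress_admissible hF.alpha_nonneg hF.alpha_two hε W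

theorem law (hF : ForceAssumption F α β γ p) {ε : ℝ} (hε : 0 < ε) {W : L2R}
    (hb : ∀ ξ x, 0 < ξ → |lawStress p ε W ξ x| ≤ γ ξ * |ε * bond (ε * ξ) W x| ^ 3) :
    BondAdmissible (lawStress p ε W) :=
  lawStress_admissible (fun ξ hξ => (hF.p_contDiff ξ hξ).continuous) hF.p_continuousOn
    hF.gamma_nonneg hF.gamma_three hε hb

theorem admissible_force (hF : ForceAssumption F α β γ p) {ε : ℝ} (hε : 0 < ε) {W : L2R}
    (hb : ∀ ξ x, 0 < ξ → |lawStress p ε W ξ x| ≤ γ ξ * |ε * bond (ε * ξ) W x| ^ 3) :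
    BondAdmissible (lawStress F ε W) :=
  ((((hF.stiff hε W).const_mul ε).add ((hF.globalLaw.quad hε W W).const_mul (ε ^ 2))).add
    (hF.law hε hb)).congr (hF.lawStress_force ε W)

theorem bondForm_force (hF : ForceAssumption F α β γ p) {ε : ℝ} (hε : 0 < ε) {W : L2R}
    (hb : ∀ ξ x, 0 < ξ → |lawStress p ε W ξ x| ≤ γ ξ * |ε * bond (ε * ξ) W x| ^ 3) (φ : L2R) :
    bondForm ε (lawStress F ε W) φ = ε * bondForm ε (stiffStress α ε W) φ +
      ε ^ 2 * bondForm ε (quadStress β ε W W) φ + bondForm ε (lawStress p ε W) φ := by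
  have h1 := (hF.stiff hε W).const_mul ε
  have h2 := (hF.globalLaw.quad hε W W).const_mul (ε ^ 2)
  rw [← bondForm_const_mul, ← bondForm_const_mul, ← h1.bondForm_add_left h2 hε.le,
    ← (h1.add h2).bondForm_add_left (hF.law hε hb) hε.le]
  exact setIntegral_congr_fun measurableSet_Ioi fun ξ hξ => by
    simp only [hF.lawStress_force ε W ξ _ hξ]

theorem waveSpeed_sq (hF : ForceAssumption F α β γ p) (ε : ℝ) :
    waveSpeed α ε ^ 2 = moment α 2 + ε ^ 2 := by
  have := hF.alpha_two_pos
  rw [waveSpeed, Real.sq_sqrt (by positivity), moment]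

/-- After the stress is split by powers of the strain, division by `ε⁵` and `c_ε² = c₀² + ε²` turn
the integrated equation into the rescaled weak one. -/
theorem solvesScaledEquation_iff_solvesWeak (hF : ForceAssumption F α β γ p) {ε : ℝ} (hε : 0 < ε)
    {W : L2R}
    (hb : ∀ ξ x, 0 < ξ → |lawStress p ε W ξ x| ≤ γ ξ * |ε * bond (ε * ξ) W x| ^ 3) :
    SolvesScaledEquation F ε (waveSpeed α ε) W ↔ SolvesWeak α β p ε W := by
  rw [solvesScaledEquation_iff hε (hF.admissible_force hε hb)]
  refine forall_congr' fun φ => ?_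
  rw [waveForm_eq hF.alpha_nonneg hF.alpha_two hε, hF.bondForm_force hε hb, hF.waveSpeed_sq]
  have hε' := hε.ne'
  constructor
  · intro h
    field_simp
    linear_combination h
  · intro h
    field_simp at h
    linear_combination h

theorem abs_lawStress_le_of_small (hF : ForceAssumption F α β γ p) {ε : ℝ} {W : L2R}
    (hs : ∀ ξ x, 0 < ξ → |ε * bond (ε * ξ) W x| ≤ 1) (ξ x : ℝ) (hξ : 0 < ξ) :
    |lawStress p ε W ξ x| ≤ γ ξ * |ε * bond (ε * ξ) W x| ^ 3 := by
  rw [lawStress, ← clampLaw_eq p (hs ξ x hξ)]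
  exact hF.globalLaw.abs_le hξ _

/-- Mean value inequality between zero and the strain, on exactly the interval where the derivative
bound is known to hold. -/
theorem abs_lawStress_le_of_range (hF : ForceAssumption F α β γ p) {ε : ℝ} {W : L2R}
    (hs : StrainsInRange γ p ε W) (ξ x : ℝ) (hξ : 0 < ξ) :
    |lawStress p ε W ξ x| ≤ γ ξ * |ε * bond (ε * ξ) W x| ^ 3 := by
  have h := abs_sub_le_of_deriv_bound (f := fun r => p r ξ) (c := γ ξ)
    (ρ := |ε * bond (ε * ξ) W x|) (r := ε * bond (ε * ξ) W x) (s := 0)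
    ((hF.p_contDiff ξ hξ).differentiable (by simp)) (hF.gamma_nonneg ξ hξ)
    (fun r hr => hs x ξ r hξ (by rwa [bond, mul_sub] at hr)) le_rfl (by rw [abs_zero]; positivity)
  rw [hF.p_zero ξ hξ, sub_zero, sub_zero] at h
  exact h.trans (le_of_eq (by ring))

theorem solvesWeak_clampLaw_iff {ε : ℝ} {W : L2R}
    (hs : ∀ ξ x, 0 < ξ → |ε * bond (ε * ξ) W x| ≤ 1) :
    SolvesWeak α β (clampLaw p) ε W ↔ SolvesWeak α β p ε W :=
  solvesWeak_congr fun ξ x hξ => clampLaw_eq p (hs ξ x hξ) ξ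

theorem kdvCoeff₁_pos (hF : ForceAssumption F α β γ p) : 0 < kdvCoeff₁ α :=
  div_pos (by norm_num) hF.alpha_four_pos

theorem kdvSoliton_eq (hF : ForceAssumption F α β γ p) :
    kdvSoliton α β = soliton (Real.sqrt (kdvCoeff₁ α)) (moment β 3) := by
  ext1 x
  rw [kdvSoliton, soliton, sechSq]
  congr 1
  have h1 := hF.alpha_four_pos
  have h2 := hF.beta_three_pos
  rw [kdvCoeff₁, kdvCoeff₂, moment]
  field_simp

end ForceAssumption

theorem distSoliton_eq {α β : ℝ → ℝ} {κ q : ℝ} (hκ : 0 < κ) (hq : 0 < q)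
    (h : kdvSoliton α β = soliton κ q) (W : L2R) :
    distSoliton α β W = ENNReal.ofReal ‖W - solitonLp hκ hq‖ := by
  rw [distSoliton, Lp.norm_def, ENNReal.ofReal_toReal (Lp.eLpNorm_ne_top _)]
  refine eLpNorm_congr_ae ?_
  filter_upwards [Lp.coeFn_sub W (solitonLp hκ hq), solitonLp_coe hκ hq] with x h1 h2
  rw [h1, Pi.sub_apply, h2, h]

end Peridynamics

theorem mainTheorem1 (F : ℝ → ℝ → ℝ) (α β γ : ℝ → ℝ) (p : ℝ → ℝ → ℝ)
    (hF : Peridynamics.ForceAssumption F α β γ p) :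
    ∃ ε₀ > (0 : ℝ), ∃ δ > (0 : ℝ), ∃ C > (0 : ℝ), ∀ ε : ℝ, 0 < ε → ε ≤ ε₀ →
      ∃ W : Lp ℝ 2 (volume : Measure ℝ),
        Peridynamics.IsEven W ∧
        Peridynamics.SolvesScaledEquation F ε (Peridynamics.waveSpeed α ε) W ∧
        Peridynamics.HasSmallStrains ε W ∧
        Peridynamics.distSoliton α β W ≤ ENNReal.ofReal δ ∧
        Peridynamics.distSoliton α β W ≤ ENNReal.ofReal (C * ε ^ 2) ∧
        Peridynamics.SolvesPeridynamicEquation F (Peridynamics.displacement α ε W) ∧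
        ∀ W' : Lp ℝ 2 (volume : Measure ℝ),
          Peridynamics.IsEven W' →
          Peridynamics.SolvesScaledEquation F ε (Peridynamics.waveSpeed α ε) W' →
          Peridynamics.StrainsInRange γ p ε W' →
          Peridynamics.distSoliton α β W' ≤ ENNReal.ofReal δ →
          W' = W := by
  open Peridynamics in
  have hG := hF.globalLaw
  have hκ : 0 < Real.sqrt (kdvCoeff₁ α) := Real.sqrt_pos.2 hF.kdvCoeff₁_pos
  have hκα : Real.sqrt (kdvCoeff₁ α) ^ 2 * moment α 4 = 12 := by
    rw [Real.sq_sqrt hF.kdvCoeff₁_pos.le, kdvCoeff₁]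
    exact div_mul_cancel₀ _ hF.alpha_four_pos.ne'
  have hdist := distSoliton_eq hκ hG.beta_three_pos hF.kdvSoliton_eq
  obtain ⟨ε₁, hε₁, hε₁1, δ, hδ, hδ1, C, hC, hsol⟩ := hG.exists_solution hκ hκα
  set W₀ := solitonLp hκ hG.beta_three_pos with hW₀
  have hq := hG.beta_three_pos
  have hγ : 0 ≤ moment γ 3 + moment γ 4 := add_nonneg
    (setIntegral_nonneg measurableSet_Ioi fun ξ hξ =>
      mul_nonneg (hF.gamma_nonneg ξ hξ) (pow_nonneg (le_of_lt hξ) _))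
    (setIntegral_nonneg measurableSet_Ioi fun ξ hξ =>
      mul_nonneg (hF.gamma_nonneg ξ hξ) (pow_nonneg (le_of_lt hξ) _))
  -- Since `δ ≤ 1`, every candidate has norm at most `‖W₀‖ + 1`, so `K` bounds all its increments;
  -- `ε ≤ 1 / K` then brings the strains below 1.
  set K := moment β 3 * (‖W₀‖ + 1) ^ 2 + (moment γ 3 + moment γ 4) * (‖W₀‖ + 1) ^ 3 with hK
  have hK0 : 0 < K := by positivity
  -- Stated for a general law because it is applied to the frozen law for existence and to the
  -- original one for uniqueness.
  have hsmall : ∀ (P : ℝ → ℝ → ℝ) (ε : ℝ) (V : L2R), 0 < ε → ε ≤ min ε₁ (1 / K) →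
      ‖V - W₀‖ ≤ δ → SolvesWeak α β P ε V →
      (∀ ξ x, 0 < ξ → |lawStress P ε V ξ x| ≤ γ ξ * |ε * bond (ε * ξ) V x| ^ 3) →
      ∀ ξ x, 0 < ξ → |ε * bond (ε * ξ) V x| ≤ 1 := by
    intro P ε V hε hεε hV hweak hb ξ x hξ
    have hn : ‖V‖ ≤ ‖W₀‖ + 1 := by
      have := norm_add_le (V - W₀) W₀
      rw [sub_add_cancel] at this
      linarith
    have h1 := hweak.abs_bond_le hF.alpha_nonneg hF.alpha_two hF.beta_nonneg hF.beta_three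
      hF.gamma_nonneg hF.gamma_three hF.gamma_four hε
      ((hεε.trans (min_le_left _ _)).trans hε₁1) hb (by positivity : 0 ≤ ε * ξ) x
    have h2 : |bond (ε * ξ) V x| ≤ K := h1.trans (by rw [hK]; gcongr)
    have h3 := hεε.trans (min_le_right _ _)
    rw [le_div_iff₀ hK0] at h3
    rw [abs_mul, abs_of_pos hε]
    exact (mul_le_mul_of_nonneg_left h2 hε.le).trans h3
  refine ⟨min ε₁ (1 / K), lt_min hε₁ (by positivity), δ, hδ, C, hC, fun ε hε hεε => ?_⟩
  obtain ⟨W, heven, hwave, hWδ, hWC, huniq⟩ := hsol ε hε (hεε.trans (min_le_left _ _))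
  have hweak := (hG.solvesWeak_iff hε W).2 hwave
  have hs := hsmall (clampLaw p) ε W hε hεε hWδ hweak fun ξ x hξ => hG.abs_le hξ _
  have hscaled := (hF.solvesScaledEquation_iff_solvesWeak hε (hF.abs_lawStress_le_of_small hs)).2
    ((ForceAssumption.solvesWeak_clampLaw_iff hs).1 hweak)
  refine ⟨W, (isEven_iff W).2 heven, hscaled, fun x ξ hξ => ?_, ?_, ?_,
    hscaled.solvesPeridynamicEquation hε hF.continuous_force, fun W' he' hsc' hr' hd' => ?_⟩
  · rw [← mul_sub]
    exact hs ξ x hξ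
  · rw [hdist]
    exact ENNReal.ofReal_le_ofReal hWδ
  · rw [hdist]
    exact ENNReal.ofReal_le_ofReal hWC
  · rw [hdist, ENNReal.ofReal_le_ofReal_iff hδ.le] at hd'
    have hb := hF.abs_lawStress_le_of_range hr'
    have hweak' := (hF.solvesScaledEquation_iff_solvesWeak hε hb).1 hsc'
    -- A competitor may initially have strains beyond 1, as long as the derivative bound holds
    -- there. The equation itself makes them small, so the competitor also solves the frozen
    -- problem, where uniqueness is known.
    have hs' := hsmall p ε W' hε hεε hd' hweak' hb
    exact huniq W' ((isEven_iff W').1 he')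
      ((hG.solvesWeak_iff hε W').1 ((ForceAssumption.solvesWeak_clampLaw_iff hs').2 hweak')) hd'
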